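/- Let $P$ be a probability distribution with finite support. Let $y_j>0$ ($j$ in a finite index set) be its distinct nonzero probabilities and let $h_j\ge 1$ be the number of domain elements of probability $y_j$, so $\sum_j h_j y_j=1$. Let $k>0$ be the (mean) number of samples and let $\varepsilon>0$ be the $\ell_1$ distance parameter. Write $\mathrm{poi}(\lambda,i)=e^{-\lambda}\lambda^i/i!$. Optimal values below are taken in the extended reals, with $0\cdot\infty=0$; infima and suprema need not be attained unless attainment is stated. *Original program.* Over real tables $c=(c_{i,j})_{i\ge 0,\,j}$, let $$R=\min_{c}\max\Big\{\max_{Q}\ \min_{t\le 0}\sum_{j,x}Q_{j,x}\log\sum_i e^{t c_{i,j}}\mathrm{poi}(kx,i)\,,\ \min_{t'\ge 0}\sum_j h_j\log\sum_i e^{t' c_{i,j}}\mathrm{poi}(ky_j,i)\Big\},$$ where $Q=(Q_{j,x})_{j,\,x\ge0}$ ranges over finitely supported arrays of nonnegative reals with $\sum_x Q_{j,x}=h_j$ for every $j$ and $\sum_j\sum_x Q_{j,x}|x-y_j|\ge\varepsilon$. *Nested program.* Let $V$ be the value of $$\min_{\alpha\le 0,\ u\in[0,1]}\Big(\varepsilon\alpha(1-u)+\sum_j\min_{\kappa_{\cdot,j}}\Big(u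 h_j\log\sum_i e^{(1-u)\kappa_{i,j}}\mathrm{poi}(ky_j,i)+(1-u)h_j\max_{x\ge 0}\big(-\alpha|x-y_j|+\log\sum_i e^{-u\kappa_{i,j}}\mathrm{poi}(kx,i)\big)\Big)\Big),$$ with real $\kappa_{i,j}$. *Claim.* The nested program has an optimal point $(\alpha,u,\kappa)$, that is, one at which the outer minimum and each inner minimum over $\kappa_{\cdot,j}$ are attained. For every optimal point, $\alpha<0$ and $u\in(0,1)$, and there are, for each $j$, $q_j\in(0,1)$ and $0\le x_{1,j}<y_j<x_{2,j}$ such that: 1. the coefficients $$\hat\kappa_{i,j}=\log\frac{q_j\,\mathrm{poi}(kx_{1,j},i)+(1-q_j)\,\mathrm{poi}(kx_{2,j},i)}{\mathrm{poi}(ky_j,i)}$$ are optimal for these $\alpha,u$, and $\kappa_{\cdot,j}$ equals $\hat\kappa_{\cdot,j}$ up to an additive constant depending only on $j$; 2. the value satisfies $V=E=R$, where $$E=\varepsilon\alpha(1-u)+\sum_j h_j\log\frac{\sum_i\big(q_j\,\mathrm{poi}(kx_{1,j},i)+(1-q_j)\,\mathrm{poi}(kx_{2,j},i)\big)^{1-u}\mathrm{poi}(ky_j,i)^{u}}{\big(q_je^{\alpha|x_{1,j}-y_j|}+(1-q_j)e^{\alpha|x_{2,j}-y_j|}\big)^{1-u}};$$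 3. at these $\alpha,u,q,x_1,x_2$, the partial derivatives of $E$ with respect to $\alpha$, to $u$ and to each $q_j$ exist and equal $0$. -/

import Mathlib

open scoped NNReal ENNReal

namespace SemilinearTest

noncomputable section

/-- The Poisson probability `poi(l, i) = e^{-l} l^i / i!` (with `0 ^ 0 = 1`). -/
def poi (l : ℝ) (i : ℕ) : ℝ := Real.exp (-l) * l ^ i / (i.factorial : ℝ)

/-- `log ∑ᵢ e^{c i} poi(l, i)` as an extended real; it is `⊤` when the series diverges. -/
def logMGF (c : ℕ → ℝ) (l : ℝ) : EReal :=
  ENNReal.log (∑' i, ENNReal.ofReal (Real.exp (c i) * poi l i))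

variable {J : Type*} [Fintype J]

/-! In what follows `J` indexes the distinct probabilities of the hypothesis, `y j` is the
`j`-th probability, `h j` the number of domain elements of that probability, `k` the (mean)
number of samples, `ε` the `ℓ₁` distance. -/

/-- Relaxed histograms `Q`: for each class `j` finitely many locations `x ≥ 0` carry nonnegative
(not necessarily integral) amounts `Q j x` of domain elements, the total amount in class `j` is
`h j`, and the `ℓ₁` distance from the hypothesis is at least `ε`. -/
def IsFarHistogram (y : J → ℝ) (h : J → ℕ) (ε : ℝ) (Q : J → ℝ≥0 →₀ ℝ≥0) : Prop :=
  (∀ j, (Q j).sum (fun _ w => w) = (h j : ℝ≥0)) ∧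
    ε ≤ ∑ j, (Q j).sum (fun x w => (w : ℝ) * |(x : ℝ) - y j|)

/-- The log of the Chernoff bound on accepting when sampling from the histogram `Q`. -/
def logErrFar (k : ℝ) (c : ℕ → J → ℝ) (Q : J → ℝ≥0 →₀ ℝ≥0) : EReal :=
  ⨅ (t : ℝ) (_ : t ≤ 0), ∑ j, (Q j).sum
    (fun x w => ((w : ℝ) : EReal) * logMGF (fun i => t * c i j) (k * x))

/-- The log of the Chernoff bound on rejecting when sampling from the hypothesis. -/
def logErrNull (y : J → ℝ) (h : J → ℕ) (k : ℝ) (c : ℕ → J → ℝ) : EReal :=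
  ⨅ (t : ℝ) (_ : 0 ≤ t), ∑ j, ((h j : ℝ) : EReal) * logMGF (fun i => t * c i j) (k * y j)

/-- Value of the original program: the best Chernoff bound on the log of the failure probability
over all tables `c` of semilinear coefficients. -/
def relaxedValue (y : J → ℝ) (h : J → ℕ) (k ε : ℝ) : EReal :=
  ⨅ c : ℕ → J → ℝ,
    max (⨆ (Q : J → ℝ≥0 →₀ ℝ≥0) (_ : IsFarHistogram y h ε Q), logErrFar k c Q)
      (logErrNull y h k c)

/-- The objective of the inner minimization of the nested program, for a class of `h` elements
of probability `y`. Products in `EReal` follow the convention `0 * ⊤ = 0`. -/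
def innerObj (k y : ℝ) (h : ℕ) (α u : ℝ) (κ : ℕ → ℝ) : EReal :=
  ((u * h : ℝ) : EReal) * logMGF (fun i => (1 - u) * κ i) (k * y) +
    (((1 - u) * h : ℝ) : EReal) *
      ⨆ x : ℝ≥0, (((-α * |(x : ℝ) - y| : ℝ) : EReal) + logMGF (fun i => -u * κ i) (k * x))

/-- The value of the inner minimization over `κ`. -/
def innerValue (k y : ℝ) (h : ℕ) (α u : ℝ) : EReal :=
  ⨅ κ : ℕ → ℝ, innerObj k y h α u κ

/-- The objective of the outer minimization of the nested program. -/
def outerObj (y : J → ℝ) (h : J → ℕ) (k ε α u : ℝ) : EReal :=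
  ((ε * α * (1 - u) : ℝ) : EReal) + ∑ j, innerValue k (y j) (h j) α u

/-- Value of the nested program. -/
def nestedValue (y : J → ℝ) (h : J → ℕ) (k ε : ℝ) : EReal :=
  ⨅ (α : ℝ) (_ : α ≤ 0) (u : ℝ) (_ : u ∈ Set.Icc (0 : ℝ) 1), outerObj y h k ε α u

/-- `(α, u, κ)` is an optimal point of the nested program: `(α, u)` is feasible and attains the
outer minimum, and each `κ · j` attains the inner minimum for class `j`. -/
structure IsNestedOptimum (y : J → ℝ) (h : J → ℕ) (k ε α u : ℝ) (κ : ℕ → J → ℝ) : Prop where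
  alpha_nonpos : α ≤ 0
  u_mem : u ∈ Set.Icc (0 : ℝ) 1
  outer : outerObj y h k ε α u = nestedValue y h k ε
  inner : ∀ j, innerObj k (y j) (h j) α u (fun i => κ i j) = innerValue k (y j) (h j) α u

/-- `log ((q poi(k x₁, i) + (1 - q) poi(k x₂, i)) / poi(k y, i))`. -/
def twoPointCoeff (k y q x₁ x₂ : ℝ) (i : ℕ) : ℝ :=
  Real.log ((q * poi (k * x₁) i + (1 - q) * poi (k * x₂) i) / poi (k * y) i)

/-- The explicit expression for the optimal value. -/
def explicitValue (y : J → ℝ) (h : J → ℕ) (k ε α u : ℝ) (q x₁ x₂ : J → ℝ) : ℝ :=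
  ε * α * (1 - u) + ∑ j, (h j : ℝ) * Real.log
    ((∑' i, (q j * poi (k * x₁ j) i + (1 - q j) * poi (k * x₂ j) i) ^ (1 - u) *
        (poi (k * y j) i) ^ u) /
      (q j * Real.exp (α * |x₁ j - y j|) + (1 - q j) * Real.exp (α * |x₂ j - y j|)) ^ (1 - u))

end

end SemilinearTest

namespace SemilinearTest
open Filter Topology Set

/-! Put `m = k y`, `l = k x` and `b = -α / k`. For `0 < u < 1` the inner minimum is dual to
maximizing the affinity `∑ M ^ (1 - u) poi(m) ^ u` over mixtures `M` of the tilted weights `e ^ (b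
|l - m|) poi(l)`. Hölder's inequality (`log_aff_le`) is weak duality, and its equality case forces
`κ = log (M / poi(m))` up to a constant, which is the uniqueness claim. There is no gap once `M`
satisfies the first order condition `field ≤ aff` at every location, because that is exactly the
bound needed on the inner supremum (`IsSaddle.sup_le`, `innerValue_saddle`).

The core is that two locations suffice, one on each side of `m`. The affinity is maximized over
two-point mixtures with locations in `[0, m]` and `[m, ∞)`; the half-line is compactified by `z = e
^ (-l)`, since tilted weights vanish at infinity when `b < 1`. On each side the first order
conditions say that the weights `(M / poi(m)) ^ (-u)`, renormalized, form a log-concave density of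
mass one and correct mean against a Poisson law (with a boundary variant at location `0`). Such a
density minus one has signs `-, +, -`; comparison with a secant of the convex function `i ↦ ρ ^ i`
shows that every other Poisson law gives it mass below one (`tsum_mul_poi_lt_one`). Local conditions
are therefore global on each side (`IsMaxMix.isSaddle`), and strictness yields uniqueness and hence
continuity of the saddle in `b`.

For the outer minimum, the objective is `⊤` when `u < 1` and either `b ≥ 1` or `b > 0 = u`, it is
nonnegative when `b = 0` or `u = 1`, and `nestedValue_neg` produces a negative value; lower
semicontinuity on the unit square then gives a minimizer, and every minimizer is interior.
Stationarity in `b` (`sum_dist_eq`) says that the two-point histograms lie at distance exactly `ε`;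
stationarity in `u` (`sum_mean_log_eq`) fixes the mean log density. These identities give the
vanishing derivatives in `α` and `u`, and maximality in the mixture weight gives those in `q`.

They also solve the original program. The table of log densities, shifted by a common constant,
makes both error bounds at most `V` (`relaxedValue_le`). Conversely the saddle histogram is a
feasible adversary, and the Gibbs variational principle applied to one common tilted law shows that
no table does better (`le_relaxedValue`). -/

theorem hasSum_of_eq {f g : ℕ → ℝ} {a b : ℝ} (h : HasSum f a) (hfg : ∀ i, g i = f i)
    (hab : b = a) : HasSum g b := by
  rw [hab, funext hfg]; exact h

/-! ### Poisson weights -/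

theorem poi_nonneg {l : ℝ} (hl : 0 ≤ l) (i : ℕ) : 0 ≤ poi l i := by
  unfold poi; positivity

theorem poi_pos {l : ℝ} (hl : 0 < l) (i : ℕ) : 0 < poi l i := by
  unfold poi; positivity

theorem poi_zero_right (l : ℝ) : poi l 0 = Real.exp (-l) := by simp [poi]

theorem poi_one_right (l : ℝ) : poi l 1 = Real.exp (-l) * l := by simp [poi]

theorem poi_zero_left_succ (i : ℕ) : poi 0 (i + 1) = 0 := by simp [poi]

/-- The probability generating function of the Poisson weights. -/
theorem hasSum_pow_mul_poi (D l : ℝ) :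
    HasSum (fun i => D ^ i * poi l i) (Real.exp (l * (D - 1))) := by
  have h := (NormedSpace.expSeries_div_hasSum_exp (D * l)).mul_left (Real.exp (-l))
  rw [← Real.exp_eq_exp_ℝ, ← Real.exp_add] at h
  have e1 : (fun i => D ^ i * poi l i) = fun i : ℕ => Real.exp (-l) * ((D * l) ^ i / i.factorial) := by
    funext i; simp only [poi, mul_pow]; ring
  have e2 : l * (D - 1) = -l + D * l := by ring
  rw [e1, e2]
  exact h

theorem hasSum_poi (l : ℝ) : HasSum (poi l) 1 := by
  simpa using hasSum_pow_mul_poi 1 l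

theorem summable_poi (l : ℝ) : Summable (poi l) := (hasSum_poi l).summable

theorem succ_mul_poi_succ (l : ℝ) (i : ℕ) : ((i + 1 : ℕ) : ℝ) * poi l (i + 1) = l * poi l i := by
  simp only [poi, Nat.factorial_succ, Nat.cast_mul, pow_succ]
  have h1 : ((i + 1 : ℕ) : ℝ) ≠ 0 := by positivity
  have h2 : (i.factorial : ℝ) ≠ 0 := by positivity
  field_simp

/-- The mean under the tilted Poisson weights. -/
theorem hasSum_nat_mul_pow_mul_poi (D l : ℝ) :
    HasSum (fun i : ℕ => (i : ℝ) * (D ^ i * poi l i)) (D * l * Real.exp (l * (D - 1))) := by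
  rw [← hasSum_nat_add_iff' 1]
  have h := (hasSum_pow_mul_poi D l).mul_left (D * l)
  simp only [Finset.range_one, Finset.sum_singleton, Nat.cast_zero, zero_mul, sub_zero]
  have e1 : (fun i : ℕ => ((i + 1 : ℕ) : ℝ) * (D ^ (i + 1) * poi l (i + 1))) =
      fun i => D * l * (D ^ i * poi l i) := by
    funext i
    calc ((i + 1 : ℕ) : ℝ) * (D ^ (i + 1) * poi l (i + 1))
        = D ^ (i + 1) * (((i + 1 : ℕ) : ℝ) * poi l (i + 1)) := by ring
      _ = D * l * (D ^ i * poi l i) := by rw [succ_mul_poi_succ]; ring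
  rw [e1]
  exact h

theorem poi_le_one {l : ℝ} (hl : 0 ≤ l) (i : ℕ) : poi l i ≤ 1 :=
  le_hasSum (hasSum_poi l) i fun j _ => poi_nonneg hl j

/-- A change of the parameter of the Poisson weights. -/
theorem poi_mul_eq (D l : ℝ) (i : ℕ) :
    poi (D * l) i = Real.exp (l * (1 - D)) * (D ^ i * poi l i) := by
  simp only [poi, mul_pow]
  have : Real.exp (-(D * l)) = Real.exp (l * (1 - D)) * Real.exp (-l) := by
    rw [← Real.exp_add]; congr 1; ring
  rw [this]; ring

theorem nat_cast_le_two_pow (i : ℕ) : (i : ℝ) ≤ 2 ^ i := by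
  exact_mod_cast (Nat.lt_two_pow_self (n := i)).le

/-- Powers of Poisson weights decay faster than any geometric sequence grows. -/
theorem summable_pow_mul_poi_rpow {D l u : ℝ} (hD : 0 < D) (hl : 0 < l) (hu : 0 < u) :
    Summable (fun i => D ^ i * poi l i ^ u) := by
  -- `R` is chosen so that `R ^ u = 2 D`: the bound `R ^ i poi(l, i) ≤ e ^ (l (R - 1))`, raised to
  -- the power `u`, then leaves a spare factor `2 ^ (-i)`.
  set R : ℝ := (2 * D) ^ (1 / u) with hR
  have hR0 : 0 < R := by positivity
  have hRu : R ^ u = 2 * D := by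
    rw [hR, ← Real.rpow_mul (by positivity)]; field_simp; simp
  have key : ∀ i, D ^ i * poi l i ^ u ≤
      (Real.exp (l * (R - 1))) ^ u * (1 / 2 : ℝ) ^ i := by
    intro i
    have h1 : R ^ i * poi l i ≤ Real.exp (l * (R - 1)) :=
      le_hasSum (hasSum_pow_mul_poi R l) i fun j _ =>
        mul_nonneg (by positivity) (poi_nonneg hl.le j)
    have h2 : (R ^ i * poi l i) ^ u ≤ (Real.exp (l * (R - 1))) ^ u :=
      Real.rpow_le_rpow (mul_nonneg (by positivity) (poi_nonneg hl.le i)) h1 hu.le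
    rw [Real.mul_rpow (by positivity) (poi_nonneg hl.le i)] at h2
    have h3 : (R ^ i) ^ u = 2 ^ i * D ^ i := by
      rw [← Real.rpow_natCast, ← Real.rpow_mul hR0.le, mul_comm, Real.rpow_mul hR0.le, hRu,
        Real.rpow_natCast, mul_pow]
    rw [h3] at h2
    calc D ^ i * poi l i ^ u = (2 ^ i * D ^ i * poi l i ^ u) * (1 / 2 : ℝ) ^ i := by
          have : (2 : ℝ) ^ i * (1 / 2 : ℝ) ^ i = 1 := by rw [← mul_pow]; norm_num
          linear_combination (-(D ^ i * poi l i ^ u)) * this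
      _ ≤ _ := by gcongr
  refine Summable.of_nonneg_of_le (fun i => ?_) key
    ((summable_geometric_of_lt_one (by norm_num) (by norm_num)).mul_left _)
  have := poi_nonneg hl.le i
  positivity

/-! ### The weighted arithmetic-geometric mean inequality in tangent form -/

theorem rpow_mul_rpow_le {u X Y : ℝ} (hu : u ∈ Ioo (0 : ℝ) 1) (hX : 0 ≤ X) (hY : 0 ≤ Y) :
    X ^ (1 - u) * Y ^ u ≤ (1 - u) * X + u * Y :=
  Real.geom_mean_le_arith_mean2_weighted (by linarith [hu.2]) hu.1.le hX hY (by ring)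

/-- Strict concavity of `log` handles `X > 0`. At `X = 0` the left side vanishes while the right
side is `u * Y > 0`. -/
theorem eq_of_rpow_mul_rpow_eq {u X Y : ℝ} (hu : u ∈ Ioo (0 : ℝ) 1) (hX : 0 ≤ X) (hY : 0 < Y)
    (h : X ^ (1 - u) * Y ^ u = (1 - u) * X + u * Y) : X = Y := by
  have h1 : 0 < 1 - u := by linarith [hu.2]
  rcases hX.eq_or_lt with rfl | hX
  · rw [Real.zero_rpow h1.ne'] at h
    nlinarith [mul_pos hu.1 hY]
  have hc := strictConcaveOn_log_Ioi
  by_contra hne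
  have h2 := hc.2 (mem_Ioi.2 hX) (mem_Ioi.2 hY) hne h1 hu.1 (by ring)
  simp only [smul_eq_mul] at h2
  rw [← h, Real.log_mul (by positivity) (by positivity), Real.log_rpow hX, Real.log_rpow hY] at h2
  exact lt_irrefl _ h2

/-- `wt u p M = (M / p) ^ (-u)`, the derivative of `M ↦ M ^ (1 - u) p ^ u` up to `1 - u`. -/
noncomputable def wt (u : ℝ) (p M : ℕ → ℝ) (i : ℕ) : ℝ := (M i / p i) ^ (-u)

/-- The affinity `∑ M ^ (1 - u) p ^ u`. -/
noncomputable def aff (u : ℝ) (p M : ℕ → ℝ) : ℝ := ∑' i, M i ^ (1 - u) * p i ^ u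

section wt
variable {u : ℝ} {p M N : ℕ → ℝ}

theorem wt_pos (hp : ∀ i, 0 < p i) (hM : ∀ i, 0 < M i) (i : ℕ) : 0 < wt u p M i :=
  Real.rpow_pos_of_pos (div_pos (hM i) (hp i)) _

theorem wt_mul_self (hp : ∀ i, 0 < p i) (hM : ∀ i, 0 < M i) (i : ℕ) :
    wt u p M i * M i = M i ^ (1 - u) * p i ^ u := by
  unfold wt
  rw [Real.div_rpow (hM i).le (hp i).le, Real.rpow_neg (hp i).le, div_inv_eq_mul,
    sub_eq_neg_add, Real.rpow_add (hM i), Real.rpow_one]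
  ring

/-- The tangent inequality for the concave function `M ↦ M ^ (1 - u) p ^ u`. -/
theorem tangent_le (hu : u ∈ Ioo (0 : ℝ) 1) (hp : ∀ i, 0 < p i) (hM : ∀ i, 0 < M i)
    {i : ℕ} (hN : 0 ≤ N i) :
    N i ^ (1 - u) * p i ^ u ≤
      M i ^ (1 - u) * p i ^ u + (1 - u) * (wt u p M i * N i - wt u p M i * M i) := by
  have h := rpow_mul_rpow_le hu hN (hM i).le
  have hMu : M i ^ u ≠ 0 := (Real.rpow_pos_of_pos (hM i) _).ne'
  have e1 : N i ^ (1 - u) * p i ^ u = wt u p M i * (N i ^ (1 - u) * M i ^ u) := by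
    unfold wt
    rw [Real.div_rpow (hM i).le (hp i).le, Real.rpow_neg (hp i).le, Real.rpow_neg (hM i).le]
    field_simp
  rw [e1, ← wt_mul_self hp hM]
  nlinarith [mul_le_mul_of_nonneg_left h (wt_pos (u := u) hp hM i).le]

theorem eq_of_tangent_eq (hu : u ∈ Ioo (0 : ℝ) 1) (hp : ∀ i, 0 < p i) (hM : ∀ i, 0 < M i)
    {i : ℕ} (hN : 0 ≤ N i) (h : N i ^ (1 - u) * p i ^ u =
      M i ^ (1 - u) * p i ^ u + (1 - u) * (wt u p M i * N i - wt u p M i * M i)) : N i = M i := by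
  have hMu : M i ^ u ≠ 0 := (Real.rpow_pos_of_pos (hM i) _).ne'
  have e1 : N i ^ (1 - u) * p i ^ u = wt u p M i * (N i ^ (1 - u) * M i ^ u) := by
    unfold wt
    rw [Real.div_rpow (hM i).le (hp i).le, Real.rpow_neg (hp i).le, Real.rpow_neg (hM i).le]
    field_simp
  rw [e1, ← wt_mul_self hp hM] at h
  refine eq_of_rpow_mul_rpow_eq hu hN (hM i) ?_
  have := (wt_pos (u := u) hp hM i).ne'
  apply mul_left_cancel₀ this
  linarith

theorem aff_term_nonneg (hp : ∀ i, 0 ≤ p i) (hM : ∀ i, 0 ≤ M i) (i : ℕ) :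
    0 ≤ M i ^ (1 - u) * p i ^ u :=
  mul_nonneg (Real.rpow_nonneg (hM i) _) (Real.rpow_nonneg (hp i) _)

theorem summable_aff (hu : u ∈ Ioo (0 : ℝ) 1) (hp : ∀ i, 0 ≤ p i) (hM : ∀ i, 0 ≤ M i)
    (sp : Summable p) (sM : Summable M) : Summable (fun i => M i ^ (1 - u) * p i ^ u) :=
  Summable.of_nonneg_of_le (aff_term_nonneg hp hM) (fun i => rpow_mul_rpow_le hu (hM i) (hp i))
    ((sM.mul_left _).add (sp.mul_left _))

theorem summable_wt_mul_self (hu : u ∈ Ioo (0 : ℝ) 1) (hp : ∀ i, 0 < p i) (hM : ∀ i, 0 < M i)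
    (sp : Summable p) (sM : Summable M) : Summable (fun i => wt u p M i * M i) := by
  simp only [wt_mul_self hp hM]
  exact summable_aff hu (fun i => (hp i).le) (fun i => (hM i).le) sp sM

theorem tsum_wt_mul_self (hp : ∀ i, 0 < p i) (hM : ∀ i, 0 < M i) :
    ∑' i, wt u p M i * M i = aff u p M := by
  simp only [wt_mul_self hp hM, aff]

/-- The summed tangent inequality. -/
theorem aff_le_of_tangent (hu : u ∈ Ioo (0 : ℝ) 1) (hp : ∀ i, 0 < p i) (hM : ∀ i, 0 < M i)
    (hN : ∀ i, 0 ≤ N i) (sp : Summable p) (sM : Summable M) (sN : Summable N)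
    (sw : Summable fun i => wt u p M i * N i) :
    aff u p N ≤ aff u p M + (1 - u) * (∑' i, wt u p M i * N i - aff u p M) := by
  have sM' := summable_wt_mul_self hu hp hM sp sM
  have sA := summable_aff hu (fun i => (hp i).le) (fun i => (hM i).le) sp sM
  rw [← tsum_wt_mul_self hp hM, ← sw.tsum_sub sM', ← tsum_mul_left,
    tsum_wt_mul_self hp hM]
  unfold aff
  rw [← sA.tsum_add ((sw.sub sM').mul_left _)]
  exact (summable_aff hu (fun i => (hp i).le) hN sp sN).tsum_le_tsum
    (fun i => tangent_le hu hp hM (hN i)) (sA.add ((sw.sub sM').mul_left _))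

/-- Equality in the summed tangent inequality. -/
theorem eq_of_aff_eq_tangent (hu : u ∈ Ioo (0 : ℝ) 1) (hp : ∀ i, 0 < p i) (hM : ∀ i, 0 < M i)
    (hN : ∀ i, 0 ≤ N i) (sp : Summable p) (sM : Summable M) (sN : Summable N)
    (sw : Summable fun i => wt u p M i * N i)
    (h : aff u p M + (1 - u) * (∑' i, wt u p M i * N i - aff u p M) ≤ aff u p N) (i : ℕ) :
    N i = M i := by
  have sM' := summable_wt_mul_self hu hp hM sp sM
  have sA := summable_aff hu (fun i => (hp i).le) (fun i => (hM i).le) sp sM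
  have sN' := summable_aff hu (fun i => (hp i).le) hN sp sN
  by_contra hne
  have hlt : N i ^ (1 - u) * p i ^ u <
      M i ^ (1 - u) * p i ^ u + (1 - u) * (wt u p M i * N i - wt u p M i * M i) :=
    lt_of_le_of_ne (tangent_le hu hp hM (hN i)) fun he => hne (eq_of_tangent_eq hu hp hM (hN i) he)
  have h2 := sN'.tsum_lt_tsum
    (fun i => tangent_le hu hp hM (hN i)) hlt (sA.add ((sw.sub sM').mul_left (1 - u)))
  rw [sA.tsum_add ((sw.sub sM').mul_left _), tsum_mul_left, sw.tsum_sub sM',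
    tsum_wt_mul_self hp hM] at h2
  exact absurd h (not_le.2 h2)

/-- Exponential lower bounds on `M / p` give exponential upper bounds on the weights. -/
theorem wt_le_of_le (hu : 0 ≤ u) (hp : ∀ i, 0 < p i) {c d : ℝ} (hc : 0 < c) (hd : 0 < d)
    {i : ℕ} (h : c * d ^ i * p i ≤ M i) : wt u p M i ≤ c ^ (-u) * (d ^ (-u)) ^ i := by
  unfold wt
  have h1 : c * d ^ i ≤ M i / p i := by rw [le_div_iff₀ (hp i)]; exact h
  have h2 : (M i / p i) ^ (-u) ≤ (c * d ^ i) ^ (-u) :=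
    Real.rpow_le_rpow_of_nonpos (by positivity) h1 (by linarith)
  refine h2.trans_eq ?_
  rw [Real.mul_rpow hc.le (by positivity), ← Real.rpow_natCast, ← Real.rpow_mul hd.le,
    mul_comm (i : ℝ), Real.rpow_mul hd.le, Real.rpow_natCast]

end wt

/-! ### Log-concave densities with respect to a Poisson law -/

section unimodal
variable {f : ℕ → ℝ}

/-- Log-concavity makes the ratios `f (i + 1) / f i` nonincreasing, so one upward step forces all
earlier steps to be upward. -/
theorem le_of_logConcave_of_le (hf : ∀ i, 0 < f i) (hc : ∀ i, f i * f (i + 2) ≤ f (i + 1) ^ 2)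
    (n : ℕ) : ∀ i, f (i + n) ≤ f (i + n + 1) → f i ≤ f (i + n) := by
  induction n with
  | zero => intro i _; exact le_rfl
  | succ n ih =>
    intro i h
    have h1 : f (i + n) ≤ f (i + n + 1) := by
      have := hc (i + n)
      have h2 : f (i + n + 1) ≤ f (i + n + 2) := h
      by_contra hlt
      push Not at hlt
      nlinarith [hf (i + n + 1), hf (i + n), hf (i + n + 2),
        mul_lt_mul_of_pos_right hlt (hf (i + n + 2)),
        mul_le_mul_of_nonneg_left h2 (hf (i + n + 1)).le]
    exact (ih i h1).trans h1

theorem succ_le_of_logConcave (hf : ∀ i, 0 < f i) (hc : ∀ i, f i * f (i + 2) ≤ f (i + 1) ^ 2)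
    {j : ℕ} (h : f (j + 1) ≤ f j) (n : ℕ) : f (j + n + 1) ≤ f (j + n) ∧ f (j + n) ≤ f j := by
  induction n with
  | zero => exact ⟨h, le_rfl⟩
  | succ n ih =>
    refine ⟨?_, ih.1.trans ih.2⟩
    have := hc (j + n)
    have h2 := ih.1
    change f (j + n + 2) ≤ f (j + n + 1)
    by_contra hlt
    push Not at hlt
    nlinarith [hf (j + n + 1), hf (j + n), hf (j + n + 2),
      mul_lt_mul_of_pos_left hlt (hf (j + n)),
      mul_le_mul_of_nonneg_left h2 (hf (j + n + 1)).le]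

/-- Positive log-concave sequences are unimodal, so superlevel sets are intervals: this bounds the
number of sign changes of `f - c`. -/
theorem lt_of_logConcave (hf : ∀ i, 0 < f i) (hc : ∀ i, f i * f (i + 2) ≤ f (i + 1) ^ 2)
    {i j l : ℕ} (hij : i ≤ j) (hjl : j ≤ l) {c : ℝ} (hi : c < f i) (hl : c < f l) : c < f j := by
  obtain ⟨n, rfl⟩ := Nat.exists_eq_add_of_le hij
  obtain ⟨n', rfl⟩ := Nat.exists_eq_add_of_le hjl
  rcases le_total (f (i + n)) (f (i + n + 1)) with h | h
  · exact hi.trans_le (le_of_logConcave_of_le hf hc n i h)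
  · exact hl.trans_le (succ_le_of_logConcave hf hc h n').2

end unimodal

/-- The secant of `x ↦ ρ ^ x` through two integers. -/
theorem pow_sub_secant {ρ : ℝ} (hρ : 0 < ρ) (hρ1 : ρ ≠ 1) {a N : ℕ} (haN : a < N) :
    ∃ A B : ℝ, (∀ i : ℕ, i < a → A + B * i < ρ ^ i) ∧ (∀ i : ℕ, N < i → A + B * i < ρ ^ i) ∧
      (∀ i : ℕ, a < i → i < N → ρ ^ i < A + B * i) ∧ ρ ^ a = A + B * a ∧ ρ ^ N = A + B * N := by
  have hlog : Real.log ρ ≠ 0 := Real.log_ne_zero_of_pos_of_ne_one hρ hρ1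
  have hsc : StrictConvexOn ℝ univ (fun x : ℝ => ρ ^ x) := by
    refine ⟨convex_univ, fun x _ y _ hxy s t hs ht hst => ?_⟩
    simp only [Real.rpow_def_of_pos hρ]
    have := strictConvexOn_exp.2 (mem_univ (Real.log ρ * x)) (mem_univ (Real.log ρ * y))
      (fun h => hxy (mul_left_cancel₀ hlog h)) hs ht hst
    simp only [smul_eq_mul] at this ⊢
    convert this using 2
    ring
  have hNa : (0 : ℝ) < N - a := by
    have : (a : ℝ) < N := by exact_mod_cast haN
    linarith
  set B : ℝ := (ρ ^ N - ρ ^ a) / (N - a) with hB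
  have hBN : B * (N - a) = ρ ^ N - ρ ^ a := by rw [hB]; field_simp
  refine ⟨ρ ^ a - B * a, B, ?_, ?_, ?_, by ring, by linarith⟩
  · intro i hi
    have hi' : (i : ℝ) < a := by exact_mod_cast hi
    have h := hsc.slope_strict_mono_adjacent (mem_univ (i : ℝ)) (mem_univ (N : ℝ)) hi'
      (by exact_mod_cast haN)
    simp only [Real.rpow_natCast] at h
    rw [← hB, div_lt_iff₀ (by linarith)] at h
    linarith
  · intro i hi
    have hi' : (N : ℝ) < i := by exact_mod_cast hi
    have h := hsc.slope_strict_mono_adjacent (mem_univ (a : ℝ)) (mem_univ (i : ℝ))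
      (by exact_mod_cast haN) hi'
    simp only [Real.rpow_natCast] at h
    rw [← hB, lt_div_iff₀ (by linarith)] at h
    linarith
  · intro i hai hiN
    have h1 : (a : ℝ) < i := by exact_mod_cast hai
    have h2 : (i : ℝ) < N := by exact_mod_cast hiN
    have h := hsc.slope_strict_mono_adjacent (mem_univ (a : ℝ)) (mem_univ (N : ℝ)) h1 h2
    simp only [Real.rpow_natCast] at h
    rw [div_lt_div_iff₀ (by linarith) (by linarith)] at h
    have h3 : (ρ ^ i - ρ ^ a) * (N - a) < (ρ ^ N - ρ ^ a) * (i - a) := by linarith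
    rw [← hBN] at h3
    have h4 : ρ ^ i - ρ ^ a < B * (i - a) := by
      have : (ρ ^ i - ρ ^ a) * (N - a) < (B * (i - a)) * (N - a) := by linarith
      exact lt_of_mul_lt_mul_right this hNa.le
    linarith

/-- If a log-concave density with respect to the Poisson law of parameter `L` has total mass `1`
and mean `L`, its mean against any other Poisson law is less than `1`. -/
theorem tsum_mul_poi_lt_one {r : ℕ → ℝ} (hr : ∀ i, 0 < r i)
    (hc : ∀ i, r i * r (i + 2) ≤ r (i + 1) ^ 2) (hne : ∃ i, r i ≠ 1) {L : ℝ} (hL : 0 < L)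
    (h1 : HasSum (fun i => r i * poi L i) 1) (h2 : HasSum (fun i : ℕ => i * (r i * poi L i)) L) :
    r 0 ≤ 1 ∧ ∀ l : ℝ, 0 < l → l ≠ L → Summable (fun i => r i * poi l i) →
      ∑' i, r i * poi l i < 1 := by
  have hπ := poi_pos hL
  have s1 : HasSum (fun i => (r i - 1) * poi L i) 0 := by
    have := h1.sub (hasSum_poi L)
    simpa [sub_mul] using this
  have s2 : HasSum (fun i : ℕ => i * ((r i - 1) * poi L i)) 0 := by
    have h3 := hasSum_nat_mul_pow_mul_poi 1 L
    simp only [one_pow, one_mul, sub_self, mul_zero, Real.exp_zero, mul_one] at h3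
    have := h2.sub h3
    simp only [sub_self] at this
    exact hasSum_of_eq this (fun i => by ring) rfl
  -- Unit mass and mean `L` together say that `(r - 1) poi(L)` annihilates affine functions.
  have sAB : ∀ A B : ℝ, HasSum (fun i : ℕ => (r i - 1) * poi L i * (A + B * i)) 0 := by
    intro A B
    have := (s1.mul_left A).add (s2.mul_left B)
    simp only [mul_zero, add_zero] at this
    exact hasSum_of_eq this (fun i => by ring) rfl
  have hex : ∃ a, 1 < r a := by
    by_contra hno
    push Not at hno
    have s1' : HasSum (fun i => (1 - r i) * poi L i) 0 := by
      have := s1.neg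
      simp only [neg_zero] at this
      exact hasSum_of_eq this (fun i => by ring) rfl
    rw [hasSum_zero_iff_of_nonneg] at s1'
    · obtain ⟨i, hi⟩ := hne
      have := congrFun s1' i
      simp only [Pi.zero_apply, mul_eq_zero, (hπ i).ne', or_false] at this
      exact hi (by linarith)
    · intro i
      exact mul_nonneg (by linarith [hno i]) (hπ i).le
  classical
  set a := Nat.find hex with ha
  have ha1 : 1 < r a := Nat.find_spec hex
  have ha2 : ∀ i < a, r i ≤ 1 := fun i hi => not_lt.1 (Nat.find_min hex hi)
  -- Otherwise `r - 1` changes sign only at `a`, and pairing it with `i - a` gives nonnegative terms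
  -- with sum zero, although the term at `a + 1` is positive.
  have hexN : ∃ N, a < N ∧ r N ≤ 1 := by
    by_contra hno
    push Not at hno
    have s := sAB (-a) 1
    rw [hasSum_zero_iff_of_nonneg] at s
    · have := congrFun s (a + 1)
      have h3 := hno (a + 1) (by omega)
      simp only [Pi.zero_apply, mul_eq_zero, (hπ _).ne', or_false] at this
      rcases this with h | h
      · linarith
      · push_cast at h; linarith
    · intro i
      rcases lt_trichotomy i a with h | h | h
      · have hi : (i : ℝ) < a := by exact_mod_cast h
        have := ha2 i h
        have := hπ i
        nlinarith [mul_nonneg (mul_nonneg (sub_nonneg.2 (ha2 i h)) (hπ i).le)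
          (sub_nonneg.2 hi.le)]
      · subst h; simp
      · have hi : (a : ℝ) < i := by exact_mod_cast h
        nlinarith [mul_nonneg (mul_nonneg (sub_nonneg.2 (hno i h).le) (hπ i).le)
          (sub_nonneg.2 hi.le)]
  set N := Nat.find hexN with hN
  obtain ⟨haN, hN1⟩ : a < N ∧ r N ≤ 1 := Nat.find_spec hexN
  have hN2 : ∀ i, a ≤ i → i < N → 1 < r i := by
    intro i hai hiN
    rcases hai.eq_or_lt with rfl | hai
    · exact ha1
    · have := Nat.find_min hexN hiN
      push Not at this
      exact this hai
  have hN3 : ∀ i, N ≤ i → r i ≤ 1 := by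
    intro i hi
    by_contra hlt
    push Not at hlt
    exact absurd (lt_of_logConcave hr hc haN.le hi ha1 hlt) (not_lt.2 hN1)
  refine ⟨?_, ?_⟩
  -- If `a = 0`, the only sign change is at `N`, and pairing with `N - i` is contradictory in the
  -- same way.
  · refine ha2 0 (Nat.pos_of_ne_zero fun ha0 => ?_)
    have s := sAB N (-1)
    rw [hasSum_zero_iff_of_nonneg] at s
    · have := congrFun s a
      have h3 : (a : ℝ) < N := by exact_mod_cast haN
      simp only [Pi.zero_apply, mul_eq_zero, (hπ _).ne', or_false] at this
      rcases this with h | h <;> linarith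
    · intro i
      rcases lt_or_ge i N with h | h
      · have hi : (i : ℝ) < N := by exact_mod_cast h
        exact mul_nonneg (mul_nonneg (by linarith [hN2 i (by omega) h]) (hπ i).le) (by linarith)
      · have hi : (N : ℝ) ≤ i := by exact_mod_cast h
        nlinarith [mul_nonneg (mul_nonneg (sub_nonneg.2 (hN3 i h)) (hπ i).le) (sub_nonneg.2 hi)]
  · intro l hl hlL hs
    set ρ := l / L with hρ
    have hρ0 : 0 < ρ := by positivity
    have hρ1 : ρ ≠ 1 := by rw [hρ, Ne, div_eq_one_iff_eq hL.ne']; exact hlL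
    obtain ⟨A, B, d1, d2, d3, d4, d5⟩ := pow_sub_secant hρ0 hρ1 haN
    have hpoi : ∀ i, poi l i = Real.exp (L * (1 - ρ)) * (ρ ^ i * poi L i) := by
      intro i
      rw [← poi_mul_eq]; congr 1; rw [hρ]; field_simp
    set E := Real.exp (L * (1 - ρ)) with hE
    have hE0 : 0 < E := Real.exp_pos _
    have hsum : HasSum (fun i => (r i - 1) * poi L i * (ρ ^ i - (A + B * i)))
        (E⁻¹ * (∑' i, r i * poi l i - 1)) := by
      have := ((hs.hasSum.sub (hasSum_poi l)).mul_left E⁻¹).sub (sAB A B)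
      simp only [sub_zero] at this
      exact hasSum_of_eq this (fun i => by rw [hpoi]; field_simp) rfl
    have hterm : ∀ i, (r i - 1) * poi L i * (ρ ^ i - (A + B * i)) ≤ 0 := by
      intro i
      rcases lt_trichotomy i a with h | h | h
      · have := mul_nonneg (mul_nonneg (sub_nonneg.2 (ha2 i h)) (hπ i).le)
          (sub_nonneg.2 (d1 i h).le)
        linarith
      · subst h; rw [d4]; simp
      · rcases lt_trichotomy i N with h' | h' | h'
        · have := mul_nonneg (mul_nonneg (sub_nonneg.2 (hN2 i h.le h').le) (hπ i).le)
            (sub_nonneg.2 (d3 i h h').le)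
          linarith
        · rw [h', d5]; simp
        · have := mul_nonneg (mul_nonneg (sub_nonneg.2 (hN3 i h'.le)) (hπ i).le)
            (sub_nonneg.2 (d2 i h').le)
          linarith
    have hle : E⁻¹ * (∑' i, r i * poi l i - 1) ≤ 0 := hasSum_le hterm hsum hasSum_zero
    -- Equality would force `r = 1` off `{a, N}`; pairing with `N - i` then leaves only the term at
    -- `a`, which is positive.
    have hne0 : E⁻¹ * (∑' i, r i * poi l i - 1) ≠ 0 := by
      intro h0
      rw [h0] at hsum
      have hsum' := hsum.neg
      rw [neg_zero, hasSum_zero_iff_of_nonneg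
        (fun i => by simpa using hterm i)] at hsum'
      have hz : ∀ i, i ≠ a → i ≠ N → r i = 1 := by
        intro i h3 h4
        have h5 := congrFun hsum' i
        simp only [Pi.zero_apply, neg_eq_zero, mul_eq_zero, (hπ i).ne', or_false] at h5
        rcases h5 with h5 | h5
        · linarith
        · exfalso
          rcases lt_trichotomy i a with h | h | h
          · linarith [d1 i h]
          · exact h3 h
          · rcases lt_trichotomy i N with h' | h' | h'
            · linarith [d3 i h h']
            · exact h4 h'
            · linarith [d2 i h']
      have h6 := sAB N (-1)
      have h7 := hasSum_single (f := fun i : ℕ => (r i - 1) * poi L i * ((N : ℝ) + -1 * i)) a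
        (fun i hi => by
          by_cases hiN : i = N
          · simp [hiN]
          · simp [hz i hi hiN])
      have h8 := h6.unique h7
      have h9 : (a : ℝ) < N := by exact_mod_cast haN
      have : 0 < (r a - 1) * poi L a * ((N : ℝ) + -1 * a) :=
        mul_pos (mul_pos (by linarith) (hπ a)) (by linarith)
      linarith
    have := lt_of_le_of_ne hle hne0
    by_contra hge
    push Not at hge
    have := mul_nonneg (inv_pos.2 hE0).le (sub_nonneg.2 hge)
    linarith

/-! ### First order conditions for maximizers of the affinity -/

section foc
variable {u : ℝ} {p M G : ℕ → ℝ}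

/-- First order condition for moving mass towards `G`. -/
theorem tsum_wt_le_aff (hu : u ∈ Ioo (0 : ℝ) 1) (hp : ∀ i, 0 < p i) (hM : ∀ i, 0 < M i)
    (hG : ∀ i, 0 ≤ G i) (sp : Summable p) (sM : Summable M) (sG : Summable G)
    (sw : Summable fun i => wt u p M i * G i)
    (hmax : ∀ s ∈ Ioo (0 : ℝ) 1, aff u p (fun i => (1 - s) * M i + s * G i) ≤ aff u p M) :
    ∑' i, wt u p M i * G i ≤ aff u p M := by
  -- The tangent is taken at the perturbed point `Q` rather than at `M`, so that maximality of `M`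
  -- gives information. The bound `Q ≥ (1 - s) M` controls the weights of `Q` by those of `M`; then
  -- `s → 0` by dominated convergence.
  have key : ∀ s ∈ Ioo (0 : ℝ) 1,
      ∑' i, wt u p (fun i => (1 - s) * M i + s * G i) i * G i ≤ (1 - s) ^ (-u) * aff u p M := by
    intro s hs
    have h1s : 0 < 1 - s := by linarith [hs.2]
    set Q : ℕ → ℝ := fun i => (1 - s) * M i + s * G i with hQ
    have hQ0 : ∀ i, 0 < Q i := fun i =>
      add_pos_of_pos_of_nonneg (mul_pos h1s (hM i)) (mul_nonneg hs.1.le (hG i))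
    have hw : ∀ i, wt u p Q i ≤ (1 - s) ^ (-u) * wt u p M i := by
      intro i
      unfold wt
      rw [← Real.mul_rpow h1s.le (div_pos (hM i) (hp i)).le]
      refine Real.rpow_le_rpow_of_nonpos (mul_pos h1s (div_pos (hM i) (hp i))) ?_
        (by linarith [hu.1])
      rw [← mul_div_assoc]
      gcongr
      · exact (hp i).le
      · exact le_add_of_nonneg_right (mul_nonneg hs.1.le (hG i))
    have sWM := summable_wt_mul_self hu hp hM sp sM
    have s1 : Summable fun i => wt u p Q i * M i := by
      refine Summable.of_nonneg_of_le (fun i => mul_nonneg (wt_pos hp hQ0 i).le (hM i).le)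
        (fun i => ?_) (sWM.mul_left ((1 - s) ^ (-u)))
      rw [← mul_assoc]
      exact mul_le_mul_of_nonneg_right (hw i) (hM i).le
    have s2 : Summable fun i => wt u p Q i * G i := by
      refine Summable.of_nonneg_of_le (fun i => mul_nonneg (wt_pos hp hQ0 i).le (hG i))
        (fun i => ?_) (sw.mul_left ((1 - s) ^ (-u)))
      rw [← mul_assoc]
      exact mul_le_mul_of_nonneg_right (hw i) (hG i)
    have sQ : Summable Q := (sM.mul_left _).add (sG.mul_left _)
    have ht := aff_le_of_tangent hu hp hQ0 (fun i => (hM i).le) sp sQ sM s1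
    have hQs : aff u p Q = (1 - s) * ∑' i, wt u p Q i * M i + s * ∑' i, wt u p Q i * G i := by
      rw [← tsum_wt_mul_self hp hQ0, ← tsum_mul_left, ← tsum_mul_left,
        ← (s1.mul_left _).tsum_add (s2.mul_left _)]
      exact tsum_congr fun i => by simp only [hQ]; ring
    have hm := hmax s hs
    have h3 : 0 ≤ ∑' i, wt u p Q i * M i - aff u p Q := by
      have h1u : 0 < 1 - u := by linarith [hu.2]
      by_contra hneg
      push Not at hneg
      have := mul_neg_of_pos_of_neg h1u hneg
      linarith
    have h4 : ∑' i, wt u p Q i * G i ≤ ∑' i, wt u p Q i * M i := by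
      rw [hQs] at h3
      have : 0 ≤ s * (∑' i, wt u p Q i * M i - ∑' i, wt u p Q i * G i) := by linarith
      have := nonneg_of_mul_nonneg_right this hs.1
      linarith
    refine h4.trans ?_
    rw [← tsum_wt_mul_self hp hM, ← tsum_mul_left]
    refine s1.tsum_le_tsum (fun i => ?_) (sWM.mul_left _)
    rw [← mul_assoc]
    exact mul_le_mul_of_nonneg_right (hw i) (hM i).le
  have hev : ∀ᶠ s : ℝ in 𝓝[>] 0, s ∈ Ioo (0 : ℝ) (1 / 2) := Ioo_mem_nhdsGT (by norm_num)
  have lim1 : Tendsto (fun s : ℝ => ∑' i, wt u p (fun i => (1 - s) * M i + s * G i) i * G i)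
      (𝓝[>] 0) (𝓝 (∑' i, wt u p M i * G i)) := by
    refine tendsto_tsum_of_dominated_convergence (sw.mul_left ((1 / 2 : ℝ) ^ (-u))) ?_ ?_
    · intro i
      refine Tendsto.mul_const _ ?_
      have hc : ContinuousAt
          (fun s : ℝ => wt u p (fun i => (1 - s) * M i + s * G i) i) 0 := by
        unfold wt
        refine ContinuousAt.rpow_const (by fun_prop) (Or.inl ?_)
        simp only [sub_zero, one_mul, zero_mul, add_zero]
        exact (div_pos (hM i) (hp i)).ne'
      have := hc.tendsto
      simp only [sub_zero, one_mul, zero_mul, add_zero] at this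
      exact this.mono_left nhdsWithin_le_nhds
    · filter_upwards [hev] with s hs i
      have hq : (1 / 2 : ℝ) * M i ≤ (1 - s) * M i + s * G i := by
        have := mul_nonneg hs.1.le (hG i)
        nlinarith [hM i, hs.2]
      have h0 : 0 ≤ wt u p (fun i => (1 - s) * M i + s * G i) i := by
        refine Real.rpow_nonneg (div_nonneg ?_ (hp i).le) _
        nlinarith [hM i]
      rw [Real.norm_of_nonneg (mul_nonneg h0 (hG i)), ← mul_assoc]
      refine mul_le_mul_of_nonneg_right ?_ (hG i)
      unfold wt
      rw [← Real.mul_rpow (by norm_num) (div_pos (hM i) (hp i)).le]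
      refine Real.rpow_le_rpow_of_nonpos
        (mul_pos (by norm_num) (div_pos (hM i) (hp i))) ?_ (by linarith [hu.1])
      rw [← mul_div_assoc]
      exact div_le_div_of_nonneg_right hq (hp i).le
  have lim2 : Tendsto (fun s : ℝ => (1 - s) ^ (-u) * aff u p M) (𝓝[>] 0) (𝓝 (aff u p M)) := by
    have hc : ContinuousAt (fun s : ℝ => (1 - s) ^ (-u) * aff u p M) 0 :=
      (ContinuousAt.rpow_const (by fun_prop) (Or.inl (by norm_num))).mul_const _
    have := hc.tendsto
    simp only [sub_zero, Real.one_rpow, one_mul] at this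
    exact this.mono_left nhdsWithin_le_nhds
  refine le_of_tendsto_of_tendsto lim1 lim2 ?_
  filter_upwards [hev] with s hs
  exact key s ⟨hs.1, by linarith [hs.2]⟩

/-- The smooth one-sided version of the tilted Poisson weights. -/
noncomputable def expPow (a l : ℝ) (i : ℕ) : ℝ := Real.exp (a * l) * l ^ i / (i.factorial : ℝ)

theorem expPow_pos {a l : ℝ} (hl : 0 < l) (i : ℕ) : 0 < expPow a l i := by
  unfold expPow; positivity

theorem expPow_eq (a l : ℝ) (i : ℕ) : expPow a l i = Real.exp ((a + 1) * l) * poi l i := by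
  unfold expPow poi
  rw [show a * l = (a + 1) * l + -l by ring, Real.exp_add]; ring

/-- The quotient of the two terms is the exponential of `i log (l' / l) + a (l' - l)`, so `e ^ s ≥ 1
+ s` gives a bound linear in `i`, without second order remainder. -/
theorem expPow_sub_ge {a l l' : ℝ} (hl : 0 < l) (hl' : 0 < l') (i : ℕ) :
    expPow a l i * (i * Real.log (l' / l) + a * (l' - l)) ≤ expPow a l' i - expPow a l i := by
  have h1 : expPow a l' i =
      expPow a l i * Real.exp (i * Real.log (l' / l) + a * (l' - l)) := by
    unfold expPow
    rw [Real.exp_add, mul_comm (i : ℝ), Real.exp_mul (Real.log (l' / l)), Real.exp_log (by positivity),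
      Real.rpow_natCast, div_pow, show a * l' = a * l + a * (l' - l) by ring, Real.exp_add]
    field_simp
  rw [h1]
  have := Real.add_one_le_exp (i * Real.log (l' / l) + a * (l' - l))
  nlinarith [expPow_pos (a := a) hl i]

theorem summable_pow_mul_expPow (D a l : ℝ) : Summable fun i => D ^ i * expPow a l i := by
  have := (hasSum_pow_mul_poi D l).summable.mul_left (Real.exp ((a + 1) * l))
  refine this.congr fun i => ?_
  rw [expPow_eq]; ring

/-- First order condition for moving a location. -/
theorem tsum_wt_mul_nat_eq {m : ℝ} (hm : 0 < m) (hu : u ∈ Ioo (0 : ℝ) 1) {N : ℕ → ℝ}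
    (hN : ∀ i, 0 ≤ N i) (sN : Summable N) {c a l : ℝ} (hc : 0 < c) (hl : 0 < l)
    (hmax : ∀ᶠ l' in 𝓝 l, aff u (poi m) (fun i => N i + c * expPow a l' i) ≤
      aff u (poi m) (fun i => N i + c * expPow a l i)) :
    ∑' i : ℕ, i * (wt u (poi m) (fun i => N i + c * expPow a l i) i * expPow a l i) =
      -a * l * ∑' i, wt u (poi m) (fun i => N i + c * expPow a l i) i * expPow a l i := by
  set Q : ℝ → ℕ → ℝ := fun l' i => N i + c * expPow a l' i with hQ
  have hp : ∀ i, 0 < poi m i := poi_pos hm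
  have hnear : ∀ᶠ l' in 𝓝 l, l' ∈ Ioo (l / 2) (2 * l) :=
    Ioo_mem_nhds (by linarith) (by linarith)
  have hQ0 : ∀ {l'}, 0 < l' → ∀ i, 0 < Q l' i := fun hl' i =>
    add_pos_of_nonneg_of_pos (hN i) (mul_pos hc (expPow_pos hl' i))
  have sQ : ∀ l', Summable (Q l') := by
    intro l'
    refine sN.add (Summable.mul_left c ?_)
    simpa using summable_pow_mul_expPow 1 a l'
  -- A geometric bound on the weights, uniform for `l'` near `l`, provides the dominating series for
  -- both limits.
  obtain ⟨C, D, hC, hD, hb⟩ : ∃ C D : ℝ, 0 < C ∧ 0 < D ∧ ∀ l' ∈ Ioo (l / 2) (2 * l), ∀ i,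
      wt u (poi m) (Q l') i ≤ C * D ^ i := by
    set c' := c * Real.exp (-(|a| * (2 * l)) + m) with hc'
    have hc'0 : 0 < c' := by positivity
    refine ⟨c' ^ (-u), (l / (2 * m)) ^ (-u), by positivity, by positivity, fun l' hl' i => ?_⟩
    refine wt_le_of_le hu.1.le hp hc'0 (by positivity) ?_
    have hl'0 : 0 < l' := by linarith [hl'.1]
    have h1 : Real.exp (-(|a| * (2 * l))) ≤ Real.exp (a * l') := by
      apply Real.exp_le_exp.2
      have h2 : |a * l'| ≤ |a| * (2 * l) := by
        rw [abs_mul, abs_of_pos hl'0]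
        exact mul_le_mul_of_nonneg_left hl'.2.le (abs_nonneg a)
      linarith [neg_abs_le (a * l')]
    have h3 : (l / 2) ^ i ≤ l' ^ i := pow_le_pow_left₀ (by positivity) hl'.1.le i
    calc c' * (l / (2 * m)) ^ i * poi m i
        = c * (Real.exp (-(|a| * (2 * l))) * (l / 2) ^ i / (i.factorial : ℝ)) := by
          rw [hc', Real.exp_add]
          unfold poi
          rw [Real.exp_neg m, show l / (2 * m) = l / 2 / m by field_simp, div_pow (l / 2)]
          field_simp
      _ ≤ c * expPow a l' i := by
          unfold expPow
          gcongr
      _ ≤ Q l' i := le_add_of_nonneg_left (hN i)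
  set A : ℝ → ℝ := fun l' => ∑' i : ℕ, i * (wt u (poi m) (Q l') i * expPow a l i) with hA
  set B : ℝ → ℝ := fun l' => ∑' i : ℕ, wt u (poi m) (Q l') i * expPow a l i with hB
  have sCD : Summable fun i => C * (D ^ i * expPow a l i) :=
    (summable_pow_mul_expPow D a l).mul_left C
  have sCD2 : Summable fun i => C * ((2 * D) ^ i * expPow a l i) :=
    (summable_pow_mul_expPow (2 * D) a l).mul_left C
  have b0 : ∀ l' ∈ Ioo (l / 2) (2 * l), ∀ i, 0 ≤ wt u (poi m) (Q l') i * expPow a l i :=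
    fun l' hl' i => mul_nonneg (wt_pos hp (hQ0 (by linarith [hl'.1])) i).le (expPow_pos hl i).le
  have b1 : ∀ l' ∈ Ioo (l / 2) (2 * l), ∀ i, wt u (poi m) (Q l') i * expPow a l i ≤
      C * (D ^ i * expPow a l i) := fun l' hl' i => by
    rw [← mul_assoc]
    exact mul_le_mul_of_nonneg_right (hb l' hl' i) (expPow_pos hl i).le
  have b2 : ∀ l' ∈ Ioo (l / 2) (2 * l), ∀ i : ℕ, i * (wt u (poi m) (Q l') i * expPow a l i) ≤
      C * ((2 * D) ^ i * expPow a l i) := fun l' hl' i => by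
    calc i * (wt u (poi m) (Q l') i * expPow a l i)
        ≤ 2 ^ i * (C * (D ^ i * expPow a l i)) :=
          mul_le_mul (nat_cast_le_two_pow i) (b1 l' hl' i) (b0 l' hl' i) (by positivity)
      _ = _ := by rw [mul_pow]; ring
  have sB : ∀ l' ∈ Ioo (l / 2) (2 * l), Summable fun i => wt u (poi m) (Q l') i * expPow a l i :=
    fun l' hl' => Summable.of_nonneg_of_le (b0 l' hl') (b1 l' hl') sCD
  have sA : ∀ l' ∈ Ioo (l / 2) (2 * l),
      Summable fun i : ℕ => i * (wt u (poi m) (Q l') i * expPow a l i) :=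
    fun l' hl' => Summable.of_nonneg_of_le
      (fun i => mul_nonneg (Nat.cast_nonneg i) (b0 l' hl' i)) (b2 l' hl') sCD2
  have hlim : ∀ i, Tendsto (fun l' => wt u (poi m) (Q l') i * expPow a l i) (𝓝 l)
      (𝓝 (wt u (poi m) (Q l) i * expPow a l i)) := by
    intro i
    refine Tendsto.mul_const _ ?_
    have hcont : ContinuousAt (fun l' => wt u (poi m) (Q l') i) l := by
      unfold wt
      refine ContinuousAt.rpow_const ?_ (Or.inl (div_pos (hQ0 hl i) (hp i)).ne')
      simp only [hQ, expPow]
      fun_prop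
    exact hcont.tendsto
  have limB : Tendsto B (𝓝 l) (𝓝 (B l)) := by
    refine tendsto_tsum_of_dominated_convergence sCD hlim ?_
    filter_upwards [hnear] with l' hl' i
    rw [Real.norm_of_nonneg (b0 l' hl' i)]
    exact b1 l' hl' i
  have limA : Tendsto A (𝓝 l) (𝓝 (A l)) := by
    refine tendsto_tsum_of_dominated_convergence sCD2 (fun i => (hlim i).const_mul _) ?_
    filter_upwards [hnear] with l' hl' i
    rw [Real.norm_of_nonneg (mul_nonneg (Nat.cast_nonneg i) (b0 l' hl' i))]
    exact b2 l' hl' i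
  -- The tangent inequality at `Q l'`, maximality at `l`, and `expPow_sub_ge` combine into a first
  -- order inequality valid on both sides of `l`.
  have key : ∀ᶠ l' in 𝓝 l, A l' * Real.log (l' / l) + a * (l' - l) * B l' ≤ 0 := by
    filter_upwards [hmax, hnear] with l' hmx hl'
    have hl'0 : 0 < l' := by linarith [hl'.1]
    have hwp := wt_pos (u := u) hp (hQ0 hl'0)
    have sW' := summable_wt_mul_self hu hp (hQ0 hl'0) (summable_poi m) (sQ l')
    have slog : Summable fun i : ℕ => c * (Real.log (l' / l) *
        (i * (wt u (poi m) (Q l') i * expPow a l i)) +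
        a * (l' - l) * (wt u (poi m) (Q l') i * expPow a l i)) :=
      (((sA l' hl').mul_left _).add ((sB l' hl').mul_left _)).mul_left c
    have hpt : ∀ i : ℕ, wt u (poi m) (Q l') i * Q l i + c * (Real.log (l' / l) *
        (i * (wt u (poi m) (Q l') i * expPow a l i)) +
        a * (l' - l) * (wt u (poi m) (Q l') i * expPow a l i)) ≤
        wt u (poi m) (Q l') i * Q l' i := by
      intro i
      have h := mul_le_mul_of_nonneg_left (expPow_sub_ge (a := a) hl hl'0 i)
        (mul_nonneg hc.le (hwp i).le)
      simp only [hQ] at h ⊢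
      linarith
    have sWl : Summable fun i => wt u (poi m) (Q l') i * Q l i := by
      have sNw : Summable fun i => wt u (poi m) (Q l') i * N i := by
        refine Summable.of_nonneg_of_le (fun i => mul_nonneg (hwp i).le (hN i)) (fun i => ?_) sW'
        refine mul_le_mul_of_nonneg_left ?_ (hwp i).le
        exact le_add_of_nonneg_right (mul_nonneg hc.le (expPow_pos hl'0 i).le)
      refine (sNw.add ((sB l' hl').mul_left c)).congr fun i => ?_
      simp only [hQ]; ring
    have ht := aff_le_of_tangent hu hp (hQ0 hl'0) (fun i => (hQ0 hl i).le) (summable_poi m)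
      (sQ l') (sQ l) sWl
    have h3 : 0 ≤ ∑' i, wt u (poi m) (Q l') i * Q l i - aff u (poi m) (Q l') := by
      have h1u : 0 < 1 - u := by linarith [hu.2]
      by_contra hneg
      push Not at hneg
      have := mul_neg_of_pos_of_neg h1u hneg
      linarith
    have h4 := (sWl.add slog).tsum_le_tsum hpt sW'
    rw [sWl.tsum_add slog, tsum_wt_mul_self hp (hQ0 hl'0), tsum_mul_left,
      ((sA l' hl').mul_left _).tsum_add ((sB l' hl').mul_left _), tsum_mul_left,
      tsum_mul_left] at h4
    have h5 : c * (A l' * Real.log (l' / l) + a * (l' - l) * B l') ≤ 0 := by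
      simp only [hA, hB]; linarith
    exact nonpos_of_mul_nonpos_right h5 hc
  have hslope : Tendsto (fun l' => Real.log (l' / l) / (l' - l)) (𝓝[≠] l) (𝓝 l⁻¹) := by
    have h := (Real.hasDerivAt_log hl.ne').tendsto_slope
    refine h.congr' ?_
    have : ∀ᶠ l' in 𝓝[≠] l, l' ∈ Ioo (l / 2) (2 * l) := hnear.filter_mono nhdsWithin_le_nhds
    filter_upwards [this] with l' hl'
    have hl'0 : 0 < l' := by linarith [hl'.1]
    rw [slope_def_field, Real.log_div hl'0.ne' hl.ne']
  have hlimE : Tendsto (fun l' => A l' * (Real.log (l' / l) / (l' - l)) + a * B l') (𝓝[≠] l)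
      (𝓝 (A l * l⁻¹ + a * B l)) :=
    ((limA.mono_left nhdsWithin_le_nhds).mul hslope).add
      ((limB.mono_left nhdsWithin_le_nhds).const_mul a)
  -- Dividing by `l' - l` from the right and from the left gives the two inequalities whose
  -- conjunction is stationarity.
  have hle : A l * l⁻¹ + a * B l ≤ 0 := by
    refine le_of_tendsto (x := 𝓝[>] l)
      (hlimE.mono_left (nhdsWithin_mono l fun x (hx : l < x) => hx.ne')) ?_
    filter_upwards [key.filter_mono nhdsWithin_le_nhds, self_mem_nhdsWithin] with l' h1 h2
    have h3 : 0 < l' - l := sub_pos.2 h2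
    have : A l' * (Real.log (l' / l) / (l' - l)) + a * B l' =
        (A l' * Real.log (l' / l) + a * (l' - l) * B l') / (l' - l) := by field_simp
    rw [this]
    exact div_nonpos_of_nonpos_of_nonneg h1 h3.le
  have hge : 0 ≤ A l * l⁻¹ + a * B l := by
    refine ge_of_tendsto (x := 𝓝[<] l)
      (hlimE.mono_left (nhdsWithin_mono l fun x (hx : x < l) => hx.ne)) ?_
    filter_upwards [key.filter_mono nhdsWithin_le_nhds, self_mem_nhdsWithin] with l' h1 h2
    have h3 : l' - l < 0 := sub_neg.2 h2
    have h3' := h3.ne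
    have : A l' * (Real.log (l' / l) / (l' - l)) + a * B l' =
        (A l' * Real.log (l' / l) + a * (l' - l) * B l') / (l' - l) := by field_simp
    rw [this]
    exact div_nonneg_of_nonpos h1 h3.le
  have h0 : A l * l⁻¹ + a * B l = 0 := le_antisymm hle hge
  have : A l = -a * l * B l := by
    field_simp at h0
    linarith
  exact this

end foc

/-! ### Two-point mixtures of tilted Poisson weights -/

/-- Poisson weights multiplied by `e ^ (b |l - m|)`. -/
noncomputable def tilt (b m l : ℝ) (i : ℕ) : ℝ := Real.exp (b * |l - m|) * poi l i

/-- A mixture of two tilted Poisson weights. -/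
noncomputable def mix (b m w l₁ l₂ : ℝ) (i : ℕ) : ℝ := w * tilt b m l₁ i + (1 - w) * tilt b m l₂ i

/-- The coefficient of `(l / m) ^ i` in the density of `tilt b m l` with respect to `poi m`. -/
noncomputable def tiltCoeff (b m l : ℝ) : ℝ := Real.exp (b * |l - m| - (l - m))

/-- The pairing of the tilted Poisson weights with the weights of a mixture. -/
noncomputable def field (u b m w l₁ l₂ l : ℝ) : ℝ :=
  ∑' i, wt u (poi m) (mix b m w l₁ l₂) i * tilt b m l i

theorem tiltCoeff_pos (b m l : ℝ) : 0 < tiltCoeff b m l := Real.exp_pos _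

section tilt
variable {u b m w l₁ l₂ l : ℝ}

theorem tilt_eq_coeff (hm : 0 < m) (i : ℕ) :
    tilt b m l i = tiltCoeff b m l * (l / m) ^ i * poi m i := by
  unfold tilt tiltCoeff poi
  rw [show b * |l - m| - (l - m) = b * |l - m| + (-l + m) by ring, Real.exp_add, Real.exp_add,
    Real.exp_neg m, div_pow]
  field_simp

/-- On each side of `m` the absolute value is affine, so the tilted weights become a constant times
the smooth family `expPow`. The two exponents `1 - b` and `1 + b` are the rates used in the
one-sided arguments. -/
theorem tilt_of_ge (h : m ≤ l) (i : ℕ) :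
    tilt b m l i = Real.exp (-(b * m)) * expPow (-(1 - b)) l i := by
  unfold tilt expPow poi
  rw [abs_of_nonneg (sub_nonneg.2 h), ← mul_div_assoc, ← mul_div_assoc, ← mul_assoc, ← mul_assoc,
    ← Real.exp_add, ← Real.exp_add, show b * (l - m) + -l = -(b * m) + -(1 - b) * l by ring]

theorem tilt_of_le (h : l ≤ m) (i : ℕ) :
    tilt b m l i = Real.exp (b * m) * expPow (-(1 + b)) l i := by
  unfold tilt expPow poi
  rw [abs_of_nonpos (sub_nonpos.2 h), ← mul_div_assoc, ← mul_div_assoc, ← mul_assoc, ← mul_assoc,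
    ← Real.exp_add, ← Real.exp_add, show b * -(l - m) + -l = b * m + -(1 + b) * l by ring]

theorem tilt_self (i : ℕ) : tilt b m m i = poi m i := by simp [tilt]

theorem tilt_nonneg (hl : 0 ≤ l) (i : ℕ) : 0 ≤ tilt b m l i :=
  mul_nonneg (Real.exp_pos _).le (poi_nonneg hl i)

theorem tilt_pos (hl : 0 < l) (i : ℕ) : 0 < tilt b m l i :=
  mul_pos (Real.exp_pos _) (poi_pos hl i)

theorem summable_pow_mul_tilt (D : ℝ) : Summable fun i => D ^ i * tilt b m l i := by
  refine ((hasSum_pow_mul_poi D l).summable.mul_left (Real.exp (b * |l - m|))).congr fun i => ?_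
  unfold tilt; ring

theorem summable_tilt : Summable (tilt b m l) := by
  simpa using summable_pow_mul_tilt (b := b) (m := m) (l := l) 1

theorem summable_mix : Summable (mix b m w l₁ l₂) :=
  (summable_tilt.mul_left _).add (summable_tilt.mul_left _)

theorem mix_nonneg (hw : w ∈ Icc (0 : ℝ) 1) (h1 : 0 ≤ l₁) (h2 : 0 ≤ l₂) (i : ℕ) :
    0 ≤ mix b m w l₁ l₂ i :=
  add_nonneg (mul_nonneg hw.1 (tilt_nonneg h1 i))
    (mul_nonneg (by linarith [hw.2]) (tilt_nonneg h2 i))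

theorem mix_pos (hw : w ∈ Ico (0 : ℝ) 1) (h1 : 0 ≤ l₁) (h2 : 0 < l₂) (i : ℕ) :
    0 < mix b m w l₁ l₂ i :=
  add_pos_of_nonneg_of_pos (mul_nonneg hw.1 (tilt_nonneg h1 i))
    (mul_pos (by linarith [hw.2]) (tilt_pos h2 i))

theorem mix_div (hm : 0 < m) (i : ℕ) : mix b m w l₁ l₂ i / poi m i =
    w * tiltCoeff b m l₁ * (l₁ / m) ^ i + (1 - w) * tiltCoeff b m l₂ * (l₂ / m) ^ i := by
  have := (poi_pos hm i).ne'
  unfold mix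
  rw [tilt_eq_coeff hm, tilt_eq_coeff hm]
  field_simp

/-- Exponential bound on the weights of a mixture. -/
theorem exists_wt_mix_le (hm : 0 < m) (hu : 0 ≤ u) (hw : w ∈ Ico (0 : ℝ) 1) (h1 : 0 ≤ l₁)
    (h2 : 0 < l₂) : ∃ C D : ℝ, 0 < C ∧ 0 < D ∧
      ∀ i, wt u (poi m) (mix b m w l₁ l₂) i ≤ C * D ^ i := by
  have hw1 : 0 < 1 - w := by linarith [hw.2]
  have hc : 0 < (1 - w) * tiltCoeff b m l₂ := mul_pos hw1 (tiltCoeff_pos _ _ _)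
  have hd : 0 < l₂ / m := by positivity
  refine ⟨_, _, Real.rpow_pos_of_pos hc _, Real.rpow_pos_of_pos hd _, fun i =>
    wt_le_of_le hu (poi_pos hm) hc hd ?_⟩
  refine le_trans (le_of_eq ?_) (le_add_of_nonneg_left (mul_nonneg hw.1 (tilt_nonneg h1 i)))
  rw [tilt_eq_coeff hm]; ring

theorem wt_mix_pos (hm : 0 < m) (hw : w ∈ Ico (0 : ℝ) 1) (h1 : 0 ≤ l₁)
    (h2 : 0 < l₂) (i : ℕ) : 0 < wt u (poi m) (mix b m w l₁ l₂) i :=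
  wt_pos (poi_pos hm) (mix_pos hw h1 h2) i

theorem summable_wt_mul_tilt (hm : 0 < m) (hu : 0 ≤ u) (hw : w ∈ Ico (0 : ℝ) 1) (h1 : 0 ≤ l₁)
    (h2 : 0 < l₂) (hl : 0 ≤ l) :
    Summable fun i => wt u (poi m) (mix b m w l₁ l₂) i * tilt b m l i := by
  obtain ⟨C, D, hC, hD, h⟩ := exists_wt_mix_le (b := b) hm hu hw h1 h2
  refine Summable.of_nonneg_of_le (fun i => mul_nonneg (wt_mix_pos hm hw h1 h2 i).le
    (tilt_nonneg hl i)) (fun i => ?_) ((summable_pow_mul_tilt (b := b) (m := m) (l := l) D).mul_left C)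
  rw [← mul_assoc]
  exact mul_le_mul_of_nonneg_right (h i) (tilt_nonneg hl i)

theorem summable_nat_mul_wt_mul_tilt (hm : 0 < m) (hu : 0 ≤ u) (hw : w ∈ Ico (0 : ℝ) 1)
    (h1 : 0 ≤ l₁) (h2 : 0 < l₂) (hl : 0 ≤ l) :
    Summable fun i : ℕ => i * (wt u (poi m) (mix b m w l₁ l₂) i * tilt b m l i) := by
  obtain ⟨C, D, hC, hD, h⟩ := exists_wt_mix_le (b := b) hm hu hw h1 h2
  have h0 : ∀ i, 0 ≤ wt u (poi m) (mix b m w l₁ l₂) i * tilt b m l i := fun i =>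
    mul_nonneg (wt_mix_pos hm hw h1 h2 i).le (tilt_nonneg hl i)
  refine Summable.of_nonneg_of_le (fun i => mul_nonneg (Nat.cast_nonneg i) (h0 i)) (fun i => ?_)
    ((summable_pow_mul_tilt (b := b) (m := m) (l := l) (2 * D)).mul_left C)
  calc i * (wt u (poi m) (mix b m w l₁ l₂) i * tilt b m l i)
      ≤ 2 ^ i * ((C * D ^ i) * tilt b m l i) :=
        mul_le_mul (nat_cast_le_two_pow i) (mul_le_mul_of_nonneg_right (h i) (tilt_nonneg hl i))
          (h0 i) (by positivity)
    _ = _ := by rw [mul_pow]; ring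

/-- The weights of a mixture are log-concave. -/
theorem wt_mix_logConcave (hm : 0 < m) (hu : 0 < u) (hw : w ∈ Ico (0 : ℝ) 1)
    (h1 : 0 ≤ l₁) (h2 : 0 < l₂) (i : ℕ) :
    wt u (poi m) (mix b m w l₁ l₂) i * wt u (poi m) (mix b m w l₁ l₂) (i + 2) ≤
      wt u (poi m) (mix b m w l₁ l₂) (i + 1) ^ 2 := by
  have hpos : ∀ i, 0 < mix b m w l₁ l₂ i / poi m i :=
    fun i => div_pos (mix_pos hw h1 h2 i) (poi_pos hm i)
  unfold wt
  rw [← Real.mul_rpow (hpos _).le (hpos _).le, ← Real.rpow_natCast, ← Real.rpow_mul (hpos _).le,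
    mul_comm (-u), Real.rpow_mul (hpos _).le, Real.rpow_natCast]
  refine Real.rpow_le_rpow_of_nonpos (by have := hpos (i + 1); positivity) ?_ (by linarith)
  rw [mix_div hm, mix_div hm, mix_div hm]
  have hA : 0 ≤ w * tiltCoeff b m l₁ := mul_nonneg hw.1 (tiltCoeff_pos _ _ _).le
  have hB : 0 ≤ (1 - w) * tiltCoeff b m l₂ :=
    mul_nonneg (by linarith [hw.2]) (tiltCoeff_pos _ _ _).le
  have hx : 0 ≤ (l₁ / m) ^ i := by positivity
  have hz : 0 ≤ (l₂ / m) ^ i := by positivity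
  -- A sum of two geometric sequences is log-convex, with gap the product of the two terms times
  -- `(l₁ / m - l₂ / m) ^ 2` up to indexing; the negative power `-u` reverses this.
  have := mul_nonneg (mul_nonneg hA hB) (mul_nonneg (mul_nonneg hx hz) (sq_nonneg (l₁ / m - l₂ / m)))
  simp only [pow_succ (l₁ / m), pow_succ (l₂ / m)]
  nlinarith

/-- Distinct rates with positive coefficients make the log-convexity of the density strict. This
prevents the renormalized weights from being constant, as `tsum_mul_poi_lt_one` requires. -/
theorem wt_mix_strict (hm : 0 < m) (hu : 0 < u) (hw : w ∈ Ioo (0 : ℝ) 1)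
    (h1 : 0 ≤ l₁) (h12 : l₁ < l₂) :
    wt u (poi m) (mix b m w l₁ l₂) 0 * wt u (poi m) (mix b m w l₁ l₂) 2 <
      wt u (poi m) (mix b m w l₁ l₂) 1 ^ 2 := by
  have h2 : 0 < l₂ := by linarith
  have hpos : ∀ i, 0 < mix b m w l₁ l₂ i / poi m i :=
    fun i => div_pos (mix_pos ⟨hw.1.le, hw.2⟩ h1 h2 i) (poi_pos hm i)
  unfold wt
  rw [← Real.mul_rpow (hpos _).le (hpos _).le, ← Real.rpow_natCast, ← Real.rpow_mul (hpos _).le,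
    mul_comm (-u), Real.rpow_mul (hpos _).le, Real.rpow_natCast]
  refine Real.rpow_lt_rpow_of_neg (by have := hpos 1; positivity) ?_ (by linarith)
  rw [mix_div hm, mix_div hm, mix_div hm]
  have hA : 0 < w * tiltCoeff b m l₁ := mul_pos hw.1 (tiltCoeff_pos _ _ _)
  have hB : 0 < (1 - w) * tiltCoeff b m l₂ := mul_pos (by linarith [hw.2]) (tiltCoeff_pos _ _ _)
  have hne : l₁ / m - l₂ / m ≠ 0 := by
    rw [← sub_div]; exact div_ne_zero (by linarith) hm.ne'
  have := mul_pos (mul_pos hA hB) (sq_pos_of_ne_zero hne)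
  nlinarith

end tilt

/-! ### One-sided global optimality -/

section side
variable {a : ℕ → ℝ} {κ E Z : ℝ}

theorem expPow_neg_eq (hκ : 0 < κ) (l : ℝ) (i : ℕ) :
    expPow (-κ) l i = κ⁻¹ ^ i * poi (κ * l) i := by
  unfold expPow poi
  rw [mul_pow, inv_pow, neg_mul]
  have : κ ^ i ≠ 0 := by positivity
  field_simp

/-- Absorbing `E`, `κ⁻¹ ^ i` and `1 / Z` into the weights turns the family into Poisson laws of
parameter `κ l`. The hypotheses `hsum` and `hmean` then say mass one and mean `κ l₀`, so
`tsum_mul_poi_lt_one` applies. -/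
theorem side_lt (ha : ∀ i, 0 < a i) (hc : ∀ i, a i * a (i + 2) ≤ a (i + 1) ^ 2)
    (hs : a 0 * a 2 < a 1 ^ 2) (hκ : 0 < κ) (hE : 0 < E) (hZ : 0 < Z) {l₀ : ℝ} (hl₀ : 0 < l₀)
    (hsum : HasSum (fun i => a i * (E * expPow (-κ) l₀ i)) Z)
    (hmean : HasSum (fun i : ℕ => i * (a i * (E * expPow (-κ) l₀ i))) (κ * l₀ * Z)) :
    a 0 * E ≤ Z ∧ ∀ l, 0 < l → l ≠ l₀ → Summable (fun i => a i * (E * expPow (-κ) l i)) →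
      ∑' i, a i * (E * expPow (-κ) l i) < Z := by
  set r : ℕ → ℝ := fun i => a i * E * κ⁻¹ ^ i / Z with hr
  have e : ∀ l i, r i * poi (κ * l) i = Z⁻¹ * (a i * (E * expPow (-κ) l i)) := by
    intro l i; rw [expPow_neg_eq hκ]; simp only [hr]; field_simp
  have hr0 : ∀ i, 0 < r i := fun i => by have := ha i; positivity
  have hrc : ∀ i, r i * r (i + 2) ≤ r (i + 1) ^ 2 := by
    intro i
    have h1 : r i * r (i + 2) = (E * κ⁻¹ ^ (i + 1) / Z) ^ 2 * (a i * a (i + 2)) := by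
      simp only [hr]; ring
    have h2 : r (i + 1) ^ 2 = (E * κ⁻¹ ^ (i + 1) / Z) ^ 2 * a (i + 1) ^ 2 := by
      simp only [hr]; ring
    rw [h1, h2]
    exact mul_le_mul_of_nonneg_left (hc i) (sq_nonneg _)
  have hne : ∃ i, r i ≠ 1 := by
    by_contra hno
    push Not at hno
    have h1 : r 0 * r 2 = (E * κ⁻¹ / Z) ^ 2 * (a 0 * a 2) := by simp only [hr]; ring
    have h2 : r 1 ^ 2 = (E * κ⁻¹ / Z) ^ 2 * a 1 ^ 2 := by simp only [hr]; ring
    rw [hno, hno] at h1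
    rw [hno] at h2
    have h3 : 0 < (E * κ⁻¹ / Z) ^ 2 := by positivity
    have := mul_lt_mul_of_pos_left hs h3
    linarith
  have hL : 0 < κ * l₀ := by positivity
  have := tsum_mul_poi_lt_one hr0 hrc hne hL
    (hasSum_of_eq (hsum.mul_left Z⁻¹) (e l₀) (by field_simp))
    (hasSum_of_eq (hmean.mul_left Z⁻¹) (fun i => by rw [e]; ring) (by field_simp))
  refine ⟨?_, fun l hl hne hS => ?_⟩
  · have h := this.1
    simp only [hr, pow_zero, mul_one] at h
    rwa [div_le_one hZ] at h
  · have hS' : Summable fun i => r i * poi (κ * l) i := by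
      simp only [e]; exact hS.mul_left _
    have h := this.2 (κ * l) (by positivity) (fun h => hne (mul_left_cancel₀ hκ.ne' h)) hS'
    simp only [e, tsum_mul_left] at h
    rwa [inv_mul_lt_iff₀ hZ, mul_one] at h

/-- For the location `0` only a one-sided derivative condition is available, namely `a 1 ≤ κ * a 0`.
It makes the renormalized density nonincreasing from the value `1` by log-concavity, and strictness
enters at index `2`. -/
theorem side_lt_of_zero (ha : ∀ i, 0 < a i) (hc : ∀ i, a i * a (i + 2) ≤ a (i + 1) ^ 2)
    (hs : a 0 * a 2 < a 1 ^ 2) (hκ : 0 < κ) (hE : 0 < E) (h0 : a 0 * E = Z)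
    (h1 : a 1 ≤ κ * a 0) (l : ℝ) (hl : 0 < l)
    (hS : Summable (fun i => a i * (E * expPow (-κ) l i))) :
    ∑' i, a i * (E * expPow (-κ) l i) < Z := by
  have hZ : 0 < Z := h0 ▸ mul_pos (ha 0) hE
  set r : ℕ → ℝ := fun i => a i * E * κ⁻¹ ^ i / Z with hr
  have e : ∀ l i, a i * (E * expPow (-κ) l i) = Z * (r i * poi (κ * l) i) := by
    intro l i; rw [expPow_neg_eq hκ]; simp only [hr]; field_simp
  have hr0 : ∀ i, 0 < r i := fun i => by have := ha i; positivity
  have hrc : ∀ i, r i * r (i + 2) ≤ r (i + 1) ^ 2 := by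
    intro i
    have h1 : r i * r (i + 2) = (E * κ⁻¹ ^ (i + 1) / Z) ^ 2 * (a i * a (i + 2)) := by
      simp only [hr]; ring
    have h2 : r (i + 1) ^ 2 = (E * κ⁻¹ ^ (i + 1) / Z) ^ 2 * a (i + 1) ^ 2 := by
      simp only [hr]; ring
    rw [h1, h2]
    exact mul_le_mul_of_nonneg_left (hc i) (sq_nonneg _)
  have r0 : r 0 = 1 := by simp only [hr, pow_zero, mul_one, h0]; exact div_self hZ.ne'
  have r1 : r 1 ≤ 1 := by
    simp only [hr, pow_one]
    rw [div_le_one hZ, ← h0, mul_assoc, mul_comm E, ← mul_assoc]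
    refine mul_le_mul_of_nonneg_right ?_ hE.le
    rw [← div_eq_mul_inv, div_le_iff₀ hκ]
    linarith
  have rle : ∀ i, r i ≤ 1 := by
    intro i
    have := (succ_le_of_logConcave hr0 hrc (j := 0) (by rw [r0]; exact r1) i).2
    rwa [zero_add, r0] at this
  have r2 : r 2 < 1 := by
    have h1 : r 0 * r 2 = (E * κ⁻¹ / Z) ^ 2 * (a 0 * a 2) := by simp only [hr]; ring
    have h2 : r 1 ^ 2 = (E * κ⁻¹ / Z) ^ 2 * a 1 ^ 2 := by simp only [hr]; ring
    have h3 : 0 < (E * κ⁻¹ / Z) ^ 2 := by positivity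
    have := mul_lt_mul_of_pos_left hs h3
    rw [← h1, ← h2, r0, one_mul] at this
    have := hr0 1
    nlinarith
  have hp := poi_pos (mul_pos hκ hl)
  have hlt : ∑' i, r i * poi (κ * l) i < ∑' i, poi (κ * l) i := by
    refine Summable.tsum_lt_tsum (i := 2) (fun i => ?_) ?_ ?_ (summable_poi _)
    · have := mul_le_mul_of_nonneg_right (rle i) (hp i).le; simpa using this
    · have := mul_lt_mul_of_pos_right r2 (hp 2); simpa using this
    · simp only [e] at hS
      exact (summable_mul_left_iff hZ.ne').1 hS
  rw [(hasSum_poi _).tsum_eq] at hlt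
  simp only [e, tsum_mul_left]
  have := mul_lt_mul_of_pos_left hlt hZ
  linarith

end side

/-! ### Maximizers of the affinity are nondegenerate saddle points -/

/-- `(w, l₁, l₂)` maximizes the affinity over two-point mixtures on both sides of `m`. -/
structure IsMaxMix (u b m w l₁ l₂ : ℝ) : Prop where
  w_mem : w ∈ Icc (0 : ℝ) 1
  l₁_mem : l₁ ∈ Icc 0 m
  le_l₂ : m ≤ l₂
  max : ∀ w' ∈ Icc (0 : ℝ) 1, ∀ l₁' ∈ Icc 0 m, ∀ l₂', m ≤ l₂' →
    aff u (poi m) (mix b m w' l₁' l₂') ≤ aff u (poi m) (mix b m w l₁ l₂)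

/-- A nondegenerate two-point mixture satisfying the global optimality conditions. -/
structure IsSaddle (u b m w l₁ l₂ : ℝ) : Prop where
  w_mem : w ∈ Ioo (0 : ℝ) 1
  l₁_nonneg : 0 ≤ l₁
  l₁_lt : l₁ < m
  lt_l₂ : m < l₂
  le : ∀ l, 0 ≤ l → field u b m w l₁ l₂ l ≤ aff u (poi m) (mix b m w l₁ l₂)
  eq₁ : field u b m w l₁ l₂ l₁ = aff u (poi m) (mix b m w l₁ l₂)
  eq₂ : field u b m w l₁ l₂ l₂ = aff u (poi m) (mix b m w l₁ l₂)
  lt₁ : ∀ l, 0 < l → l ≤ m → l ≠ l₁ → field u b m w l₁ l₂ l < aff u (poi m) (mix b m w l₁ l₂)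
  lt₂ : ∀ l, m ≤ l → l ≠ l₂ → field u b m w l₁ l₂ l < aff u (poi m) (mix b m w l₁ l₂)

section saddle
variable {u b m w l₁ l₂ l : ℝ}

theorem field_le_aff (hu : u ∈ Ioo (0 : ℝ) 1) (hm : 0 < m) (hw : w ∈ Ico (0 : ℝ) 1)
    (h1 : 0 ≤ l₁) (h2 : 0 < l₂) (hl : 0 ≤ l)
    (hmax : ∀ s ∈ Ioo (0 : ℝ) 1, aff u (poi m)
      (fun i => (1 - s) * mix b m w l₁ l₂ i + s * tilt b m l i) ≤
        aff u (poi m) (mix b m w l₁ l₂)) :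
    field u b m w l₁ l₂ l ≤ aff u (poi m) (mix b m w l₁ l₂) :=
  tsum_wt_le_aff hu (poi_pos hm) (mix_pos hw h1 h2) (tilt_nonneg hl) (summable_poi m) summable_mix
    summable_tilt (summable_wt_mul_tilt hm hu.1.le hw h1 h2 hl) hmax

theorem mix_one (i : ℕ) : mix b m 1 l₁ l₂ i = tilt b m l₁ i := by simp [mix]

theorem mix_zero (i : ℕ) : mix b m 0 l₁ l₂ i = tilt b m l₂ i := by simp [mix]

/-- Rewrites full weight on the first location as full weight on the second, where the lemmas
requiring weight below `1` and a positive second location apply. -/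
theorem mix_one_eq : mix b m 1 l₁ l₂ = mix b m 0 0 l₁ := by
  funext i; rw [mix_one, mix_zero]

theorem wt_single (hm : 0 < m) (hl₂ : 0 < l₂) (i : ℕ) : wt u (poi m) (mix b m 0 l₁ l₂) i =
    tiltCoeff b m l₂ ^ (-u) * ((l₂ / m) ^ (-u)) ^ i := by
  have h : 0 < l₂ / m := by positivity
  unfold wt
  rw [mix_div hm, zero_mul, zero_mul, zero_add, sub_zero, one_mul,
    Real.mul_rpow (tiltCoeff_pos _ _ _).le (by positivity), ← Real.rpow_natCast,
    ← Real.rpow_mul h.le, mul_comm (i : ℝ), Real.rpow_mul h.le, Real.rpow_natCast]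

/-- For a single location the weights are geometric, so the pairing is a Poisson generating
function. -/
theorem field_single (hm : 0 < m) (hl₂ : 0 < l₂) : field u b m 0 l₁ l₂ l =
    tiltCoeff b m l₂ ^ (-u) * Real.exp (b * |l - m| + l * ((l₂ / m) ^ (-u) - 1)) := by
  have h := (hasSum_pow_mul_poi ((l₂ / m) ^ (-u)) l).mul_left
    (tiltCoeff b m l₂ ^ (-u) * Real.exp (b * |l - m|))
  rw [Real.exp_add, ← mul_assoc, ← h.tsum_eq]
  refine tsum_congr fun i => ?_
  rw [wt_single hm hl₂]
  unfold tilt; ring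

theorem aff_eq_field (hu : u ∈ Ioo (0 : ℝ) 1) (hm : 0 < m) (hw : w ∈ Ico (0 : ℝ) 1)
    (h1 : 0 ≤ l₁) (h2 : 0 < l₂) : aff u (poi m) (mix b m w l₁ l₂) =
      w * field u b m w l₁ l₂ l₁ + (1 - w) * field u b m w l₁ l₂ l₂ := by
  rw [← tsum_wt_mul_self (poi_pos hm) (mix_pos hw h1 h2)]
  have s1 := summable_wt_mul_tilt (b := b) hm hu.1.le hw h1 h2 h1
  have s2 := summable_wt_mul_tilt (b := b) hm hu.1.le hw h1 h2 h2.le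
  unfold field
  rw [← tsum_mul_left, ← tsum_mul_left, ← (s1.mul_left _).tsum_add (s2.mul_left _)]
  refine tsum_congr fun i => ?_
  rw [show mix b m w l₁ l₂ i = w * tilt b m l₁ i + (1 - w) * tilt b m l₂ i from rfl]
  ring

theorem aff_mix_pos (hu : u ∈ Ioo (0 : ℝ) 1) (hm : 0 < m) (hw : w ∈ Ico (0 : ℝ) 1)
    (h1 : 0 ≤ l₁) (h2 : 0 < l₂) : 0 < aff u (poi m) (mix b m w l₁ l₂) := by
  have hp := poi_pos hm
  have hM := mix_pos (b := b) (m := m) hw h1 h2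
  refine (summable_aff hu (fun i => (hp i).le) (fun i => (hM i).le) (summable_poi m)
    summable_mix).tsum_pos (aff_term_nonneg (fun i => (hp i).le) (fun i => (hM i).le)) 0 ?_
  exact mul_pos (Real.rpow_pos_of_pos (hM 0) _) (Real.rpow_pos_of_pos (hp 0) _)

namespace IsMaxMix

/-- If all mass sat at `0 < l₁ ≤ m`, the weights would be geometric of ratio at least `1`, and the
field would grow at least like `e ^ (b (l - m))` on the right, against the first order condition
`field ≤ A`. -/
theorem w_ne_one_of_pos (hu : u ∈ Ioo (0 : ℝ) 1) (hb : b ∈ Ioo (0 : ℝ) 1) (hm : 0 < m)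
    (h : IsMaxMix u b m w l₁ l₂) (hl₁ : 0 < l₁) : w ≠ 1 := by
  rintro rfl
  set A := aff u (poi m) (mix b m 1 l₁ l₂) with hA
  set c₀ := tiltCoeff b m l₁ ^ (-u) with hc₀
  have hc₀0 : 0 < c₀ := Real.rpow_pos_of_pos (tiltCoeff_pos _ _ _) _
  have hle : ∀ l, m ≤ l → field u b m 0 0 l₁ l ≤ A := by
    intro l hl
    have : A = aff u (poi m) (mix b m 0 0 l₁) := by rw [hA, mix_one_eq]
    rw [this]
    refine field_le_aff hu hm ⟨le_rfl, one_pos⟩ le_rfl hl₁ (hm.le.trans hl) fun s hs => ?_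
    have h2 := h.max (1 - s) ⟨by linarith [hs.2], by linarith [hs.1]⟩ l₁ h.l₁_mem l hl
    rw [← this]
    convert h2 using 3
    rename_i i
    rw [mix_zero]
    unfold mix; ring
  have hA0 : 0 < A := by
    rw [hA, mix_one_eq]
    exact aff_mix_pos hu hm ⟨le_rfl, one_pos⟩ le_rfl hl₁
  have hτ : 1 ≤ (l₁ / m) ^ (-u) := by
    refine Real.one_le_rpow_of_pos_of_le_one_of_nonpos (by positivity) ?_ (by linarith [hu.1])
    rw [div_le_one hm]; exact h.l₁_mem.2
  -- At this location the exponent is at least `A / c₀`, so the field is at least `c₀ (A / c₀ + 1) >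
  -- A`.
  have hml : m ≤ m + A / (c₀ * b) := by
    have := hb.1
    have : 0 ≤ A / (c₀ * b) := by positivity
    linarith
  have h3 := hle _ hml
  rw [field_single hm hl₁, ← hc₀] at h3
  have h4 : A / c₀ ≤ b * |m + A / (c₀ * b) - m| + (m + A / (c₀ * b)) * ((l₁ / m) ^ (-u) - 1) := by
    have e : b * |m + A / (c₀ * b) - m| = A / c₀ := by
      have := hb.1
      rw [add_sub_cancel_left, abs_of_nonneg (by positivity)]
      field_simp
    rw [e]
    exact le_add_of_nonneg_right (mul_nonneg (hm.le.trans hml) (by linarith))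
  have h5 := Real.add_one_le_exp (A / c₀)
  have h6 := Real.exp_le_exp.2 h4
  have h7 : c₀ * (A / c₀ + 1) ≤ A :=
    (mul_le_mul_of_nonneg_left (h5.trans h6) hc₀0.le).trans h3
  rw [mul_add, mul_div_cancel₀ _ hc₀0.ne'] at h7
  linarith

/-- Mass at location `0` lives on the index `0` only. Moving a fraction `s` to location `m` loses at
most `s A` there but gains at least `s ^ (1 - u) B` at index `1`, which wins for small `s`. -/
theorem w_ne_one_of_zero (hu : u ∈ Ioo (0 : ℝ) 1) (hm : 0 < m)
    (h : IsMaxMix u b m w 0 l₂) : w ≠ 1 := by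
  rintro rfl
  have h1u : 0 < 1 - u := by linarith [hu.2]
  have hp := poi_pos hm
  set A : ℝ := tilt b m 0 0 ^ (1 - u) * poi m 0 ^ u with hA
  have ht0 : 0 < tilt b m 0 0 := by
    unfold tilt; rw [poi_zero_right]; positivity
  have hA0 : 0 < A := mul_pos (Real.rpow_pos_of_pos ht0 _) (Real.rpow_pos_of_pos (hp 0) _)
  have hAeq : aff u (poi m) (mix b m 1 0 l₂) = A := by
    unfold aff
    rw [tsum_eq_single 0, mix_one]
    intro i hi
    obtain ⟨j, rfl⟩ := Nat.exists_eq_succ_of_ne_zero hi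
    rw [mix_one]
    unfold tilt
    rw [poi_zero_left_succ, mul_zero, Real.zero_rpow h1u.ne', zero_mul]
  set B : ℝ := poi m 1 ^ (1 - u) * poi m 1 ^ u with hB
  have hB0 : 0 < B := mul_pos (Real.rpow_pos_of_pos (hp 1) _) (Real.rpow_pos_of_pos (hp 1) _)
  have key : ∀ s ∈ Ioo (0 : ℝ) 1, B ≤ s ^ u * A := by
    intro s hs
    have h1s : 0 < 1 - s := by linarith [hs.2]
    have hwm : 1 - s ∈ Icc (0 : ℝ) 1 := ⟨by linarith, by linarith [hs.1]⟩
    have h2 := h.max (1 - s) hwm 0 ⟨le_rfl, hm.le⟩ m le_rfl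
    rw [hAeq] at h2
    have hM : ∀ i, 0 ≤ mix b m (1 - s) 0 m i := mix_nonneg hwm le_rfl hm.le
    have h3 := (summable_aff hu (fun i => (hp i).le) hM (summable_poi m)
      summable_mix).sum_le_tsum (Finset.range 2)
        (fun i _ => aff_term_nonneg (fun i => (hp i).le) hM i)
    have h4 : (1 - s) * A ≤ mix b m (1 - s) 0 m 0 ^ (1 - u) * poi m 0 ^ u := by
      have h5 : ((1 - s) * tilt b m 0 0) ^ (1 - u) ≤ mix b m (1 - s) 0 m 0 ^ (1 - u) := by
        refine Real.rpow_le_rpow (mul_nonneg h1s.le ht0.le) ?_ h1u.le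
        exact le_add_of_nonneg_right (mul_nonneg (by linarith [hs.1]) (tilt_nonneg hm.le 0))
      have h6 : (1 - s) ≤ (1 - s) ^ (1 - u) := by
        have := Real.rpow_le_rpow_of_exponent_ge h1s (by linarith [hs.1])
          (by linarith [hu.1] : 1 - u ≤ 1)
        rwa [Real.rpow_one] at this
      rw [Real.mul_rpow h1s.le ht0.le] at h5
      rw [hA, ← mul_assoc]
      refine mul_le_mul_of_nonneg_right (le_trans ?_ h5) (Real.rpow_pos_of_pos (hp 0) _).le
      exact mul_le_mul_of_nonneg_right h6 (Real.rpow_pos_of_pos ht0 _).le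
    have h7 : s ^ (1 - u) * B ≤ mix b m (1 - s) 0 m 1 ^ (1 - u) * poi m 1 ^ u := by
      rw [hB, ← mul_assoc, ← Real.mul_rpow hs.1.le (hp 1).le]
      refine mul_le_mul_of_nonneg_right (Real.rpow_le_rpow (mul_nonneg hs.1.le (hp 1).le) ?_ h1u.le)
        (Real.rpow_pos_of_pos (hp 1) _).le
      unfold mix
      rw [tilt_self, sub_sub_cancel]
      exact le_add_of_nonneg_left (mul_nonneg h1s.le (tilt_nonneg le_rfl 1))
    rw [Finset.sum_range_succ, Finset.sum_range_one] at h3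
    have h8 : s ^ (1 - u) * B ≤ s * A := by
      have : ∑' i, mix b m (1 - s) 0 m i ^ (1 - u) * poi m i ^ u ≤ A := h2
      linarith
    have h9 : s ^ (1 - u) * s ^ u = s := by
      rw [← Real.rpow_add hs.1]; simp
    have h10 : s ^ (1 - u) * B ≤ s ^ (1 - u) * (s ^ u * A) := by
      calc s ^ (1 - u) * B ≤ s * A := h8
        _ = s ^ (1 - u) * (s ^ u * A) := by rw [← mul_assoc (s ^ (1 - u)), h9]
    exact le_of_mul_le_mul_left h10 (Real.rpow_pos_of_pos hs.1 _)
  have lim : Tendsto (fun s : ℝ => s ^ u * A) (𝓝[>] 0) (𝓝 0) := by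
    have hc : ContinuousAt (fun s : ℝ => s ^ u * A) 0 :=
      (Real.continuousAt_rpow_const 0 u (Or.inr hu.1.le)).mul_const A
    have := hc.tendsto
    simp only [Real.zero_rpow hu.1.ne', zero_mul] at this
    exact this.mono_left nhdsWithin_le_nhds
  have : B ≤ 0 := by
    refine ge_of_tendsto lim ?_
    filter_upwards [Ioo_mem_nhdsGT (zero_lt_one' ℝ)] with s hs using key s hs
  linarith

theorem w_lt_one (hu : u ∈ Ioo (0 : ℝ) 1) (hb : b ∈ Ioo (0 : ℝ) 1) (hm : 0 < m)
    (h : IsMaxMix u b m w l₁ l₂) : w < 1 := by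
  refine lt_of_le_of_ne h.w_mem.2 ?_
  rcases h.l₁_mem.1.eq_or_lt with rfl | h0
  · exact h.w_ne_one_of_zero hu hm
  · exact h.w_ne_one_of_pos hu hb hm h0

/-- The first order condition for the location on the right. -/
theorem mean_right (hu : u ∈ Ioo (0 : ℝ) 1) (hm : 0 < m)
    (h : IsMaxMix u b m w l₁ l₂) (hw : w < 1) (hl₂ : m < l₂) :
    ∑' i : ℕ, i * (wt u (poi m) (mix b m w l₁ l₂) i * tilt b m l₂ i) =
      (1 - b) * l₂ * field u b m w l₁ l₂ l₂ := by
  have e : ∀ l', m ≤ l' → mix b m w l₁ l' = fun i => w * tilt b m l₁ i +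
      (1 - w) * Real.exp (-(b * m)) * expPow (-(1 - b)) l' i := by
    intro l' hl'
    funext i
    unfold mix
    rw [tilt_of_ge hl']; ring
  have hev : ∀ᶠ l' in 𝓝 l₂, m ≤ l' := by
    filter_upwards [Ioi_mem_nhds hl₂] with l' hl' using le_of_lt hl'
  have key := tsum_wt_mul_nat_eq hm hu (N := fun i => w * tilt b m l₁ i)
    (fun i => mul_nonneg h.w_mem.1 (tilt_nonneg h.l₁_mem.1 i)) (summable_tilt.mul_left _)
    (c := (1 - w) * Real.exp (-(b * m))) (a := -(1 - b)) (l := l₂)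
    (mul_pos (by linarith) (Real.exp_pos _)) (hm.trans hl₂) (by
      filter_upwards [hev] with l' hl'
      rw [← e l' hl', ← e l₂ hl₂.le]
      exact h.max w h.w_mem l₁ h.l₁_mem l' hl')
  rw [← e l₂ hl₂.le] at key
  unfold field
  simp only [tilt_of_ge hl₂.le]
  have e1 : ∀ i : ℕ, i * (wt u (poi m) (mix b m w l₁ l₂) i *
      (Real.exp (-(b * m)) * expPow (-(1 - b)) l₂ i)) = Real.exp (-(b * m)) *
      (i * (wt u (poi m) (mix b m w l₁ l₂) i * expPow (-(1 - b)) l₂ i)) := fun i => by ring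
  have e2 : ∀ i : ℕ, wt u (poi m) (mix b m w l₁ l₂) i *
      (Real.exp (-(b * m)) * expPow (-(1 - b)) l₂ i) = Real.exp (-(b * m)) *
      (wt u (poi m) (mix b m w l₁ l₂) i * expPow (-(1 - b)) l₂ i) := fun i => by ring
  rw [tsum_congr e1, tsum_congr e2, tsum_mul_left, tsum_mul_left, key]
  ring

/-- The first order condition for a positive location on the left. -/
theorem mean_left (hu : u ∈ Ioo (0 : ℝ) 1) (hm : 0 < m)
    (h : IsMaxMix u b m w l₁ l₂) (hw : 0 < w) (hl₁ : 0 < l₁) (hl₁m : l₁ < m) :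
    ∑' i : ℕ, i * (wt u (poi m) (mix b m w l₁ l₂) i * tilt b m l₁ i) =
      (1 + b) * l₁ * field u b m w l₁ l₂ l₁ := by
  have e : ∀ l', l' ≤ m → mix b m w l' l₂ = fun i => (1 - w) * tilt b m l₂ i +
      w * Real.exp (b * m) * expPow (-(1 + b)) l' i := by
    intro l' hl'
    funext i
    unfold mix
    rw [tilt_of_le hl']; ring
  have key := tsum_wt_mul_nat_eq hm hu (N := fun i => (1 - w) * tilt b m l₂ i)
    (fun i => mul_nonneg (by linarith [h.w_mem.2]) (tilt_nonneg (hm.le.trans h.le_l₂) i))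
    (summable_tilt.mul_left _)
    (c := w * Real.exp (b * m)) (a := -(1 + b)) (l := l₁)
    (mul_pos hw (Real.exp_pos _)) hl₁ (by
      filter_upwards [Ioo_mem_nhds hl₁ hl₁m] with l' hl'
      rw [← e l' hl'.2.le, ← e l₁ hl₁m.le]
      exact h.max w h.w_mem l' ⟨hl'.1.le, hl'.2.le⟩ l₂ h.le_l₂)
  rw [← e l₁ hl₁m.le] at key
  unfold field
  simp only [tilt_of_le hl₁m.le]
  have e1 : ∀ i : ℕ, i * (wt u (poi m) (mix b m w l₁ l₂) i *
      (Real.exp (b * m) * expPow (-(1 + b)) l₁ i)) = Real.exp (b * m) *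
      (i * (wt u (poi m) (mix b m w l₁ l₂) i * expPow (-(1 + b)) l₁ i)) := fun i => by ring
  have e2 : ∀ i : ℕ, wt u (poi m) (mix b m w l₁ l₂) i *
      (Real.exp (b * m) * expPow (-(1 + b)) l₁ i) = Real.exp (b * m) *
      (wt u (poi m) (mix b m w l₁ l₂) i * expPow (-(1 + b)) l₁ i) := fun i => by ring
  rw [tsum_congr e1, tsum_congr e2, tsum_mul_left, tsum_mul_left, key]
  ring

/-- The first order condition for the location `0` on the left. -/
theorem wt_one_le (hu : u ∈ Ioo (0 : ℝ) 1) (hm : 0 < m)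
    (h : IsMaxMix u b m w 0 l₂) (hw : w ∈ Ioo (0 : ℝ) 1) :
    wt u (poi m) (mix b m w 0 l₂) 1 ≤ (1 + b) * wt u (poi m) (mix b m w 0 l₂) 0 := by
  have hw' : w ∈ Ico (0 : ℝ) 1 := ⟨hw.1.le, hw.2⟩
  have hl₂ : 0 < l₂ := hm.trans_le h.le_l₂
  have hp := poi_pos hm
  -- The comparison moves `t` back to `0` with the tangent taken at `t`. All terms with `i ≥ 1`
  -- vanish at location `0`, so discarding the indices `i ≥ 2` only lowers the sum; division by `t`
  -- and `t → 0` give the slope `1 + b`.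
  have key : ∀ t ∈ Ioo 0 m, wt u (poi m) (mix b m w t l₂) 1 ≤
      wt u (poi m) (mix b m w t l₂) 0 * ((Real.exp ((1 + b) * t) - 1) / t) := by
    intro t ht
    have hM' := mix_pos (b := b) (m := m) hw' ht.1.le hl₂
    have hM := mix_pos (b := b) (m := m) hw' le_rfl hl₂
    have st := summable_wt_mul_tilt (b := b) hm hu.1.le hw' ht.1.le hl₂ ht.1.le
    have s0 := summable_wt_mul_tilt (b := b) hm hu.1.le hw' ht.1.le hl₂ le_rfl
    have s2 := summable_wt_mul_tilt (b := b) hm hu.1.le hw' ht.1.le hl₂ hl₂.le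
    set a := wt u (poi m) (mix b m w t l₂) with ha
    have ha0 : ∀ i, 0 < a i := wt_mix_pos hm hw' ht.1.le hl₂
    have sN : Summable fun i => a i * mix b m w 0 l₂ i := by
      refine ((s0.mul_left w).add (s2.mul_left (1 - w))).congr fun i => ?_
      unfold mix; ring
    have htan := aff_le_of_tangent hu hp hM' (fun i => (hM i).le) (summable_poi m) summable_mix
      summable_mix sN
    have hmx := h.max w h.w_mem t ⟨ht.1.le, ht.2.le⟩ l₂ h.le_l₂
    have h3 : 0 ≤ ∑' i, a i * mix b m w 0 l₂ i - aff u (poi m) (mix b m w t l₂) := by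
      have h1u : 0 < 1 - u := by linarith [hu.2]
      by_contra hneg
      push Not at hneg
      have := mul_neg_of_pos_of_neg h1u hneg
      linarith
    have h4 : ∑' i, a i * mix b m w 0 l₂ i - aff u (poi m) (mix b m w t l₂) =
        -w * ∑' i, (a i * tilt b m t i - a i * tilt b m 0 i) := by
      rw [← tsum_wt_mul_self hp hM', ← ha, ← sN.tsum_sub, ← tsum_mul_left]
      · refine tsum_congr fun i => ?_
        unfold mix; ring
      · exact summable_wt_mul_self hu hp hM' (summable_poi m) summable_mix
    have h5 : ∑' i, (a i * tilt b m t i - a i * tilt b m 0 i) ≤ 0 := by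
      rw [h4] at h3
      nlinarith [hw.1]
    have h6 := (st.sub s0).sum_le_tsum (Finset.range 2) (fun i hi => by
      obtain ⟨j, rfl⟩ : ∃ j, i = j + 1 := ⟨i - 1, by simp at hi; omega⟩
      have : tilt b m 0 (j + 1) = 0 := by unfold tilt; rw [poi_zero_left_succ, mul_zero]
      rw [this, mul_zero, sub_zero]
      exact mul_nonneg (ha0 _).le (tilt_nonneg ht.1.le _))
    rw [Finset.sum_range_succ, Finset.sum_range_one] at h6
    have h7 := h6.trans h5
    have e0 : tilt b m t 0 = Real.exp (b * m) * Real.exp (-((1 + b) * t)) := by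
      rw [tilt_of_le ht.2.le]; simp only [expPow, neg_mul]; simp
    have e1 : tilt b m t 1 = Real.exp (b * m) * Real.exp (-((1 + b) * t)) * t := by
      rw [tilt_of_le ht.2.le]; simp only [expPow, neg_mul]; simp [mul_assoc]
    have e2 : tilt b m 0 0 = Real.exp (b * m) := by
      rw [tilt_of_le hm.le]; simp [expPow]
    have e3 : tilt b m 0 1 = 0 := by
      unfold tilt; rw [poi_zero_left_succ, mul_zero]
    rw [e0, e1, e2, e3, Real.exp_neg] at h7
    have hE := Real.exp_pos (b * m)
    have hX := Real.exp_pos ((1 + b) * t)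
    have h8 : Real.exp (b * m) * (a 1 * t) ≤
        Real.exp (b * m) * (a 0 * (Real.exp ((1 + b) * t) - 1)) := by
      have h9 := mul_le_mul_of_nonneg_right h7 hX.le
      have h10 : (a 0 * (Real.exp (b * m) * (Real.exp ((1 + b) * t))⁻¹) - a 0 * Real.exp (b * m) +
          (a 1 * (Real.exp (b * m) * (Real.exp ((1 + b) * t))⁻¹ * t) - a 1 * 0)) *
          Real.exp ((1 + b) * t) = Real.exp (b * m) * (a 1 * t) -
          Real.exp (b * m) * (a 0 * (Real.exp ((1 + b) * t) - 1)) := by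
        field_simp; ring
      rw [h10] at h9
      linarith
    have h11 := le_of_mul_le_mul_left h8 hE
    rw [← mul_div_assoc, le_div_iff₀ ht.1]
    exact h11
  have hwt : ∀ i, Tendsto (fun t => wt u (poi m) (mix b m w t l₂) i) (𝓝[>] 0)
      (𝓝 (wt u (poi m) (mix b m w 0 l₂) i)) := by
    intro i
    have hc : ContinuousAt (fun t => wt u (poi m) (mix b m w t l₂) i) 0 := by
      unfold wt
      refine ContinuousAt.rpow_const ?_
        (Or.inl (div_pos (mix_pos hw' le_rfl hl₂ i) (hp i)).ne')
      simp only [mix, tilt, poi]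
      fun_prop
    exact hc.tendsto.mono_left nhdsWithin_le_nhds
  have hsl : Tendsto (fun t : ℝ => (Real.exp ((1 + b) * t) - 1) / t) (𝓝[>] 0) (𝓝 (1 + b)) := by
    have hd : HasDerivAt (fun t : ℝ => Real.exp ((1 + b) * t)) (1 + b) 0 := by
      have := ((hasDerivAt_id (0 : ℝ)).const_mul (1 + b)).exp
      simpa using this
    have := hd.tendsto_slope.mono_left
      (nhdsWithin_mono 0 fun x (hx : 0 < x) => hx.ne' : 𝓝[>] (0 : ℝ) ≤ 𝓝[≠] 0)
    refine this.congr fun t => ?_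
    rw [slope_def_field]; simp
  refine le_of_tendsto_of_tendsto (hwt 1) ((hsl.mul (hwt 0))) ?_
  filter_upwards [Ioo_mem_nhdsGT hm] with t ht
  have := key t ht
  linarith

end IsMaxMix
end saddle

/-! ### Nondegeneracy of maximizers and the saddle property -/

section saddle
variable {u b m w l₁ l₂ l : ℝ}

namespace IsMaxMix

/-- Moving mass from `l₂` to `0` must not help, so the exponent of the field at `0`, which is `b m`,
is at most the one at `l₂`. The latter is `0` if `l₂ = m`, and `-b m` if `l₂ > m`, since the mean
condition then forces the ratio `(l₂ / m) ^ (-u)` to be `1 - b`. -/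
theorem w_ne_zero (hu : u ∈ Ioo (0 : ℝ) 1) (hb : b ∈ Ioo (0 : ℝ) 1) (hm : 0 < m)
    (h : IsMaxMix u b m w l₁ l₂) : w ≠ 0 := by
  rintro rfl
  have hl₂ : 0 < l₂ := hm.trans_le h.le_l₂
  have h01 : (0 : ℝ) ∈ Ico (0 : ℝ) 1 := ⟨le_rfl, one_pos⟩
  have hle : field u b m 0 l₁ l₂ 0 ≤ aff u (poi m) (mix b m 0 l₁ l₂) := by
    refine field_le_aff hu hm h01 h.l₁_mem.1 hl₂ le_rfl fun s hs => ?_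
    have h2 := h.max s ⟨hs.1.le, hs.2.le⟩ 0 ⟨le_rfl, hm.le⟩ l₂ h.le_l₂
    convert h2 using 3
    rename_i i
    rw [mix_zero]; unfold mix; ring
  rw [aff_eq_field hu hm h01 h.l₁_mem.1 hl₂, zero_mul, zero_add, sub_zero, one_mul,
    field_single hm hl₂, field_single hm hl₂] at hle
  have hle2 := le_of_mul_le_mul_left hle (Real.rpow_pos_of_pos (tiltCoeff_pos b m l₂) (-u))
  rw [Real.exp_le_exp, zero_mul, add_zero, zero_sub, abs_neg, abs_of_pos hm,
    abs_of_nonneg (sub_nonneg.2 h.le_l₂)] at hle2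
  have hbm : 0 < b * m := mul_pos hb.1 hm
  rcases h.le_l₂.eq_or_lt with rfl | hlt
  · rw [div_self hm.ne', Real.one_rpow] at hle2
    linarith
  · have hmean := h.mean_right hu hm one_pos hlt
    rw [field_single hm hl₂] at hmean
    have h3 := (hasSum_nat_mul_pow_mul_poi ((l₂ / m) ^ (-u)) l₂).mul_left
      (tiltCoeff b m l₂ ^ (-u) * Real.exp (b * |l₂ - m|))
    have h4 : ∑' i : ℕ, i * (wt u (poi m) (mix b m 0 l₁ l₂) i * tilt b m l₂ i) =
        tiltCoeff b m l₂ ^ (-u) * Real.exp (b * |l₂ - m|) * ((l₂ / m) ^ (-u) * l₂ *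
          Real.exp (l₂ * ((l₂ / m) ^ (-u) - 1))) := by
      rw [← h3.tsum_eq]
      refine tsum_congr fun i => ?_
      rw [wt_single hm hl₂]
      unfold tilt; ring
    rw [h4, Real.exp_add] at hmean
    have h5 : (l₂ / m) ^ (-u) = 1 - b := by
      have hE := Real.exp_pos (b * |l₂ - m|)
      have hX := Real.exp_pos (l₂ * ((l₂ / m) ^ (-u) - 1))
      have hc := Real.rpow_pos_of_pos (tiltCoeff_pos b m l₂) (-u)
      have hne : tiltCoeff b m l₂ ^ (-u) * Real.exp (b * |l₂ - m|) * l₂ *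
          Real.exp (l₂ * ((l₂ / m) ^ (-u) - 1)) ≠ 0 := by positivity
      apply mul_right_cancel₀ hne
      linarith
    rw [h5] at hle2
    nlinarith

/-- Both fields are at most the affinity, and the affinity is their average with weights `w` and `1
- w`, both positive. -/
theorem field_eq (hu : u ∈ Ioo (0 : ℝ) 1) (hm : 0 < m)
    (h : IsMaxMix u b m w l₁ l₂) (hw : w ∈ Ioo (0 : ℝ) 1) :
    field u b m w l₁ l₂ l₁ = aff u (poi m) (mix b m w l₁ l₂) ∧
      field u b m w l₁ l₂ l₂ = aff u (poi m) (mix b m w l₁ l₂) := by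
  have hw' : w ∈ Ico (0 : ℝ) 1 := ⟨hw.1.le, hw.2⟩
  have hl₂ : 0 < l₂ := hm.trans_le h.le_l₂
  have f1 : field u b m w l₁ l₂ l₁ ≤ aff u (poi m) (mix b m w l₁ l₂) := by
    refine field_le_aff hu hm hw' h.l₁_mem.1 hl₂ h.l₁_mem.1 fun s hs => ?_
    have h2 := h.max ((1 - s) * w + s) ⟨by nlinarith [hs.1, hs.2, hw.1],
      by nlinarith [hs.1, hs.2, hw.2]⟩ l₁ h.l₁_mem l₂ h.le_l₂
    convert h2 using 3
    unfold mix; ring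
  have f2 : field u b m w l₁ l₂ l₂ ≤ aff u (poi m) (mix b m w l₁ l₂) := by
    refine field_le_aff hu hm hw' h.l₁_mem.1 hl₂ hl₂.le fun s hs => ?_
    have h2 := h.max ((1 - s) * w) ⟨by nlinarith [hs.1, hs.2, hw.1],
      by nlinarith [hs.1, hs.2, hw.2, hw.1]⟩ l₁ h.l₁_mem l₂ h.le_l₂
    convert h2 using 3
    unfold mix; ring
  have e := aff_eq_field (b := b) hu hm hw' h.l₁_mem.1 hl₂
  have hw1 : 0 < 1 - w := by linarith [hw.2]
  constructor <;> nlinarith [hw.1]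

/-- On `[m, ∞)` this is `side_lt` with rate `1 - b`; the condition `b < 1` keeps the rate positive.
-/
theorem right_lt (hu : u ∈ Ioo (0 : ℝ) 1) (hb : b ∈ Ioo (0 : ℝ) 1) (hm : 0 < m)
    (h : IsMaxMix u b m w l₁ l₂) (hw : w ∈ Ioo (0 : ℝ) 1) (hl₂ : m < l₂) :
    ∀ l, m ≤ l → l ≠ l₂ → field u b m w l₁ l₂ l < aff u (poi m) (mix b m w l₁ l₂) := by
  have hw' : w ∈ Ico (0 : ℝ) 1 := ⟨hw.1.le, hw.2⟩
  have hl₂0 : 0 < l₂ := hm.trans hl₂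
  have hb1 : 0 < 1 - b := by linarith [hb.2]
  have h1 := h.l₁_mem.1
  intro l hl hne
  have hS := fun l (hl : 0 ≤ l) => summable_wt_mul_tilt (b := b) hm hu.1.le hw' h1 hl₂0 hl
  have hsum := (hS l₂ hl₂0.le).hasSum
  have hmean := (summable_nat_mul_wt_mul_tilt (b := b) hm hu.1.le hw' h1 hl₂0 hl₂0.le).hasSum
  rw [h.mean_right hu hm hw.2 hl₂, (h.field_eq hu hm hw).2] at hmean
  rw [show (∑' i, wt u (poi m) (mix b m w l₁ l₂) i * tilt b m l₂ i) = _ from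
    (h.field_eq hu hm hw).2] at hsum
  have key := (side_lt (wt_mix_pos hm hw' h1 hl₂0)
    (wt_mix_logConcave (b := b) hm hu.1 hw' h1 hl₂0)
    (wt_mix_strict hm hu.1 hw h1 (h.l₁_mem.2.trans_lt hl₂)) hb1 (Real.exp_pos (-(b * m)))
    (aff_mix_pos hu hm hw' h1 hl₂0) hl₂0
    (hasSum_of_eq hsum (fun i => by rw [tilt_of_ge hl₂.le]) rfl)
    (hasSum_of_eq hmean (fun i => by rw [tilt_of_ge hl₂.le]) rfl)).2 l (hm.trans_le hl) hne
    ((hS l (hm.le.trans hl)).congr fun i => by rw [tilt_of_ge hl])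
  unfold field
  simpa only [tilt_of_ge hl] using key

/-- On `[0, m]` the rate is `1 + b`. An optimal location at `0` is handled by its boundary condition
`wt_one_le`, a positive one by the mean condition. The value at `0` is only bounded weakly. -/
theorem left_lt (hu : u ∈ Ioo (0 : ℝ) 1) (hb : b ∈ Ioo (0 : ℝ) 1) (hm : 0 < m)
    (h : IsMaxMix u b m w l₁ l₂) (hw : w ∈ Ioo (0 : ℝ) 1) (hl₁ : l₁ < m) :
    field u b m w l₁ l₂ 0 ≤ aff u (poi m) (mix b m w l₁ l₂) ∧
    ∀ l, 0 < l → l ≤ m → l ≠ l₁ →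
      field u b m w l₁ l₂ l < aff u (poi m) (mix b m w l₁ l₂) := by
  have hw' : w ∈ Ico (0 : ℝ) 1 := ⟨hw.1.le, hw.2⟩
  have hl₂0 : 0 < l₂ := hm.trans_le h.le_l₂
  have hb1 : 0 < 1 + b := by linarith [hb.1]
  have h1 := h.l₁_mem.1
  have h12 : l₁ < l₂ := hl₁.trans_le h.le_l₂
  have hS := fun l (hl : 0 ≤ l) => summable_wt_mul_tilt (b := b) hm hu.1.le hw' h1 hl₂0 hl
  have hz : field u b m w l₁ l₂ 0 =
      wt u (poi m) (mix b m w l₁ l₂) 0 * Real.exp (b * m) := by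
    unfold field
    rw [tsum_eq_single 0]
    · rw [tilt_of_le hm.le]; simp [expPow]
    · intro i hi
      obtain ⟨j, rfl⟩ := Nat.exists_eq_succ_of_ne_zero hi
      unfold tilt
      rw [poi_zero_left_succ, mul_zero, mul_zero]
  rcases h1.eq_or_lt with rfl | hl₁0
  · refine ⟨(h.field_eq hu hm hw).1.le, fun l hl hlm hne => ?_⟩
    have key := side_lt_of_zero (wt_mix_pos hm hw' h1 hl₂0)
      (wt_mix_logConcave (b := b) hm hu.1 hw' h1 hl₂0)
      (wt_mix_strict hm hu.1 hw h1 h12) hb1 (Real.exp_pos (b * m))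
      (hz.symm.trans (h.field_eq hu hm hw).1) (h.wt_one_le hu hm hw) l hl
      ((hS l hl.le).congr fun i => by rw [tilt_of_le hlm])
    unfold field
    simpa only [tilt_of_le hlm] using key
  · have hsum := (hS l₁ h1).hasSum
    have hmean := (summable_nat_mul_wt_mul_tilt (b := b) hm hu.1.le hw' h1 hl₂0 h1).hasSum
    rw [h.mean_left hu hm hw.1 hl₁0 hl₁, (h.field_eq hu hm hw).1] at hmean
    rw [show (∑' i, wt u (poi m) (mix b m w l₁ l₂) i * tilt b m l₁ i) = _ from
      (h.field_eq hu hm hw).1] at hsum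
    have key := side_lt (wt_mix_pos hm hw' h1 hl₂0)
      (wt_mix_logConcave (b := b) hm hu.1 hw' h1 hl₂0)
      (wt_mix_strict hm hu.1 hw h1 h12) hb1 (Real.exp_pos (b * m))
      (aff_mix_pos hu hm hw' h1 hl₂0) hl₁0
      (hasSum_of_eq hsum (fun i => by rw [tilt_of_le hl₁.le]) rfl)
      (hasSum_of_eq hmean (fun i => by rw [tilt_of_le hl₁.le]) rfl)
    refine ⟨hz ▸ key.1, fun l hl hlm hne => ?_⟩
    have := key.2 l hl hne ((hS l hl.le).congr fun i => by rw [tilt_of_le hlm])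
    unfold field
    simpa only [tilt_of_le hlm] using this

theorem isSaddle (hu : u ∈ Ioo (0 : ℝ) 1) (hb : b ∈ Ioo (0 : ℝ) 1) (hm : 0 < m)
    (h : IsMaxMix u b m w l₁ l₂) : IsSaddle u b m w l₁ l₂ := by
  have hw : w ∈ Ioo (0 : ℝ) 1 :=
    ⟨lt_of_le_of_ne h.w_mem.1 (h.w_ne_zero hu hb hm).symm, h.w_lt_one hu hb hm⟩
  have hfe := h.field_eq hu hm hw
  -- With both locations at `m` the weight is irrelevant, so weight `0` would also be maximal, which
  -- `w_ne_zero` excludes.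
  have hne : ¬ (l₁ = m ∧ l₂ = m) := by
    rintro ⟨rfl, rfl⟩
    have e : mix b l₂ 0 l₂ l₂ = mix b l₂ w l₂ l₂ := by funext i; unfold mix; ring
    have h0 : IsMaxMix u b l₂ 0 l₂ l₂ :=
      ⟨⟨le_rfl, zero_le_one⟩, h.l₁_mem, h.le_l₂, fun w' hw' a ha c hc => by
        rw [e]; exact h.max w' hw' a ha c hc⟩
    exact h0.w_ne_zero hu hb hm rfl
  -- If `l₁ = m < l₂`, the point `m` belongs to the right side, where the inequality is strict away
  -- from `l₂`; yet the field at `l₁` equals the affinity. The argument for `l₂` is symmetric.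
  have hl₁ : l₁ < m := by
    refine lt_of_le_of_ne h.l₁_mem.2 fun he => ?_
    have hl₂ : m < l₂ := lt_of_le_of_ne h.le_l₂ fun h' => hne ⟨he, h'.symm⟩
    have := h.right_lt hu hb hm hw hl₂ m le_rfl hl₂.ne
    have h3 := hfe.1
    rw [he] at h3 this
    linarith
  have hl₂ : m < l₂ := by
    refine lt_of_le_of_ne h.le_l₂ fun he => ?_
    have := (h.left_lt hu hb hm hw hl₁).2 m hm le_rfl hl₁.ne'
    have h3 := hfe.2
    rw [← he] at h3 this
    linarith
  have hL := h.left_lt hu hb hm hw hl₁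
  have hR := h.right_lt hu hb hm hw hl₂
  refine ⟨hw, h.l₁_mem.1, hl₁, hl₂, fun l hl => ?_, hfe.1, hfe.2, hL.2, hR⟩
  rcases hl.eq_or_lt with rfl | hl0
  · exact hL.1
  rcases le_total l m with hlm | hlm
  · by_cases hll : l = l₁
    · rw [hll]; exact hfe.1.le
    · exact (hL.2 l hl0 hlm hll).le
  · by_cases hll : l = l₂
    · rw [hll]; exact hfe.2.le
    · exact (hR l hlm hll).le

end IsMaxMix

/-! ### Global optimality and uniqueness of saddle points -/

namespace IsSaddle

theorem l₂_pos (h : IsSaddle u b m w l₁ l₂) : 0 < l₂ := by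
  linarith [h.l₁_nonneg, h.l₁_lt, h.lt_l₂]

theorem w_mem' (h : IsSaddle u b m w l₁ l₂) : w ∈ Ico (0 : ℝ) 1 := ⟨h.w_mem.1.le, h.w_mem.2⟩

theorem mix_pos (h : IsSaddle u b m w l₁ l₂) (i : ℕ) : 0 < mix b m w l₁ l₂ i :=
  SemilinearTest.mix_pos h.w_mem' h.l₁_nonneg h.l₂_pos i

theorem aff_pos (hu : u ∈ Ioo (0 : ℝ) 1) (hm : 0 < m) (h : IsSaddle u b m w l₁ l₂) :
    0 < aff u (poi m) (mix b m w l₁ l₂) :=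
  aff_mix_pos hu hm h.w_mem' h.l₁_nonneg h.l₂_pos

theorem summable (hu : u ∈ Ioo (0 : ℝ) 1) (hm : 0 < m) (h : IsSaddle u b m w l₁ l₂)
    (hl : 0 ≤ l) : Summable fun i => wt u (poi m) (mix b m w l₁ l₂) i * tilt b m l i :=
  summable_wt_mul_tilt hm hu.1.le h.w_mem' h.l₁_nonneg h.l₂_pos hl

variable {w' l₁' l₂' : ℝ}

theorem hasSum_mix (hu : u ∈ Ioo (0 : ℝ) 1) (hm : 0 < m) (h : IsSaddle u b m w l₁ l₂)
    (h1 : 0 ≤ l₁') (h2 : 0 ≤ l₂') :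
    HasSum (fun i => wt u (poi m) (mix b m w l₁ l₂) i * mix b m w' l₁' l₂' i)
      (w' * field u b m w l₁ l₂ l₁' + (1 - w') * field u b m w l₁ l₂ l₂') := by
  refine hasSum_of_eq (((h.summable hu hm h1).hasSum.mul_left w').add
    ((h.summable hu hm h2).hasSum.mul_left (1 - w'))) (fun i => ?_) rfl
  unfold mix; ring

/-- A saddle point maximizes the affinity over all two-point mixtures. -/
theorem aff_le (hu : u ∈ Ioo (0 : ℝ) 1) (hm : 0 < m) (h : IsSaddle u b m w l₁ l₂)
    (hw' : w' ∈ Icc (0 : ℝ) 1) (h1 : 0 ≤ l₁') (h2 : 0 ≤ l₂') :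
    aff u (poi m) (mix b m w' l₁' l₂') ≤ aff u (poi m) (mix b m w l₁ l₂) := by
  have hs := h.hasSum_mix hu hm (w' := w') h1 h2
  have ht := aff_le_of_tangent hu (poi_pos hm) h.mix_pos (mix_nonneg hw' h1 h2) (summable_poi m)
    summable_mix summable_mix hs.summable
  rw [hs.tsum_eq] at ht
  have f1 := h.le l₁' h1
  have f2 := h.le l₂' h2
  have : 0 < 1 - u := by linarith [hu.2]
  have h3 : w' * field u b m w l₁ l₂ l₁' + (1 - w') * field u b m w l₁ l₂ l₂' ≤
      aff u (poi m) (mix b m w l₁ l₂) := by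
    nlinarith [mul_le_mul_of_nonneg_left f1 hw'.1,
      mul_le_mul_of_nonneg_left f2 (sub_nonneg.2 hw'.2)]
  nlinarith

/-- Two saddles have equal affinity, so equality holds in the strict tangent inequality and the
mixtures coincide. Their fields then coincide, and strict maximality on each side identifies the
locations; distinct locations have distinct tilted weights, which identifies `w`. -/
theorem unique (hu : u ∈ Ioo (0 : ℝ) 1) (hm : 0 < m) (h : IsSaddle u b m w l₁ l₂)
    (h' : IsSaddle u b m w' l₁' l₂') : w' = w ∧ l₁' = l₁ ∧ l₂' = l₂ := by
  have hw' : w' ∈ Icc (0 : ℝ) 1 := ⟨h'.w_mem.1.le, h'.w_mem.2.le⟩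
  have hle := h'.aff_le hu hm ⟨h.w_mem.1.le, h.w_mem.2.le⟩ h.l₁_nonneg h.l₂_pos.le
  have hs := h.hasSum_mix hu hm (w' := w') h'.l₁_nonneg h'.l₂_pos.le
  have heq : mix b m w' l₁' l₂' = mix b m w l₁ l₂ := by
    funext i
    refine eq_of_aff_eq_tangent hu (poi_pos hm) h.mix_pos (fun i => (h'.mix_pos i).le)
      (summable_poi m) summable_mix summable_mix hs.summable ?_ i
    rw [hs.tsum_eq]
    have f1 := h.le l₁' h'.l₁_nonneg
    have f2 := h.le l₂' h'.l₂_pos.le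
    have : 0 < 1 - u := by linarith [hu.2]
    have h3 : w' * field u b m w l₁ l₂ l₁' + (1 - w') * field u b m w l₁ l₂ l₂' ≤
        aff u (poi m) (mix b m w l₁ l₂) := by
      nlinarith [mul_le_mul_of_nonneg_left f1 hw'.1,
        mul_le_mul_of_nonneg_left f2 (sub_nonneg.2 hw'.2)]
    nlinarith
  have hf : ∀ l, field u b m w' l₁' l₂' l = field u b m w l₁ l₂ l := by
    intro l; unfold field; rw [heq]
  have e2 : l₂' = l₂ := by
    by_contra hne
    have := h.lt₂ l₂' h'.lt_l₂.le hne
    rw [← hf, h'.eq₂, heq] at this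
    exact lt_irrefl _ this
  have e1 : l₁' = l₁ := by
    by_contra hne
    -- Strictness `lt₁` is not available at location `0`, so when `l₁' = 0` it is applied for `h'`
    -- at the positive point `l₁` instead.
    rcases h'.l₁_nonneg.eq_or_lt with h0 | h0
    · have hpos : 0 < l₁ := lt_of_le_of_ne h.l₁_nonneg fun h3 => hne (h0.symm.trans h3)
      have := h'.lt₁ l₁ hpos h.l₁_lt.le (Ne.symm hne)
      rw [hf, h.eq₁, heq] at this
      exact lt_irrefl _ this
    · have := h.lt₁ l₁' h0 h'.l₁_lt.le hne
      rw [← hf, h'.eq₁, heq] at this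
      exact lt_irrefl _ this
  refine ⟨?_, e1, e2⟩
  subst e1 e2
  by_contra hne
  have hd : ∀ i, tilt b m l₁' i = tilt b m l₂' i := by
    intro i
    have := congrFun heq i
    unfold mix at this
    have h3 : (w' - w) * (tilt b m l₁' i - tilt b m l₂' i) = 0 := by linear_combination this
    rcases mul_eq_zero.1 h3 with h4 | h4
    · exact absurd (sub_eq_zero.1 h4) hne
    · exact sub_eq_zero.1 h4
  have h0 := hd 0
  have h1 := hd 1
  unfold tilt at h0 h1
  rw [poi_zero_right, poi_zero_right] at h0
  rw [poi_one_right, poi_one_right, ← mul_assoc, ← mul_assoc, h0] at h1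
  have : l₁' = l₂' := mul_left_cancel₀
    (mul_pos (Real.exp_pos _) (Real.exp_pos _)).ne' h1
  linarith [h.l₁_lt, h.lt_l₂]

end IsSaddle
end saddle

/-! ### Existence and continuity of the saddle point -/

/-- The tilted Poisson weights at the location `-log z`, extended by `0` to `z = 0`. -/
noncomputable def tiltZ (b m z : ℝ) (i : ℕ) : ℝ :=
  Real.exp (-(b * m)) * (z ^ (1 - b) * (-Real.log z) ^ i / (i.factorial : ℝ))

/-- Two-point mixtures in compactified coordinates. -/
noncomputable def mixZ (b m w l₁ z : ℝ) (i : ℕ) : ℝ := w * tilt b m l₁ i + (1 - w) * tiltZ b m z i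

section
variable {u b b₁ m w l₁ l₂ z : ℝ}

theorem tiltZ_eq (hz : 0 < z) (hzm : m ≤ -Real.log z) (i : ℕ) :
    tiltZ b m z i = tilt b m (-Real.log z) i := by
  rw [tilt_of_ge hzm]
  unfold tiltZ expPow
  rw [Real.rpow_def_of_pos hz]
  congr 4; ring

theorem tiltZ_zero (hb : b < 1) (i : ℕ) : tiltZ b m 0 i = 0 := by
  unfold tiltZ
  rw [Real.zero_rpow (by linarith)]; simp

theorem mixZ_eq (hz : 0 < z) (hzm : m ≤ -Real.log z) :
    mixZ b m w l₁ z = mix b m w l₁ (-Real.log z) := by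
  funext i; unfold mixZ mix; rw [tiltZ_eq hz hzm]

/-- The decay `z ^ (1 - b)` is at most `z ^ (2 c)` with `c = (1 - b₁) / 2`. One half turns `l ^ i /
i!` into `c⁻¹ ^ i` times a Poisson weight; the other half stays as `z ^ c` and tends to `0` with
`z`, uniformly for `b ≤ b₁`. -/
theorem tiltZ_mem (hm : 0 < m) (hb : b ∈ Icc 0 b₁) (hb₁ : b₁ < 1)
    (hz : z ∈ Icc 0 (Real.exp (-m))) (i : ℕ) :
    0 ≤ tiltZ b m z i ∧ tiltZ b m z i ≤ ((1 - b₁) / 2)⁻¹ ^ i * z ^ ((1 - b₁) / 2) := by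
  set c := (1 - b₁) / 2 with hc
  have hc0 : 0 < c := by rw [hc]; linarith
  rcases hz.1.eq_or_lt with rfl | hz0
  · rw [tiltZ_zero (hb.2.trans_lt hb₁), Real.zero_rpow hc0.ne', mul_zero]
    exact ⟨le_rfl, le_rfl⟩
  · have hlog : m ≤ -Real.log z := by
      have := Real.log_le_log hz0 hz.2
      rw [Real.log_exp] at this; linarith
    set l := -Real.log z with hl
    have hl0 : 0 < l := hm.trans_le hlog
    have hzl : Real.log z = -l := by rw [hl]; ring
    constructor
    · unfold tiltZ
      rw [← hl]
      positivity
    · unfold tiltZ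
      rw [← hl]
      have h1 : Real.exp (-(b * m)) ≤ 1 := by
        rw [Real.exp_le_one_iff]
        have := mul_nonneg hb.1 hm.le
        linarith
      have h2 : z ^ (1 - b) ≤ z ^ (c + c) := by
        refine Real.rpow_le_rpow_of_exponent_ge hz0 ?_ ?_
        · exact hz.2.trans (by rw [Real.exp_le_one_iff]; linarith)
        · rw [hc]; linarith [hb.2]
      have h3 : z ^ (c + c) * l ^ i / (i.factorial : ℝ) = c⁻¹ ^ i * poi (c * l) i * z ^ c := by
        unfold poi
        rw [Real.rpow_add hz0, Real.rpow_def_of_pos hz0, hzl, mul_pow, inv_pow]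
        have : Real.exp (-l * c) = Real.exp (-(c * l)) := by congr 1; ring
        rw [this]
        field_simp
      have h4 : z ^ (1 - b) * l ^ i / (i.factorial : ℝ) ≤ c⁻¹ ^ i * z ^ c := by
        calc z ^ (1 - b) * l ^ i / (i.factorial : ℝ)
            ≤ z ^ (c + c) * l ^ i / (i.factorial : ℝ) := by gcongr
          _ = c⁻¹ ^ i * poi (c * l) i * z ^ c := h3
          _ ≤ c⁻¹ ^ i * 1 * z ^ c := by
            gcongr
            exact poi_le_one (by positivity) i
          _ = _ := by ring
      calc Real.exp (-(b * m)) * (z ^ (1 - b) * l ^ i / (i.factorial : ℝ))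
          ≤ 1 * (z ^ (1 - b) * l ^ i / (i.factorial : ℝ)) := by gcongr
        _ ≤ _ := by rw [one_mul]; exact h4

/-- The point `z = 0` is reached by squeezing with the bound `z ^ c` of `tiltZ_mem`, jointly in `b`.
-/
theorem continuousOn_tiltZ (hm : 0 < m) (hb₁ : b₁ < 1) (i : ℕ) :
    ContinuousOn (fun x : ℝ × ℝ => tiltZ x.1 m x.2 i)
      (Icc 0 b₁ ×ˢ Icc 0 (Real.exp (-m))) := by
  rintro ⟨b, z⟩ ⟨hb, hz⟩
  rcases hz.1.eq_or_lt with rfl | hz0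
  · have hc0 : 0 < (1 - b₁) / 2 := by linarith
    have hlim : Tendsto (fun x : ℝ × ℝ => ((1 - b₁) / 2)⁻¹ ^ i * x.2 ^ ((1 - b₁) / 2))
        (𝓝[Icc 0 b₁ ×ˢ Icc 0 (Real.exp (-m))] (b, 0)) (𝓝 0) := by
      have hc : ContinuousAt
          (fun x : ℝ × ℝ => ((1 - b₁) / 2)⁻¹ ^ i * x.2 ^ ((1 - b₁) / 2)) (b, 0) :=
        (ContinuousAt.rpow_const continuousAt_snd (Or.inr hc0.le)).const_mul _
      have := hc.tendsto
      simp only [Real.zero_rpow hc0.ne', mul_zero] at this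
      exact this.mono_left nhdsWithin_le_nhds
    unfold ContinuousWithinAt
    simp only [tiltZ_zero (hb.2.trans_lt hb₁)]
    refine tendsto_of_tendsto_of_tendsto_of_le_of_le' tendsto_const_nhds hlim ?_ ?_
    · filter_upwards [self_mem_nhdsWithin] with x hx using (tiltZ_mem hm hx.1 hb₁ hx.2 i).1
    · filter_upwards [self_mem_nhdsWithin] with x hx using (tiltZ_mem hm hx.1 hb₁ hx.2 i).2
  · refine ContinuousAt.continuousWithinAt ?_
    unfold tiltZ
    have h1 : ContinuousAt (fun x : ℝ × ℝ => x.2 ^ (1 - x.1)) (b, z) :=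
      ContinuousAt.rpow continuousAt_snd (by fun_prop) (Or.inl hz0.ne')
    have h2 : ContinuousAt (fun x : ℝ × ℝ => Real.log x.2) (b, z) :=
      ContinuousAt.log continuousAt_snd hz0.ne'
    have h3 : ContinuousAt (fun x : ℝ × ℝ => Real.exp (-(x.1 * m))) (b, z) := by fun_prop
    exact h3.mul ((h1.mul (h2.neg.pow i)).div_const _)

/-- The domain of the compactified coordinates. -/
def boxZ (m : ℝ) : Set (ℝ × ℝ × ℝ) := Icc 0 1 ×ˢ Icc 0 m ×ˢ Icc 0 (Real.exp (-m))

theorem isCompact_boxZ (m : ℝ) : IsCompact (boxZ m) :=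
  isCompact_Icc.prod (isCompact_Icc.prod isCompact_Icc)

theorem mixZ_mem (hm : 0 < m) (hb : b ∈ Icc 0 b₁) (hb₁ : b₁ < 1) (h : (w, l₁, z) ∈ boxZ m)
    (i : ℕ) : 0 ≤ mixZ b m w l₁ z i ∧
      mixZ b m w l₁ z i ≤ Real.exp m * (1 + ((1 - b₁) / 2)⁻¹) ^ i := by
  obtain ⟨hw, hl, hz⟩ := h
  simp only at hw hl hz
  obtain ⟨h1, h2⟩ := tiltZ_mem hm hb hb₁ hz i
  have ht := tilt_nonneg (b := b) (m := m) hl.1 i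
  have hc0 : 0 < ((1 - b₁) / 2)⁻¹ := by rw [inv_pos]; linarith
  set D := 1 + ((1 - b₁) / 2)⁻¹ with hD
  have hem : 1 ≤ Real.exp m := Real.one_le_exp hm.le
  have hD1 : 1 ≤ D ^ i := one_le_pow₀ (by rw [hD]; linarith)
  have t1 : tilt b m l₁ i ≤ Real.exp m * D ^ i := by
    unfold tilt
    have h3 : Real.exp (b * |l₁ - m|) ≤ Real.exp m := by
      apply Real.exp_le_exp.2
      rw [abs_of_nonpos (by linarith [hl.2])]
      nlinarith [hb.1, hb.2, hl.1, hl.2]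
    calc _ ≤ Real.exp m * 1 := by
          gcongr
          · exact poi_nonneg hl.1 i
          · exact poi_le_one hl.1 i
      _ ≤ Real.exp m * D ^ i := by gcongr
  have t2 : tiltZ b m z i ≤ Real.exp m * D ^ i := by
    have h4 : z ^ ((1 - b₁) / 2) ≤ 1 := Real.rpow_le_one hz.1
      (hz.2.trans (by rw [Real.exp_le_one_iff]; linarith)) (by linarith)
    calc tiltZ b m z i ≤ ((1 - b₁) / 2)⁻¹ ^ i * z ^ ((1 - b₁) / 2) := h2
      _ ≤ D ^ i * 1 := by
        gcongr
        · exact Real.rpow_nonneg hz.1 _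
        · rw [hD]; linarith
      _ ≤ D ^ i * Real.exp m := by gcongr
      _ = _ := by ring
  have hw' : 0 ≤ 1 - w := by linarith [hw.2]
  refine ⟨add_nonneg (mul_nonneg hw.1 ht) (mul_nonneg hw' h1), ?_⟩
  unfold mixZ
  calc _ ≤ w * (Real.exp m * D ^ i) + (1 - w) * (Real.exp m * D ^ i) :=
        add_le_add (mul_le_mul_of_nonneg_left t1 hw.1) (mul_le_mul_of_nonneg_left t2 hw')
    _ = _ := by ring

theorem affZ_term_le (hu : u ∈ Ioo (0 : ℝ) 1) (hm : 0 < m) (hb : b ∈ Icc 0 b₁) (hb₁ : b₁ < 1)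
    (h : (w, l₁, z) ∈ boxZ m) (i : ℕ) : mixZ b m w l₁ z i ^ (1 - u) * poi m i ^ u ≤
      Real.exp m ^ (1 - u) * (((1 + ((1 - b₁) / 2)⁻¹) ^ (1 - u)) ^ i * poi m i ^ u) := by
  have hc0 : 0 < ((1 - b₁) / 2)⁻¹ := by rw [inv_pos]; linarith
  have h1u : 0 < 1 - u := by linarith [hu.2]
  obtain ⟨h1, h2⟩ := mixZ_mem hm hb hb₁ h i
  have h3 := Real.rpow_le_rpow h1 h2 h1u.le
  have hD : 0 ≤ 1 + ((1 - b₁) / 2)⁻¹ := by linarith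
  rw [Real.mul_rpow (Real.exp_pos _).le (by positivity), ← Real.rpow_natCast,
    ← Real.rpow_mul hD, mul_comm (i : ℝ), Real.rpow_mul hD, Real.rpow_natCast] at h3
  rw [← mul_assoc]
  exact mul_le_mul_of_nonneg_right h3 (Real.rpow_nonneg (poi_nonneg hm.le i) _)

theorem summable_affZ_bound (hu : u ∈ Ioo (0 : ℝ) 1) (hm : 0 < m) (hb₁ : b₁ < 1) :
    Summable fun i => Real.exp m ^ (1 - u) *
      (((1 + ((1 - b₁) / 2)⁻¹) ^ (1 - u)) ^ i * poi m i ^ u) := by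
  have hc0 : 0 < ((1 - b₁) / 2)⁻¹ := by rw [inv_pos]; linarith
  exact (summable_pow_mul_poi_rpow (by positivity) hm hu.1).mul_left _

theorem summable_affZ (hu : u ∈ Ioo (0 : ℝ) 1) (hm : 0 < m) (hb : b ∈ Icc 0 b₁) (hb₁ : b₁ < 1)
    (h : (w, l₁, z) ∈ boxZ m) :
    Summable fun i => mixZ b m w l₁ z i ^ (1 - u) * poi m i ^ u :=
  Summable.of_nonneg_of_le (aff_term_nonneg (fun i => poi_nonneg hm.le i)
    (fun i => (mixZ_mem hm hb hb₁ h i).1)) (affZ_term_le hu hm hb hb₁ h)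
    (summable_affZ_bound hu hm hb₁)

/-- Weierstrass test: mixtures grow at most geometrically in `i`, uniformly on the box, and `poi m i
^ u` decays faster than any geometric sequence. -/
theorem continuousOn_affZ (hu : u ∈ Ioo (0 : ℝ) 1) (hm : 0 < m) (hb₁ : b₁ < 1) :
    ContinuousOn (fun x : ℝ × ℝ × ℝ × ℝ => aff u (poi m) (mixZ x.1 m x.2.1 x.2.2.1 x.2.2.2))
      (Icc 0 b₁ ×ˢ boxZ m) := by
  unfold aff
  refine continuousOn_tsum (fun i => ?_) (summable_affZ_bound hu hm hb₁) fun i x hx => ?_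
  · refine ContinuousOn.mul (ContinuousOn.rpow_const ?_ fun x hx => Or.inr (by linarith [hu.2]))
      continuousOn_const
    have h1 : ContinuousOn (fun x : ℝ × ℝ × ℝ × ℝ => tiltZ x.1 m x.2.2.2 i)
        (Icc 0 b₁ ×ˢ boxZ m) :=
      (continuousOn_tiltZ hm hb₁ i).comp (f := fun x : ℝ × ℝ × ℝ × ℝ => (x.1, x.2.2.2))
        (by fun_prop) fun x hx => ⟨hx.1, hx.2.2.2⟩
    have h2 : ContinuousOn (fun x : ℝ × ℝ × ℝ × ℝ => tilt x.1 m x.2.2.1 i)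
        (Icc 0 b₁ ×ˢ boxZ m) := by
      unfold tilt poi; fun_prop
    unfold mixZ
    exact (continuous_fst.comp continuous_snd).continuousOn.mul h2 |>.add
      ((continuousOn_const.sub (continuous_fst.comp continuous_snd).continuousOn).mul h1)
  · rw [Real.norm_of_nonneg (aff_term_nonneg (fun i => poi_nonneg hm.le i)
      (fun i => (mixZ_mem hm hx.1 hb₁ hx.2 i).1) i)]
    exact affZ_term_le hu hm hx.1 hb₁ hx.2 i

theorem aff_mixZ_zero_le (hu : u ∈ Ioo (0 : ℝ) 1) (hb : b ∈ Ioo (0 : ℝ) 1) (hm : 0 < m)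
    (h : (w, l₁, z) ∈ boxZ m) :
    aff u (poi m) (mixZ b m w l₁ 0) ≤ aff u (poi m) (mixZ b m w l₁ z) := by
  have hbb : b ∈ Icc 0 b := ⟨hb.1.le, le_rfl⟩
  have h0 : (w, l₁, (0 : ℝ)) ∈ boxZ m := ⟨h.1, h.2.1, le_rfl, (Real.exp_pos _).le⟩
  refine (summable_affZ hu hm hbb hb.2 h0).tsum_le_tsum (fun i => ?_)
    (summable_affZ hu hm hbb hb.2 h)
  refine mul_le_mul_of_nonneg_right ?_ (Real.rpow_nonneg (poi_nonneg hm.le i) _)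
  refine Real.rpow_le_rpow (mixZ_mem hm hbb hb.2 h0 i).1 ?_ (by linarith [hu.2])
  unfold mixZ
  rw [tiltZ_zero hb.2, mul_zero]
  have h1 : 0 ≤ 1 - w := sub_nonneg.2 h.1.2
  have := mul_nonneg h1 (tiltZ_mem hm hbb hb.2 h.2.2 i).1
  linarith

/-- A maximizer in the compactified coordinates is a saddle point. -/
theorem isSaddle_of_max (hu : u ∈ Ioo (0 : ℝ) 1) (hb : b ∈ Ioo (0 : ℝ) 1) (hm : 0 < m)
    (hk : (w, l₁, z) ∈ boxZ m) (hmax : ∀ x ∈ boxZ m,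
      aff u (poi m) (mixZ b m x.1 x.2.1 x.2.2) ≤ aff u (poi m) (mixZ b m w l₁ z)) :
    0 < z ∧ IsSaddle u b m w l₁ (-Real.log z) := by
  have hbb : b ∈ Icc 0 b := ⟨hb.1.le, le_rfl⟩
  have hlog : ∀ {z}, 0 < z → z ≤ Real.exp (-m) → m ≤ -Real.log z := by
    intro z hz hzm
    have := Real.log_le_log hz hzm
    rw [Real.log_exp] at this; linarith
  have main : ∀ {z}, (w, l₁, z) ∈ boxZ m → 0 < z → (∀ x ∈ boxZ m,
      aff u (poi m) (mixZ b m x.1 x.2.1 x.2.2) ≤ aff u (poi m) (mixZ b m w l₁ z)) →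
      IsMaxMix u b m w l₁ (-Real.log z) := by
    intro z hk hz hmax
    refine ⟨hk.1, hk.2.1, hlog hz hk.2.2.2, fun w' hw' a ha c hc => ?_⟩
    have h := hmax (w', a, Real.exp (-c)) ⟨hw', ha, (Real.exp_pos _).le,
      Real.exp_le_exp.2 (by linarith)⟩
    rw [mixZ_eq hz (hlog hz hk.2.2.2), mixZ_eq (Real.exp_pos _) (by simpa using hc)] at h
    simpa using h
  -- At `z = 0` the right component is absent. If `w < 1`, placing it at location `m` strictly
  -- increases the affinity; if `w = 1` it does not matter, so `z = e ^ (-m)` is maximal too,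
  -- against `w_lt_one`.
  have hz : 0 < z := by
    refine lt_of_le_of_ne hk.2.2.1 fun h0 => ?_
    subst h0
    have hk' : (w, l₁, Real.exp (-m)) ∈ boxZ m :=
      ⟨hk.1, hk.2.1, (Real.exp_pos _).le, le_rfl⟩
    have e0 : ∀ i, mixZ b m w l₁ 0 i = w * tilt b m l₁ i := by
      intro i; unfold mixZ; rw [tiltZ_zero hb.2, mul_zero, add_zero]
    have e1 : ∀ i, mixZ b m w l₁ (Real.exp (-m)) i = w * tilt b m l₁ i + (1 - w) * poi m i := by
      intro i
      unfold mixZ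
      rw [tiltZ_eq (Real.exp_pos _) (by simp), Real.log_exp, neg_neg, tilt_self]
    rcases hk.1.2.eq_or_lt with hw1 | hw1
    · simp only at hw1
      subst hw1
      have e : mixZ b m 1 l₁ (Real.exp (-m)) = mixZ b m 1 l₁ 0 := by
        funext i; rw [e0, e1]; ring
      have := main hk' (Real.exp_pos _) (by rw [e]; exact hmax)
      exact lt_irrefl _ (this.w_lt_one hu hb hm)
    · simp only at hw1
      have h1 := hmax _ hk'
      have hp := poi_pos hm
      refine absurd h1 (not_le.2 ?_)
      have hlt : ∀ i, mixZ b m w l₁ 0 i ^ (1 - u) * poi m i ^ u <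
          mixZ b m w l₁ (Real.exp (-m)) i ^ (1 - u) * poi m i ^ u := by
        intro i
        refine mul_lt_mul_of_pos_right ?_ (Real.rpow_pos_of_pos (hp i) _)
        refine Real.rpow_lt_rpow (mixZ_mem hm hbb hb.2 hk i).1 ?_ (by linarith [hu.2])
        rw [e0, e1]
        have := mul_pos (sub_pos.2 hw1) (hp i)
        linarith
      exact (summable_affZ hu hm hbb hb.2 hk).tsum_lt_tsum (fun i => (hlt i).le) (hlt 0)
        (summable_affZ hu hm hbb hb.2 hk')
  exact ⟨hz, (main hk hz hmax).isSaddle hu hb hm⟩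

theorem exists_isSaddle (hu : u ∈ Ioo (0 : ℝ) 1) (hb : b ∈ Ioo (0 : ℝ) 1) (hm : 0 < m) :
    ∃ w l₁ l₂, IsSaddle u b m w l₁ l₂ := by
  have hc : ContinuousOn (fun x : ℝ × ℝ × ℝ => aff u (poi m) (mixZ b m x.1 x.2.1 x.2.2))
      (boxZ m) :=
    (continuousOn_affZ hu hm hb.2).comp (f := fun x : ℝ × ℝ × ℝ => (b, x)) (by fun_prop)
      fun x hx => ⟨⟨hb.1.le, le_rfl⟩, hx⟩
  have hne : (boxZ m).Nonempty :=
    ⟨(0, 0, 0), ⟨le_rfl, zero_le_one⟩, ⟨le_rfl, hm.le⟩, le_rfl, (Real.exp_pos _).le⟩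
  obtain ⟨⟨w, l₁, z⟩, hk, hmax⟩ := (isCompact_boxZ m).exists_isMaxOn hne hc
  exact ⟨_, _, _, (isSaddle_of_max hu hb hm hk hmax).2⟩

/-- The saddle point depends continuously on `b`. -/
theorem tendsto_isSaddle (hu : u ∈ Ioo (0 : ℝ) 1) (hb : b ∈ Ioo (0 : ℝ) 1) (hm : 0 < m)
    {W A C : ℝ → ℝ} (h : ∀ b' ∈ Ioo (0 : ℝ) 1, IsSaddle u b' m (W b') (A b') (C b')) :
    Tendsto W (𝓝 b) (𝓝 (W b)) ∧ Tendsto A (𝓝 b) (𝓝 (A b)) ∧ Tendsto C (𝓝 b) (𝓝 (C b)) := by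
  obtain ⟨b₁, hb₁, hb₁1⟩ := exists_between hb.2
  set k : ℝ → ℝ × ℝ × ℝ := fun b' => (W b', A b', Real.exp (-C b')) with hk
  have hkm : ∀ b' ∈ Ioo (0 : ℝ) 1, k b' ∈ boxZ m := fun b' hb' =>
    ⟨⟨(h b' hb').w_mem.1.le, (h b' hb').w_mem.2.le⟩, ⟨(h b' hb').l₁_nonneg, (h b' hb').l₁_lt.le⟩,
      (Real.exp_pos _).le, Real.exp_le_exp.2 (by linarith [(h b' hb').lt_l₂])⟩
  have hke : ∀ b' ∈ Ioo (0 : ℝ) 1, mixZ b' m (k b').1 (k b').2.1 (k b').2.2 =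
      mix b' m (W b') (A b') (C b') := by
    intro b' hb'
    simp only [hk]
    rw [mixZ_eq (Real.exp_pos _) (by simpa using (h b' hb').lt_l₂.le), Real.log_exp, neg_neg]
  have hmax : ∀ b' ∈ Ioo (0 : ℝ) 1, ∀ x ∈ boxZ m, 0 < x.2.2 →
      aff u (poi m) (mixZ b' m x.1 x.2.1 x.2.2) ≤
      aff u (poi m) (mixZ b' m (k b').1 (k b').2.1 (k b').2.2) := by
    intro b' hb' x hx hz
    have hlog : m ≤ -Real.log x.2.2 := by
      have := Real.log_le_log hz hx.2.2.2
      rw [Real.log_exp] at this; linarith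
    rw [hke b' hb', mixZ_eq hz hlog]
    exact (h b' hb').aff_le hu hm hx.1 hx.2.1.1 (hm.le.trans hlog)
  obtain ⟨G, hG, hcont⟩ : ∃ G : ℝ × ℝ × ℝ × ℝ → ℝ,
      (∀ b' x, G (b', x) = aff u (poi m) (mixZ b' m x.1 x.2.1 x.2.2)) ∧
      ContinuousOn G (Icc 0 b₁ ×ˢ boxZ m) :=
    ⟨_, fun _ _ => rfl, continuousOn_affZ hu hm hb₁1⟩
  have hkt : Tendsto k (𝓝 b) (𝓝 (k b)) := by
    -- Along any ultrafilter tending to `b` the saddles converge in the compact box. Joint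
    -- continuity makes the limit a maximizer at `b`, hence a saddle, hence the one at `b` by
    -- uniqueness.
    rw [tendsto_iff_ultrafilter]
    intro g hg
    have hmem : ∀ᶠ b' in (g : Filter ℝ), b' ∈ Ioo 0 b₁ := hg (Ioo_mem_nhds hb.1 hb₁)
    have hmem' : ∀ᶠ b' in (g : Filter ℝ), b' ∈ Ioo (0 : ℝ) 1 :=
      hmem.mono fun b' h' => ⟨h'.1, h'.2.trans hb₁1⟩
    obtain ⟨⟨w, l, z⟩, hx, hlim⟩ := (isCompact_boxZ m).ultrafilter_le_nhds (g.map k)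
      (by rw [Ultrafilter.coe_map, le_principal_iff]; exact hmem'.mono fun b' h' => hkm b' h')
    have hlim : Tendsto k g (𝓝 (w, l, z)) := hlim
    have hF : ∀ (f : ℝ → ℝ × ℝ × ℝ) (x), x ∈ boxZ m → Tendsto f g (𝓝 x) →
        (∀ᶠ b' in (g : Filter ℝ), f b' ∈ boxZ m) →
        Tendsto (fun b' => G (b', f b')) (g : Filter ℝ) (𝓝 (G (b, x))) := by
      intro f x hx hf hfm
      have h1 : Tendsto G (𝓝[Icc 0 b₁ ×ˢ boxZ m] (b, x)) (𝓝 (G (b, x))) :=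
        hcont (b, x) ⟨⟨hb.1.le, hb₁.le⟩, hx⟩
      have hg' : Tendsto (fun b' : ℝ => b') (g : Filter ℝ) (𝓝 b) := hg
      have h2 : Tendsto (fun b' => (b', f b')) (g : Filter ℝ)
          (𝓝[Icc 0 b₁ ×ˢ boxZ m] (b, x)) := by
        refine tendsto_nhdsWithin_iff.2 ⟨hg'.prodMk_nhds hf, ?_⟩
        filter_upwards [hmem, hfm] with b' h3 h4 using ⟨⟨h3.1.le, h3.2.le⟩, h4⟩
      exact Tendsto.comp h1 h2
    have hkl := hF k _ hx hlim (hmem'.mono fun b' h' => hkm b' h')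
    have hM : ∀ y ∈ boxZ m, 0 < y.2.2 → aff u (poi m) (mixZ b m y.1 y.2.1 y.2.2) ≤
        aff u (poi m) (mixZ b m w l z) := by
      intro y hy hy0
      have := le_of_tendsto_of_tendsto
        (hF (fun _ => y) y hy tendsto_const_nhds (Eventually.of_forall fun _ => hy)) hkl
        (hmem'.mono fun b' h' => by simp only [hG]; exact hmax b' h' y hy hy0)
      rwa [hG, hG] at this
    -- Saddles only compare with genuine mixtures, that is `z > 0`; points with `z = 0` are
    -- dominated by those with `z = e ^ (-m)`.
    have hM' : ∀ y ∈ boxZ m, aff u (poi m) (mixZ b m y.1 y.2.1 y.2.2) ≤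
        aff u (poi m) (mixZ b m w l z) := by
      rintro ⟨w', l', z'⟩ hy
      have hz' : 0 ≤ z' := hy.2.2.1
      rcases hz'.eq_or_lt with rfl | h0
      · have hin : (w', l', Real.exp (-m)) ∈ boxZ m :=
          ⟨hy.1, hy.2.1, (Real.exp_pos _).le, le_rfl⟩
        refine le_trans ?_ (hM _ hin (Real.exp_pos _))
        exact aff_mixZ_zero_le hu hb hm hin
      · exact hM _ hy h0
    obtain ⟨hz, hs⟩ := isSaddle_of_max hu hb hm hx hM'
    obtain ⟨e1, e2, e3⟩ := (h b hb).unique hu hm hs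
    have : (w, l, z) = k b := by
      simp only [hk]
      rw [e1, e2, ← e3, neg_neg, Real.exp_log hz]
    rw [← this]
    exact hlim
  have h1 := (continuous_fst.tendsto (k b)).comp hkt
  have h2 := ((continuous_fst.comp continuous_snd).tendsto (k b)).comp hkt
  have h3 := ((continuous_snd.comp continuous_snd).tendsto (k b)).comp hkt
  refine ⟨h1, h2, ?_⟩
  have h4 := ((Real.continuousAt_log (Real.exp_pos (-C b)).ne').tendsto.comp h3).neg
  simpa [Function.comp_def, hk] using h4

end

/-! ### Extended-real preliminaries -/

theorem ereal_coe_finset_sum {ι : Type*} (s : Finset ι) (f : ι → ℝ) :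
    ((∑ i ∈ s, f i : ℝ) : EReal) = ∑ i ∈ s, (f i : EReal) := by
  classical
  induction s using Finset.induction_on with
  | empty => simp
  | insert a s ha ih => rw [Finset.sum_insert ha, Finset.sum_insert ha, EReal.coe_add, ih]

theorem ereal_sum_ne_bot {ι : Type*} (s : Finset ι) (f : ι → EReal) (h : ∀ i ∈ s, f i ≠ ⊥) :
    ∑ i ∈ s, f i ≠ ⊥ := by
  classical
  induction s using Finset.induction_on with
  | empty => simp
  | insert a s ha ih =>
    rw [Finset.sum_insert ha, Ne, EReal.add_eq_bot_iff, not_or]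
    exact ⟨h a (Finset.mem_insert_self _ _), ih fun i hi => h i (Finset.mem_insert_of_mem hi)⟩

theorem ereal_sum_eq_top {ι : Type*} (s : Finset ι) (f : ι → EReal) (h : ∀ i ∈ s, f i ≠ ⊥)
    {i : ι} (hi : i ∈ s) (ht : f i = ⊤) : ∑ i ∈ s, f i = ⊤ := by
  classical
  rw [← Finset.add_sum_erase _ _ hi, ht]
  exact EReal.top_add_of_ne_bot (ereal_sum_ne_bot _ _ fun j hj => h j (Finset.mem_of_mem_erase hj))

section logMGF
variable {c : ℕ → ℝ} {l : ℝ}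

theorem exp_mul_poi_nonneg (hl : 0 ≤ l) (i : ℕ) : 0 ≤ Real.exp (c i) * poi l i :=
  mul_nonneg (Real.exp_pos _).le (poi_nonneg hl i)

theorem tsum_exp_mul_poi_pos (hl : 0 ≤ l) (hs : Summable fun i => Real.exp (c i) * poi l i) :
    0 < ∑' i, Real.exp (c i) * poi l i := by
  refine hs.tsum_pos (exp_mul_poi_nonneg hl) 0 ?_
  rw [poi_zero_right]; positivity

theorem logMGF_of_summable (hl : 0 ≤ l) (hs : Summable fun i => Real.exp (c i) * poi l i) :
    logMGF c l = ((Real.log (∑' i, Real.exp (c i) * poi l i) : ℝ) : EReal) := by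
  unfold logMGF
  rw [← ENNReal.ofReal_tsum_of_nonneg (exp_mul_poi_nonneg hl) hs,
    ENNReal.log_ofReal_of_pos (tsum_exp_mul_poi_pos hl hs)]

theorem logMGF_of_hasSum (hl : 0 ≤ l) {S : ℝ} (hs : HasSum (fun i => Real.exp (c i) * poi l i) S) :
    logMGF c l = ((Real.log S : ℝ) : EReal) := by
  rw [logMGF_of_summable hl hs.summable, hs.tsum_eq]

theorem logMGF_of_not_summable (hl : 0 ≤ l)
    (hs : ¬ Summable fun i => Real.exp (c i) * poi l i) : logMGF c l = ⊤ := by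
  unfold logMGF
  rw [ENNReal.log_eq_top_iff]
  by_contra h
  apply hs
  have := ENNReal.summable_toReal h
  refine this.congr fun i => ?_
  rw [ENNReal.toReal_ofReal (exp_mul_poi_nonneg hl i)]

theorem logMGF_ne_bot (hl : 0 ≤ l) : logMGF c l ≠ ⊥ := by
  by_cases hs : Summable fun i => Real.exp (c i) * poi l i
  · rw [logMGF_of_summable hl hs]; exact EReal.coe_ne_bot _
  · rw [logMGF_of_not_summable hl hs]; exact top_ne_bot

theorem summable_of_logMGF_ne_top (hl : 0 ≤ l) (h : logMGF c l ≠ ⊤) :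
    Summable fun i => Real.exp (c i) * poi l i := by
  by_contra hs
  exact h (logMGF_of_not_summable hl hs)

theorem logMGF_zero (l : ℝ) (hl : 0 ≤ l) : logMGF (fun _ => 0) l = 0 := by
  have : HasSum (fun i => Real.exp ((fun _ => 0 : ℕ → ℝ) i) * poi l i) 1 := by
    simpa using hasSum_poi l
  rw [logMGF_of_hasSum hl this, Real.log_one, EReal.coe_zero]

end logMGF

/-! ### Weak duality -/

/-- The inner supremum of the nested program. -/
noncomputable def innerSup (k y α u : ℝ) (κ : ℕ → ℝ) : EReal :=
  ⨆ x : ℝ≥0, (((-α * |(x : ℝ) - y| : ℝ) : EReal) + logMGF (fun i => -u * κ i) (k * x))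

section
variable {k y u b α w l₁ l₂ : ℝ} {h : ℕ} {κ : ℕ → ℝ}

theorem innerObj_eq : innerObj k y h α u κ =
    ((u * h : ℝ) : EReal) * logMGF (fun i => (1 - u) * κ i) (k * y) +
      (((1 - u) * h : ℝ) : EReal) * innerSup k y α u κ := rfl

theorem le_innerSup (x : ℝ≥0) :
    ((-α * |(x : ℝ) - y| : ℝ) : EReal) + logMGF (fun i => -u * κ i) (k * x) ≤
      innerSup k y α u κ :=
  le_iSup (fun x : ℝ≥0 =>
    (((-α * |(x : ℝ) - y| : ℝ) : EReal) + logMGF (fun i => -u * κ i) (k * x))) x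

theorem innerSup_ne_bot : innerSup k y α u κ ≠ ⊥ := by
  intro hbot
  have := le_innerSup (k := k) (y := y) (α := α) (u := u) (κ := κ) 0
  rw [hbot, le_bot_iff, EReal.add_eq_bot_iff] at this
  rcases this with h | h
  · exact EReal.coe_ne_bot _ h
  · exact logMGF_ne_bot (by simp) h

/-- An upper bound for the inner objective. -/
theorem innerObj_le (hk : 0 ≤ k) (hy : 0 ≤ y) (hu : u ∈ Icc (0 : ℝ) 1) {B s : ℝ}
    (hB : HasSum (fun i => Real.exp ((1 - u) * κ i) * poi (k * y) i) B)
    (hs : ∀ x, 0 ≤ x → Summable (fun i => Real.exp (-u * κ i) * poi (k * x) i) ∧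
      -α * |x - y| + Real.log (∑' i, Real.exp (-u * κ i) * poi (k * x) i) ≤ s) :
    innerObj k y h α u κ ≤ ((h * (u * Real.log B + (1 - u) * s) : ℝ) : EReal) := by
  have h1 : innerSup k y α u κ ≤ (s : EReal) := by
    refine iSup_le fun x => ?_
    obtain ⟨h2, h3⟩ := hs x x.2
    rw [logMGF_of_summable (mul_nonneg hk x.coe_nonneg) h2, ← EReal.coe_add]
    exact EReal.coe_le_coe_iff.2 h3
  rw [innerObj_eq, logMGF_of_hasSum (mul_nonneg hk hy) hB, ← EReal.coe_mul]
  have h4 : (((1 - u) * h : ℝ) : EReal) * innerSup k y α u κ ≤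
      (((1 - u) * h : ℝ) : EReal) * (s : EReal) :=
    mul_le_mul_of_nonneg_left h1
      (EReal.coe_nonneg.2 (mul_nonneg (by linarith [hu.2]) (Nat.cast_nonneg h)))
  refine (add_le_add_right h4 _).trans_eq ?_
  rw [← EReal.coe_mul, ← EReal.coe_add]
  congr 1; ring

/-- For interior `u` the inner objective is either `⊤` or an explicit real number. -/
theorem innerObj_cases (hk : 0 ≤ k) (hy : 0 ≤ y) (hu : u ∈ Ioo (0 : ℝ) 1) (hh : 0 < h) :
    innerObj k y h α u κ = ⊤ ∨ ∃ s : ℝ,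
      Summable (fun i => Real.exp ((1 - u) * κ i) * poi (k * y) i) ∧
      (∀ x, 0 ≤ x → Summable (fun i => Real.exp (-u * κ i) * poi (k * x) i) ∧
        -α * |x - y| + Real.log (∑' i, Real.exp (-u * κ i) * poi (k * x) i) ≤ s) ∧
      innerObj k y h α u κ = ((h * (u * Real.log (∑' i, Real.exp ((1 - u) * κ i) * poi (k * y) i) +
        (1 - u) * s) : ℝ) : EReal) := by
  have hh' : (0 : ℝ) < h := by exact_mod_cast hh
  have c1 : (0 : ℝ) < u * h := mul_pos hu.1 hh'
  have c2 : (0 : ℝ) < (1 - u) * h := mul_pos (by linarith [hu.2]) hh'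
  have hky : 0 ≤ k * y := mul_nonneg hk hy
  by_cases h1 : logMGF (fun i => (1 - u) * κ i) (k * y) = ⊤
  · left
    rw [innerObj_eq, h1, EReal.coe_mul_top_of_pos c1]
    refine EReal.top_add_of_ne_bot ?_
    intro hbot
    rw [EReal.mul_eq_bot] at hbot
    rcases hbot with h | h | h | h
    · exact EReal.coe_ne_bot _ h.1
    · exact innerSup_ne_bot h.2
    · exact EReal.coe_ne_top _ h.1
    · exact absurd (EReal.coe_neg'.1 h.1) (by linarith)
  have hs1 := summable_of_logMGF_ne_top hky h1
  rw [innerObj_eq, logMGF_of_summable hky hs1]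
  by_cases h2 : innerSup k y α u κ = ⊤
  · left
    rw [h2, EReal.coe_mul_top_of_pos c2, ← EReal.coe_mul]
    exact EReal.add_top_of_ne_bot (EReal.coe_ne_bot _)
  right
  obtain ⟨s, hs⟩ : ∃ s : ℝ, innerSup k y α u κ = s :=
    ⟨_, (EReal.coe_toReal h2 (innerSup_ne_bot)).symm⟩
  refine ⟨s, hs1, fun x hx => ?_, ?_⟩
  · have h3 := le_innerSup (k := k) (y := y) (α := α) (u := u) (κ := κ) ⟨x, hx⟩
    rw [hs] at h3
    change ((-α * |x - y| : ℝ) : EReal) + logMGF (fun i => -u * κ i) (k * x) ≤ (s : EReal) at h3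
    have hkx : 0 ≤ k * x := mul_nonneg hk hx
    have h4 : logMGF (fun i => -u * κ i) (k * x) ≠ ⊤ := by
      intro ht
      rw [ht, EReal.coe_add_top, top_le_iff] at h3
      exact EReal.coe_ne_top _ h3
    have h5 := summable_of_logMGF_ne_top hkx h4
    refine ⟨h5, ?_⟩
    rwa [logMGF_of_summable hkx h5, ← EReal.coe_add, EReal.coe_le_coe_iff] at h3
  · rw [hs, ← EReal.coe_mul, ← EReal.coe_mul, ← EReal.coe_add]
    congr 1; ring

/-- Hölder's inequality for dual feasible points, with its equality case. -/
theorem log_aff_le (hu : u ∈ Ioo (0 : ℝ) 1) {p M : ℕ → ℝ} (hp : ∀ i, 0 < p i)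
    (hM : ∀ i, 0 < M i) (sp : Summable p) (sM : Summable M) {B s : ℝ}
    (hB : HasSum (fun i => Real.exp ((1 - u) * κ i) * p i) B)
    (sA : Summable fun i => Real.exp (-u * κ i) * M i)
    (hA : ∑' i, Real.exp (-u * κ i) * M i ≤ Real.exp s) :
    Real.log (aff u p M) ≤ u * Real.log B + (1 - u) * s ∧
      (u * Real.log B + (1 - u) * s ≤ Real.log (aff u p M) →
        ∀ i, κ i = Real.log (M i / p i) + (Real.log B - s)) := by
  have h1u : 0 < 1 - u := by linarith [hu.2]
  have hB0 : 0 < B := by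
    rw [← hB.tsum_eq]
    exact hB.summable.tsum_pos (fun i => (mul_pos (Real.exp_pos _) (hp i)).le) 0
      (mul_pos (Real.exp_pos _) (hp 0))
  have sF := summable_aff hu (fun i => (hp i).le) (fun i => (hM i).le) sp sM
  have hF0 : 0 < aff u p M :=
    sF.tsum_pos (aff_term_nonneg (fun i => (hp i).le) (fun i => (hM i).le)) 0
      (mul_pos (Real.rpow_pos_of_pos (hM 0) _) (Real.rpow_pos_of_pos (hp 0) _))
  -- `X` has mass at most one, `Y` has mass one, and the exponents are such that `κ` cancels from `X
  -- ^ (1 - u) * Y ^ u`. Equality in the summed mean inequality forces `X = Y`, which determines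
  -- `κ`.
  set X : ℕ → ℝ := fun i => Real.exp (-s) * (Real.exp (-u * κ i) * M i) with hX
  set Y : ℕ → ℝ := fun i => B⁻¹ * (Real.exp ((1 - u) * κ i) * p i) with hY
  set K : ℝ := Real.exp (-s) ^ (1 - u) * B⁻¹ ^ u with hK
  have hX0 : ∀ i, 0 < X i := fun i => by have := hM i; simp only [hX]; positivity
  have hY0 : ∀ i, 0 < Y i := fun i => by have := hp i; simp only [hY]; positivity
  have hXY : ∀ i, X i ^ (1 - u) * Y i ^ u = K * (M i ^ (1 - u) * p i ^ u) := by
    intro i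
    simp only [hX, hY]
    rw [Real.mul_rpow (Real.exp_pos _).le (mul_pos (Real.exp_pos _) (hM i)).le,
      Real.mul_rpow (Real.exp_pos _).le (hM i).le,
      Real.mul_rpow (inv_pos.2 hB0).le (mul_pos (Real.exp_pos _) (hp i)).le,
      Real.mul_rpow (Real.exp_pos _).le (hp i).le, ← Real.exp_mul (-u * κ i),
      ← Real.exp_mul ((1 - u) * κ i)]
    have : Real.exp (-u * κ i * (1 - u)) * Real.exp ((1 - u) * κ i * u) = 1 := by
      rw [← Real.exp_add, Real.exp_eq_one_iff]; ring
    linear_combination (Real.exp (-s) ^ (1 - u) * B⁻¹ ^ u * M i ^ (1 - u) * p i ^ u) * this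
  have hle : ∀ i, K * (M i ^ (1 - u) * p i ^ u) ≤ (1 - u) * X i + u * Y i := fun i => by
    rw [← hXY]; exact rpow_mul_rpow_le hu (hX0 i).le (hY0 i).le
  have sX : Summable X := sA.mul_left _
  have sY : Summable Y := hB.summable.mul_left _
  have hXs : ∑' i, X i ≤ 1 := by
    simp only [hX, tsum_mul_left]
    calc _ ≤ Real.exp (-s) * Real.exp s := by gcongr
      _ = 1 := by rw [← Real.exp_add]; simp
  have hYs : ∑' i, Y i = 1 := by
    simp only [hY, tsum_mul_left, hB.tsum_eq]; exact inv_mul_cancel₀ hB0.ne'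
  have hsum : ∑' i, ((1 - u) * X i + u * Y i) ≤ 1 := by
    rw [(sX.mul_left _).tsum_add (sY.mul_left _), sX.tsum_mul_left, sY.tsum_mul_left, hYs]
    nlinarith
  have hK0 : 0 < K := by positivity
  have hlogK : Real.log K = -(u * Real.log B + (1 - u) * s) := by
    rw [hK, Real.log_mul (by positivity) (by positivity), Real.log_rpow (Real.exp_pos _),
      Real.log_rpow (by positivity), Real.log_exp, Real.log_inv]
    ring
  have hKF : K * aff u p M ≤ 1 := by
    unfold aff
    rw [← tsum_mul_left]
    exact ((sF.mul_left K).tsum_le_tsum hle ((sX.mul_left _).add (sY.mul_left _))).trans hsum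
  constructor
  · have := Real.log_le_log (mul_pos hK0 hF0) hKF
    rw [Real.log_mul hK0.ne' hF0.ne', Real.log_one, hlogK] at this
    linarith
  · intro hge i
    have heq : X i = Y i := by
      refine eq_of_rpow_mul_rpow_eq hu (hX0 i).le (hY0 i) ?_
      by_contra hne
      have hlt : K * (M i ^ (1 - u) * p i ^ u) < (1 - u) * X i + u * Y i :=
        lt_of_le_of_ne (hle i) (by rw [← hXY]; exact hne)
      have h2 := ((sF.mul_left K).tsum_lt_tsum hle hlt
        ((sX.mul_left _).add (sY.mul_left _))).trans_le hsum
      rw [tsum_mul_left] at h2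
      have h3 := Real.log_lt_log (mul_pos hK0 hF0) h2
      rw [Real.log_mul hK0.ne' hF0.ne', Real.log_one, hlogK] at h3
      linarith
    have h4 := congrArg Real.log heq
    simp only [hX, hY] at h4
    rw [Real.log_mul (by positivity) (mul_pos (Real.exp_pos _) (hM i)).ne',
      Real.log_mul (by positivity) (hM i).ne',
      Real.log_mul (by positivity) (mul_pos (Real.exp_pos _) (hp i)).ne',
      Real.log_mul (by positivity) (hp i).ne', Real.log_exp, Real.log_exp, Real.log_exp,
      Real.log_inv] at h4
    rw [Real.log_div (hM i).ne' (hp i).ne']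
    linarith

theorem tilt_le_exp {A s l m : ℝ} (hA : 0 < A) (h : b * |l - m| + Real.log A ≤ s) :
    Real.exp (b * |l - m|) * A ≤ Real.exp s := by
  have := Real.exp_le_exp.2 h
  rwa [Real.exp_add, Real.exp_log hA] at this

/-- Weak duality for the inner minimization, with its equality case. -/
theorem log_aff_mix_le_innerObj (hk : 0 < k) (hy : 0 < y) (hu : u ∈ Ioo (0 : ℝ) 1) (hh : 0 < h)
    (hw : w ∈ Ico (0 : ℝ) 1) (h1 : 0 ≤ l₁) (h2 : 0 < l₂) :
    ((h * Real.log (aff u (poi (k * y)) (mix b (k * y) w l₁ l₂)) : ℝ) : EReal) ≤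
        innerObj k y h (-(k * b)) u κ ∧
      (innerObj k y h (-(k * b)) u κ ≤
        ((h * Real.log (aff u (poi (k * y)) (mix b (k * y) w l₁ l₂)) : ℝ) : EReal) →
        ∃ c, ∀ i, κ i = Real.log (mix b (k * y) w l₁ l₂ i / poi (k * y) i) + c) := by
  have hky : 0 < k * y := mul_pos hk hy
  have hh' : (0 : ℝ) < h := by exact_mod_cast hh
  rcases innerObj_cases (κ := κ) (α := -(k * b)) hk.le hy.le hu hh with ht | ⟨s, s1, s2, s3⟩
  · rw [ht]
    exact ⟨le_top, fun h => absurd h (by rw [top_le_iff]; exact EReal.coe_ne_top _)⟩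
  have key : ∀ l, 0 ≤ l → Summable (fun i => Real.exp (-u * κ i) * tilt b (k * y) l i) ∧
      ∑' i, Real.exp (-u * κ i) * tilt b (k * y) l i ≤ Real.exp s := by
    intro l hl
    have hkl : k * (l / k) = l := by field_simp
    obtain ⟨h3, h4⟩ := s2 (l / k) (by positivity)
    rw [hkl] at h3 h4
    have h5 : -(-(k * b)) * |l / k - y| = b * |l - k * y| := by
      have : l - k * y = k * (l / k - y) := by field_simp
      rw [this, abs_mul, abs_of_pos hk]; ring
    rw [h5] at h4
    have e : ∀ i, Real.exp (-u * κ i) * tilt b (k * y) l i =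
        Real.exp (b * |l - k * y|) * (Real.exp (-u * κ i) * poi l i) := by
      intro i; unfold tilt; ring
    simp only [e, tsum_mul_left]
    exact ⟨h3.mul_left _, tilt_le_exp (tsum_exp_mul_poi_pos hl h3) h4⟩
  have sA : Summable fun i => Real.exp (-u * κ i) * mix b (k * y) w l₁ l₂ i := by
    refine (((key l₁ h1).1.mul_left w).add ((key l₂ h2.le).1.mul_left (1 - w))).congr fun i => ?_
    unfold mix; ring
  have hA : ∑' i, Real.exp (-u * κ i) * mix b (k * y) w l₁ l₂ i ≤ Real.exp s := by
    have e : ∀ i, Real.exp (-u * κ i) * mix b (k * y) w l₁ l₂ i =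
        w * (Real.exp (-u * κ i) * tilt b (k * y) l₁ i) +
        (1 - w) * (Real.exp (-u * κ i) * tilt b (k * y) l₂ i) := by
      intro i; unfold mix; ring
    simp only [e]
    rw [((key l₁ h1).1.mul_left w).tsum_add ((key l₂ h2.le).1.mul_left (1 - w)), tsum_mul_left,
      tsum_mul_left]
    have hw1 : 0 ≤ 1 - w := by linarith [hw.2]
    nlinarith [mul_le_mul_of_nonneg_left (key l₁ h1).2 hw.1,
      mul_le_mul_of_nonneg_left (key l₂ h2.le).2 hw1]
  obtain ⟨r1, r2⟩ := log_aff_le hu (poi_pos hky) (mix_pos (b := b) (m := k * y) hw h1 h2)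
    (summable_poi _) summable_mix s1.hasSum sA hA
  rw [s3, EReal.coe_le_coe_iff, EReal.coe_le_coe_iff]
  exact ⟨mul_le_mul_of_nonneg_left r1 hh'.le,
    fun h5 => ⟨_, r2 (le_of_mul_le_mul_left h5 hh')⟩⟩

theorem IsSaddle.hasSum_exp (hk : 0 < k) (hy : 0 < y) (hu : u ∈ Ioo (0 : ℝ) 1)
    (hS : IsSaddle u b (k * y) w l₁ l₂) {c : ℝ}
    (hκ : ∀ i, κ i = Real.log (mix b (k * y) w l₁ l₂ i / poi (k * y) i) + c) :
    HasSum (fun i => Real.exp ((1 - u) * κ i) * poi (k * y) i)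
      (Real.exp ((1 - u) * c) * aff u (poi (k * y)) (mix b (k * y) w l₁ l₂)) := by
  have hp := poi_pos (mul_pos hk hy)
  have hM := hS.mix_pos
  refine hasSum_of_eq ((summable_aff hu (fun i => (hp i).le) (fun i => (hM i).le)
    (summable_poi _) summable_mix).hasSum.mul_left (Real.exp ((1 - u) * c))) (fun i => ?_) rfl
  rw [hκ, mul_add, Real.exp_add, mul_comm (1 - u) (Real.log _), Real.exp_mul,
    Real.exp_log (div_pos (hM i) (hp i)), Real.div_rpow (hM i).le (hp i).le, Real.rpow_sub (hp i),
    Real.rpow_one]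
  have := (Real.rpow_pos_of_pos (hp i) u).ne'
  have := (hp i).ne'
  field_simp

/-- For the log density, `e ^ (-u κ)` is `wt` up to a constant. The bound on the inner supremum is
therefore the saddle inequality `field ≤ aff`, with the distance penalty moved into the tilt. -/
theorem IsSaddle.sup_le (hk : 0 < k) (hy : 0 < y) (hu : u ∈ Ioo (0 : ℝ) 1)
    (hS : IsSaddle u b (k * y) w l₁ l₂) {c : ℝ}
    (hκ : ∀ i, κ i = Real.log (mix b (k * y) w l₁ l₂ i / poi (k * y) i) + c)
    {x : ℝ} (hx : 0 ≤ x) :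
    Summable (fun i => Real.exp (-u * κ i) * poi (k * x) i) ∧
      -(-(k * b)) * |x - y| + Real.log (∑' i, Real.exp (-u * κ i) * poi (k * x) i) ≤
        -u * c + Real.log (aff u (poi (k * y)) (mix b (k * y) w l₁ l₂)) := by
  have hky : 0 < k * y := mul_pos hk hy
  have hp := poi_pos hky
  have hM := hS.mix_pos
  have hpos : ∀ i, 0 < mix b (k * y) w l₁ l₂ i / poi (k * y) i := fun i => div_pos (hM i) (hp i)
  have hkx : 0 ≤ k * x := mul_nonneg hk.le hx
  have e : ∀ i, Real.exp (-u * κ i) * poi (k * x) i = Real.exp (-u * c) *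
      (Real.exp (-(b * |k * x - k * y|)) *
        (wt u (poi (k * y)) (mix b (k * y) w l₁ l₂) i * tilt b (k * y) (k * x) i)) := by
    intro i
    unfold wt tilt
    rw [hκ, mul_add, Real.exp_add, mul_comm (-u) (Real.log _), Real.exp_mul,
      Real.exp_log (hpos i), Real.exp_neg (b * |k * x - k * y|)]
    field_simp
  have hs := hS.summable hu hky hkx
  have hf : 0 < field u b (k * y) w l₁ l₂ (k * x) := by
    refine hs.tsum_pos (fun i => mul_nonneg (wt_pos hp hM i).le (tilt_nonneg hkx i)) 0 ?_
    refine mul_pos (wt_pos hp hM 0) (mul_pos (Real.exp_pos _) ?_)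
    rw [poi_zero_right]; exact Real.exp_pos _
  simp only [e]
  refine ⟨(hs.mul_left _).mul_left _, ?_⟩
  rw [tsum_mul_left, tsum_mul_left]
  change _ + Real.log (_ * (_ * field u b (k * y) w l₁ l₂ (k * x))) ≤ _
  rw [Real.log_mul (by positivity) (mul_pos (Real.exp_pos _) hf).ne',
    Real.log_mul (by positivity) hf.ne', Real.log_exp, Real.log_exp]
  have h5 : |k * x - k * y| = k * |x - y| := by rw [← mul_sub, abs_mul, abs_of_pos hk]
  have h6 := Real.log_le_log hf (hS.le (k * x) hkx)
  rw [h5]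
  linarith

/-- At a saddle point the logarithmic density is optimal. -/
theorem innerObj_saddle_le (hk : 0 < k) (hy : 0 < y) (hu : u ∈ Ioo (0 : ℝ) 1)
    (hS : IsSaddle u b (k * y) w l₁ l₂) (c : ℝ)
    (hκ : ∀ i, κ i = Real.log (mix b (k * y) w l₁ l₂ i / poi (k * y) i) + c) :
    innerObj k y h (-(k * b)) u κ ≤
      ((h * Real.log (aff u (poi (k * y)) (mix b (k * y) w l₁ l₂)) : ℝ) : EReal) := by
  refine (innerObj_le hk.le hy.le ⟨hu.1.le, hu.2.le⟩ (hS.hasSum_exp hk hy hu hκ)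
    fun x hx => hS.sup_le hk hy hu hκ hx).trans (EReal.coe_le_coe_iff.2 (le_of_eq ?_))
  rw [Real.log_mul (by positivity) (hS.aff_pos hu (mul_pos hk hy)).ne', Real.log_exp]
  ring

/-- Strong duality: the log density of the saddle attains the Hölder lower bound given by the same
mixture. -/
theorem innerValue_saddle (hk : 0 < k) (hy : 0 < y) (hu : u ∈ Ioo (0 : ℝ) 1) (hh : 0 < h)
    (hS : IsSaddle u b (k * y) w l₁ l₂) : innerValue k y h (-(k * b)) u =
      ((h * Real.log (aff u (poi (k * y)) (mix b (k * y) w l₁ l₂)) : ℝ) : EReal) := by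
  refine le_antisymm ?_ ?_
  · exact (iInf_le _ _).trans (innerObj_saddle_le hk hy hu hS 0 fun i => (add_zero _).symm)
  · exact le_iInf fun κ => (log_aff_mix_le_innerObj hk hy hu hh hS.w_mem' hS.l₁_nonneg hS.l₂_pos).1

end

/-! ### The value of the nested program is negative -/

/-- Each signed remainder vanishes at `0` and has the previous one as its derivative. In particular
truncations with an odd number of terms bound `e ^ (-z)` from above. -/
theorem exp_neg_taylor_sign (n : ℕ) : ∀ z : ℝ, 0 ≤ z →
    0 ≤ (-1) ^ n * (Real.exp (-z) - ∑ i ∈ Finset.range n, (-z) ^ i / (i.factorial : ℝ)) := by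
  induction n with
  | zero => intro z _; simpa using (Real.exp_pos _).le
  | succ n ih =>
    intro z hz
    have hder : ∀ x : ℝ, HasDerivAt (fun z : ℝ => (-1) ^ (n + 1) * (Real.exp (-z) -
        ∑ i ∈ Finset.range (n + 1), (-z) ^ i / (i.factorial : ℝ)))
        ((-1) ^ n * (Real.exp (-x) - ∑ i ∈ Finset.range n, (-x) ^ i / (i.factorial : ℝ))) x := by
      intro x
      have h1 : HasDerivAt (fun z : ℝ => Real.exp (-z)) (-Real.exp (-x)) x := by
        simpa using (hasDerivAt_neg x).exp
      have h2 : HasDerivAt (fun z : ℝ => ∑ i ∈ Finset.range (n + 1),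
          (-z) ^ i / (i.factorial : ℝ)) (∑ i ∈ Finset.range (n + 1),
            ((i : ℝ) * (-x) ^ (i - 1) * (-1)) / (i.factorial : ℝ)) x :=
        HasDerivAt.fun_sum fun i _ => ((hasDerivAt_neg x).fun_pow i).div_const _
      refine ((h1.sub h2).const_mul ((-1 : ℝ) ^ (n + 1))).congr_deriv ?_
      rw [Finset.sum_range_succ']
      have e : ∀ i : ℕ, ((i + 1 : ℕ) : ℝ) * (-x) ^ (i + 1 - 1) * (-1) / ((i + 1).factorial : ℝ) =
          -((-x) ^ i / (i.factorial : ℝ)) := by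
        intro i
        rw [Nat.factorial_succ]; push_cast
        have : ((i : ℝ) + 1) ≠ 0 := by positivity
        have : (i.factorial : ℝ) ≠ 0 := by positivity
        field_simp
      simp only [e, Finset.sum_neg_distrib]
      simp only [Nat.cast_zero, zero_mul, zero_div, add_zero, pow_succ]
      ring
    have hmono : MonotoneOn (fun z : ℝ => (-1) ^ (n + 1) * (Real.exp (-z) -
        ∑ i ∈ Finset.range (n + 1), (-z) ^ i / (i.factorial : ℝ))) (Ici 0) := by
      refine monotoneOn_of_deriv_nonneg (convex_Ici 0)
        (fun x _ => (hder x).continuousAt.continuousWithinAt)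
        (fun x _ => (hder x).differentiableAt.differentiableWithinAt) fun x hx => ?_
      rw [interior_Ici] at hx
      rw [(hder x).deriv]
      exact ih x (le_of_lt hx)
    have h0 := hmono (self_mem_Ici) (mem_Ici.2 hz) hz
    refine le_trans (le_of_eq ?_) h0
    simp [Finset.sum_range_succ']

/-- A finite Poisson expansion dominating `(y - x)₊` that is small at `y`. -/
theorem exists_poi_hinge {k y δ : ℝ} (hk : 0 < k) (hδ : 0 < δ) :
    ∃ (N : ℕ) (b : ℕ → ℝ),
      (∀ x, 0 ≤ x → 0 ≤ ∑ i ∈ Finset.range N, b i * poi (k * x) i ∧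
        y - x ≤ ∑ i ∈ Finset.range N, b i * poi (k * x) i) ∧
      ∑ i ∈ Finset.range N, b i * poi (k * y) i < δ := by
  -- The smooth majorant `e ^ (s (y - x)) / s` of the hinge has value `1 / s < δ` at `y`, and `b`
  -- lists its coefficients in the functions `poi (k x) i`. An odd truncation stays above it for
  -- every `x ≥ 0`.
  set s : ℝ := k + 2 / δ with hs
  have hd : 0 < 2 / δ := by positivity
  have hs0 : 0 < s := by positivity
  set b : ℕ → ℝ := fun i => Real.exp (s * y) / s * (-(s - k) / k) ^ i with hb
  have hterm : ∀ x : ℝ, ∀ i, b i * poi (k * x) i = Real.exp (-(k * x)) * (Real.exp (s * y) / s) *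
      ((-((s - k) * x)) ^ i / (i.factorial : ℝ)) := by
    intro x i
    have : (-((s - k) * x)) ^ i = (-(s - k) / k) ^ i * (k * x) ^ i := by
      rw [← mul_pow]; congr 1; field_simp
    rw [this]; simp only [hb, poi]; ring
  have hlim : Tendsto (fun N => ∑ i ∈ Finset.range N, b i * poi (k * y) i) atTop (𝓝 (1 / s)) := by
    have h1 : HasSum (fun i => b i * poi (k * y) i) (Real.exp (-(k * y)) * (Real.exp (s * y) / s) *
        Real.exp (-((s - k) * y))) := by
      refine hasSum_of_eq ((NormedSpace.expSeries_div_hasSum_exp (-((s - k) * y))).mul_left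
        (Real.exp (-(k * y)) * (Real.exp (s * y) / s))) (hterm y) ?_
      rw [Real.exp_eq_exp_ℝ]
    have h2 := h1.tendsto_sum_nat
    have e : Real.exp (-(k * y)) * (Real.exp (s * y) / s) * Real.exp (-((s - k) * y)) = 1 / s := by
      rw [mul_div_assoc', ← Real.exp_add, div_mul_eq_mul_div, ← Real.exp_add]
      congr 1; rw [Real.exp_eq_one_iff]; ring
    rwa [e] at h2
  have h1s : 1 / s < δ := by
    rw [div_lt_iff₀ hs0, hs, mul_add]
    have : δ * (2 / δ) = 2 := by field_simp
    nlinarith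
  obtain ⟨n, hn⟩ := eventually_atTop.1 (hlim.eventually_lt_const h1s)
  refine ⟨2 * n + 1, b, fun x hx => ?_, hn _ (by omega)⟩
  have hz : 0 ≤ (s - k) * x := mul_nonneg (by rw [hs]; linarith) hx
  have h2 := exp_neg_taylor_sign (2 * n + 1) _ hz
  rw [pow_succ, pow_mul] at h2
  norm_num at h2
  have h3 : Real.exp (s * (y - x)) / s ≤ ∑ i ∈ Finset.range (2 * n + 1), b i * poi (k * x) i := by
    simp only [hterm, ← Finset.mul_sum]
    calc Real.exp (s * (y - x)) / s = Real.exp (-(k * x)) * (Real.exp (s * y) / s) *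
          Real.exp (-((s - k) * x)) := by
          rw [mul_div_assoc', ← Real.exp_add, div_mul_eq_mul_div, ← Real.exp_add]
          congr 2; ring
      _ ≤ _ := mul_le_mul_of_nonneg_left h2 (by positivity)
  refine ⟨(by positivity : 0 ≤ Real.exp (s * (y - x)) / s).trans h3, le_trans ?_ h3⟩
  rw [le_div_iff₀ hs0]
  linarith [Real.add_one_le_exp (s * (y - x))]

/-- The inner minimization at `u = 1 / 2` has arbitrarily small slope at `α = 0`. -/
theorem exists_innerValue_le {k y δ : ℝ} {h : ℕ} (hk : 0 < k) (hy : 0 < y) (hδ : 0 < δ) :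
    ∃ (W : ℝ → ℝ) (D : ℝ), W 0 = 1 ∧ HasDerivAt W D 0 ∧ D ≤ δ ∧
      ∀ᶠ β in 𝓝[>] 0, innerValue k y h (-β) (1 / 2) ≤
        ((h * (1 / 2 * Real.log (W β)) : ℝ) : EReal) := by
  obtain ⟨N, b, hb, hbδ⟩ := exists_poi_hinge (y := y) hk (half_pos hδ)
  -- `W β` is the sum of `poi(k y, i) / a i` for the sequence `a` introduced below. The first order
  -- terms `-y` and `y` of its main factors cancel, leaving only the small hinge contribution as
  -- slope.
  set W : ℝ → ℝ := fun β => Real.exp (-(β * y)) * (Real.exp (k * y * ((1 - β / k)⁻¹ - 1)) +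
    ∑ i ∈ Finset.range N, poi (k * y) i *
      (((1 - β / k) ^ i - β * (2 * b i))⁻¹ - ((1 - β / k) ^ i)⁻¹)) with hW
  refine ⟨W, ∑ i ∈ Finset.range N, poi (k * y) i * (2 * b i), by simp [hW], ?_, ?_, ?_⟩
  · have hρ : HasDerivAt (fun β : ℝ => 1 - β / k) (-(1 / k)) 0 :=
      ((hasDerivAt_id (0 : ℝ)).div_const k).const_sub 1
    have hS : HasDerivAt (fun β : ℝ => ∑ i ∈ Finset.range N, poi (k * y) i *
        (((1 - β / k) ^ i - β * (2 * b i))⁻¹ - ((1 - β / k) ^ i)⁻¹))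
        (∑ i ∈ Finset.range N, poi (k * y) i * (2 * b i)) 0 := by
      refine HasDerivAt.fun_sum fun i _ => HasDerivAt.const_mul _ ?_
      have e1 := hρ.fun_pow i
      have e2 : HasDerivAt (fun β : ℝ => β * (2 * b i)) (2 * b i) 0 := by
        simpa using (hasDerivAt_id (0 : ℝ)).mul_const (2 * b i)
      refine (((e1.sub e2).inv (by simp)).sub (e1.inv (by simp))).congr_deriv ?_
      simp
    have hE : HasDerivAt (fun β : ℝ => Real.exp (k * y * ((1 - β / k)⁻¹ - 1))) y 0 := by
      refine ((((hρ.inv (by simp)).sub_const 1).const_mul (k * y)).exp).congr_deriv ?_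
      simp; field_simp
    have hY : HasDerivAt (fun β : ℝ => Real.exp (-(β * y))) (-y) 0 := by
      refine (((hasDerivAt_id (0 : ℝ)).mul_const y).neg.exp).congr_deriv ?_
      simp
    refine (hY.mul (hE.add hS)).congr_deriv ?_
    simp
  · rw [show ∑ i ∈ Finset.range N, poi (k * y) i * (2 * b i) =
      2 * ∑ i ∈ Finset.range N, b i * poi (k * y) i by
        rw [Finset.mul_sum]; exact Finset.sum_congr rfl fun i _ => by ring]
    linarith
  · have hev : ∀ᶠ β in 𝓝[>] (0 : ℝ), ∀ i ∈ Finset.range N, 0 < (1 - β / k) ^ i - β * (2 * b i) := by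
      rw [Filter.eventually_all_finset]
      intro i _
      have : Tendsto (fun β : ℝ => (1 - β / k) ^ i - β * (2 * b i)) (𝓝 0) (𝓝 1) := by
        have hc : Continuous fun β : ℝ => (1 - β / k) ^ i - β * (2 * b i) := by fun_prop
        simpa using hc.tendsto 0
      exact nhdsWithin_le_nhds (this.eventually_const_lt zero_lt_one)
    filter_upwards [hev, self_mem_nhdsWithin, nhdsWithin_le_nhds (eventually_lt_nhds hk)]
      with β hβ hβ0 hβk
    rw [mem_Ioi] at hβ0
    have hρ : 0 < 1 - β / k := by rw [sub_pos, div_lt_one hk]; exact hβk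
    set ρ := 1 - β / k with hρd
    -- Here `a i = e ^ (-κ i / 2)`. The part `e ^ (β y) ρ ^ i` averages to `e ^ (β (y - x))` under
    -- `poi(k x)`, which is exact for `x ≥ y`; for `x < y` the subtracted hinge, taken twice, brings
    -- the average below `e ^ (-β (y - x))`.
    set a : ℕ → ℝ := fun i => Real.exp (β * y) *
      (ρ ^ i - if i ∈ Finset.range N then β * (2 * b i) else 0) with ha
    have ha0 : ∀ i, 0 < a i := by
      intro i
      refine mul_pos (Real.exp_pos _) ?_
      split_ifs with hi
      · exact hβ i hi
      · rw [sub_zero]; positivity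
    refine (iInf_le _ (fun i => -2 * Real.log (a i))).trans ?_
    have hB : HasSum (fun i => Real.exp ((1 - 1 / 2) * (-2 * Real.log (a i))) * poi (k * y) i)
        (W β) := by
      have e1 : HasSum (fun i => if i ∈ Finset.range N then poi (k * y) i *
          ((ρ ^ i - β * (2 * b i))⁻¹ - (ρ ^ i)⁻¹) else 0)
          (∑ i ∈ Finset.range N, poi (k * y) i * ((ρ ^ i - β * (2 * b i))⁻¹ - (ρ ^ i)⁻¹)) := by
        rw [← Finset.sum_congr rfl fun i hi => if_pos hi]
        exact hasSum_sum_of_ne_finset_zero fun i hi => if_neg hi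
      refine hasSum_of_eq (((hasSum_pow_mul_poi ρ⁻¹ (k * y)).add e1).mul_left
        (Real.exp (-(β * y)))) (fun i => ?_) rfl
      rw [show (1 - 1 / 2) * (-2 * Real.log (a i)) = -Real.log (a i) by ring, Real.exp_neg,
        Real.exp_log (ha0 i), Real.exp_neg]
      simp only [ha, inv_pow]
      split_ifs with hi
      · rw [mul_inv]; ring
      · rw [mul_inv]; simp; ring
    have hA : ∀ x, 0 ≤ x → HasSum (fun i => Real.exp (-(1 / 2) * (-2 * Real.log (a i))) *
        poi (k * x) i) (Real.exp (β * y) * (Real.exp (-(β * x)) -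
          ∑ i ∈ Finset.range N, β * (2 * b i) * poi (k * x) i)) := by
      intro x _
      have e1 : HasSum (fun i => if i ∈ Finset.range N then β * (2 * b i) * poi (k * x) i else 0)
          (∑ i ∈ Finset.range N, β * (2 * b i) * poi (k * x) i) := by
        rw [← Finset.sum_congr rfl fun i hi => if_pos hi]
        exact hasSum_sum_of_ne_finset_zero fun i hi => if_neg hi
      refine hasSum_of_eq (((hasSum_pow_mul_poi ρ (k * x)).sub e1).mul_left
        (Real.exp (β * y))) (fun i => ?_) ?_
      · rw [show -(1 / 2) * (-2 * Real.log (a i)) = Real.log (a i) by ring, Real.exp_log (ha0 i)]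
        simp only [ha]
        split_ifs with hi <;> ring
      · rw [show k * x * (ρ - 1) = -(β * x) by rw [hρd]; field_simp; ring]
    refine (innerObj_le (s := 0) hk.le hy.le (by norm_num) hB fun x hx =>
      ⟨(hA x hx).summable, ?_⟩).trans (EReal.coe_le_coe_iff.2 (le_of_eq (by ring)))
    have hpos := tsum_exp_mul_poi_pos (mul_nonneg hk.le hx) (hA x hx).summable
    have hle : ∑' i, Real.exp (-(1 / 2) * (-2 * Real.log (a i))) * poi (k * x) i ≤
        Real.exp (-(β * |x - y|)) := by
      rw [(hA x hx).tsum_eq]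
      obtain ⟨g0, g1⟩ := hb x hx
      set G := ∑ i ∈ Finset.range N, b i * poi (k * x) i with hG
      have e2 : ∑ i ∈ Finset.range N, β * (2 * b i) * poi (k * x) i = 2 * β * G := by
        rw [hG, Finset.mul_sum]; exact Finset.sum_congr rfl fun i _ => by ring
      rw [e2, mul_sub, ← Real.exp_add]
      rcases le_total y x with hxy | hxy
      · rw [abs_of_nonneg (by linarith), show β * y + -(β * x) = -(β * (x - y)) by ring]
        have : 0 ≤ Real.exp (β * y) * (2 * β * G) := by positivity
        linarith
      · rw [abs_of_nonpos (by linarith), show -(β * -(x - y)) = β * (x - y) by ring,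
          show β * y + -(β * x) = β * (y - x) by ring]
        have h1 : Real.exp (β * (x - y)) = Real.exp (β * (y - x)) * Real.exp (-(2 * β * (y - x))) := by
          rw [← Real.exp_add]; congr 1; ring
        have h2 := Real.add_one_le_exp (-(2 * β * (y - x)))
        have h3 : Real.exp (β * (y - x)) ≤ Real.exp (β * y) :=
          Real.exp_le_exp.2 (by nlinarith)
        have h4 : 0 < Real.exp (β * (y - x)) := Real.exp_pos _
        have h5 : 0 ≤ 2 * β * (y - x) := by have := sub_nonneg.2 hxy; positivity
        have h6 : 2 * β * (y - x) ≤ 2 * β * G := mul_le_mul_of_nonneg_left g1 (by positivity)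
        have h7 : Real.exp (β * (y - x)) * (2 * β * (y - x)) ≤ Real.exp (β * y) * (2 * β * G) :=
          mul_le_mul h3 h6 h5 (Real.exp_pos _).le
        rw [h1]
        nlinarith
    have := Real.log_le_log hpos hle
    rw [Real.log_exp] at this
    rw [neg_neg]; linarith

section
variable {J : Type*} [Fintype J]

theorem nestedValue_le {y : J → ℝ} {h : J → ℕ} {k ε α u : ℝ} (hα : α ≤ 0)
    (hu : u ∈ Icc (0 : ℝ) 1) : nestedValue y h k ε ≤ outerObj y h k ε α u :=
  (iInf_le _ α).trans ((iInf_le _ hα).trans ((iInf_le _ u).trans (iInf_le _ hu)))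

/-- At `u = 1 / 2` and `α = -β` the objective is at most a function vanishing at `β = 0`. The
penalty contributes slope `-ε / 2`, and the choice of `δ` keeps the contribution of all classes
together below `ε / 2`. -/
theorem nestedValue_neg {y : J → ℝ} {h : J → ℕ} {k ε : ℝ} (hy : ∀ j, 0 < y j) (hk : 0 < k)
    (hε : 0 < ε) : nestedValue y h k ε < 0 := by
  have hδ : 0 < ε / (1 + ∑ j, (h j : ℝ)) := by positivity
  set δ := ε / (1 + ∑ j, (h j : ℝ)) with hδd
  choose W D hW0 hWd hD hW using fun j => exists_innerValue_le (h := h j) hk (hy j) hδ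
  set f : ℝ → ℝ := fun β => -(ε * β / 2) + ∑ j, (h j : ℝ) * (1 / 2 * Real.log (W j β)) with hf
  have hfd : HasDerivAt f (-(ε / 2) + ∑ j, (h j : ℝ) * (1 / 2 * D j)) 0 := by
    refine HasDerivAt.add ?_ (HasDerivAt.fun_sum fun j _ =>
      HasDerivAt.const_mul _ (HasDerivAt.const_mul _ ?_))
    · simpa using (((hasDerivAt_id (0 : ℝ)).const_mul ε).div_const 2).fun_neg
    · have := (hWd j).log (by rw [hW0]; exact one_ne_zero)
      simpa [hW0] using this
  have hneg : -(ε / 2) + ∑ j, (h j : ℝ) * (1 / 2 * D j) < 0 := by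
    have h1 : ∑ j, (h j : ℝ) * (1 / 2 * D j) ≤ ∑ j, (h j : ℝ) * (1 / 2 * δ) :=
      Finset.sum_le_sum fun j _ => by have := hD j; gcongr
    rw [← Finset.sum_mul] at h1
    have h2 : (1 + ∑ j, (h j : ℝ)) * δ = ε := by rw [hδd]; field_simp
    nlinarith
  have hf0 : f 0 = 0 := by simp [hf, hW0]
  have hev : ∀ᶠ β in 𝓝[>] 0, f β < 0 := by
    have h1 := (hasDerivAt_iff_tendsto_slope.1 hfd).eventually_lt_const hneg
    have h2 := h1.filter_mono (nhdsWithin_mono 0 fun x (hx : 0 < x) => hx.ne')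
    filter_upwards [h2, self_mem_nhdsWithin] with β h3 hβ
    rw [slope_def_field, hf0, sub_zero, sub_zero, div_neg_iff] at h3
    rcases h3 with h3 | h3
    · exact absurd h3.2 (not_lt.2 (le_of_lt hβ))
    · exact h3.1
  obtain ⟨β, h1, h2, h3⟩ := (hev.and ((eventually_all.2 hW).and self_mem_nhdsWithin)).exists
  refine (nestedValue_le (α := -β) (u := 1 / 2) (by linarith [show 0 < β from h3])
    (by norm_num)).trans_lt ?_
  refine lt_of_le_of_lt ?_ (EReal.coe_neg'.2 h1)
  unfold outerObj
  rw [hf, EReal.coe_add, ereal_coe_finset_sum]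
  refine add_le_add (EReal.coe_le_coe_iff.2 (le_of_eq (by ring))) (Finset.sum_le_sum fun j _ => h2 j)

end

/-! ### Attainment of the outer minimum -/

/-- The logarithm of the affinity between `tilt b m l` and `poi m`. -/
noncomputable def singleVal (m l b u : ℝ) : ℝ :=
  (1 - u) * (b * |l - m|) - ((1 - u) * l + u * m - l ^ (1 - u) * m ^ u)

section
variable {k y u b α m l : ℝ} {h : ℕ}

theorem singleVal_self (hm : 0 < m) : singleVal m m b u = 0 := by
  unfold singleVal
  rw [← Real.rpow_add hm, show 1 - u + u = 1 by ring, Real.rpow_one]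
  simp; ring

/-- The weighted geometric mean of two Poisson laws is a multiple of the Poisson law with parameter
`l ^ (1 - u) * m ^ u`. -/
theorem log_aff_tilt (hm : 0 < m) (hl : 0 < l) :
    Real.log (aff u (poi m) (tilt b m l)) = singleVal m l b u := by
  have e : ∀ i, tilt b m l i ^ (1 - u) * poi m i ^ u =
      Real.exp (singleVal m l b u) * poi (l ^ (1 - u) * m ^ u) i := by
    intro i
    have hf : (0 : ℝ) < (i.factorial : ℝ) := by positivity
    have h1 : ∀ x : ℝ, 0 < x → ∀ v : ℝ, (x ^ i) ^ v = (x ^ v) ^ i := by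
      intro x hx v
      rw [← Real.rpow_natCast, ← Real.rpow_mul hx.le, mul_comm, Real.rpow_mul hx.le,
        Real.rpow_natCast]
    unfold tilt poi singleVal
    rw [Real.mul_rpow (by positivity) (by positivity), Real.div_rpow (by positivity) hf.le,
      Real.div_rpow (by positivity) hf.le, Real.mul_rpow (by positivity) (by positivity),
      Real.mul_rpow (by positivity) (by positivity), h1 l hl, h1 m hm, ← Real.exp_mul,
      ← Real.exp_mul, ← Real.exp_mul]
    have h2 : (i.factorial : ℝ) ^ (1 - u) * (i.factorial : ℝ) ^ u = i.factorial := by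
      rw [← Real.rpow_add hf]; simp
    have h3 : Real.exp ((1 - u) * (b * |l - m|) - ((1 - u) * l + u * m - l ^ (1 - u) * m ^ u)) *
        Real.exp (-(l ^ (1 - u) * m ^ u)) =
        Real.exp (b * |l - m| * (1 - u)) * Real.exp (-l * (1 - u)) * Real.exp (-m * u) := by
      rw [← Real.exp_add, ← Real.exp_add, ← Real.exp_add]; congr 1; ring
    trans Real.exp (b * |l - m| * (1 - u)) * Real.exp (-l * (1 - u)) * Real.exp (-m * u) *
      ((l ^ (1 - u)) ^ i * (m ^ u) ^ i) / ((i.factorial : ℝ) ^ (1 - u) * (i.factorial : ℝ) ^ u)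
    · ring
    · rw [← h3, h2, mul_pow]; ring
  unfold aff
  simp only [e, tsum_mul_left, (hasSum_poi _).tsum_eq, mul_one, Real.log_exp]

/-- Weak duality with a single location as trial mixture. The endpoints `u = 0` and `u = 1`, where
Hölder is unavailable, are checked directly; they are needed on the closed square. -/
theorem singleVal_le_innerValue (hk : 0 < k) (hy : 0 < y) (hh : 0 < h) (hu : u ∈ Icc (0 : ℝ) 1)
    (hl : 0 < l) : ((h * singleVal (k * y) l b u : ℝ) : EReal) ≤
      innerValue k y h (-(k * b)) u := by
  have hky : 0 < k * y := mul_pos hk hy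
  refine le_iInf fun κ => ?_
  rcases eq_or_lt_of_le hu.1 with h0 | h0
  · subst h0
    have e0 : innerObj k y h (-(k * b)) 0 κ = ((h : ℝ) : EReal) * innerSup k y (-(k * b)) 0 κ := by
      rw [innerObj_eq]; simp
    have h1 := le_innerSup (k := k) (y := y) (α := -(k * b)) (u := 0) (κ := κ)
      ⟨l / k, by positivity⟩
    change ((-(-(k * b)) * |l / k - y| : ℝ) : EReal) + logMGF (fun i => -0 * κ i) (k * (l / k)) ≤ _
      at h1
    simp only [neg_zero, zero_mul] at h1
    rw [logMGF_zero _ (by positivity), add_zero] at h1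
    rw [e0]
    refine le_trans ?_ (mul_le_mul_of_nonneg_left h1 (EReal.coe_nonneg.2 (Nat.cast_nonneg h)))
    rw [← EReal.coe_mul, EReal.coe_le_coe_iff]
    refine le_of_eq ?_
    have h5 : l / k - y = (l - k * y) / k := by field_simp
    unfold singleVal
    rw [h5, abs_div, abs_of_pos hk]
    simp
    field_simp
    simp
  rcases eq_or_lt_of_le hu.2 with h1 | h1
  · subst h1
    have e0 : innerObj k y h (-(k * b)) 1 κ = 0 := by
      rw [innerObj_eq]
      simp [logMGF_zero _ hky.le]
    rw [e0]
    simp [singleVal]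
  · have := (log_aff_mix_le_innerObj (κ := κ) (b := b) (w := 0) (l₁ := 0) (l₂ := l) hk hy
      ⟨h0, h1⟩ hh (by simp) le_rfl hl).1
    rwa [show mix b (k * y) 0 0 l = tilt b (k * y) l from funext fun i => mix_zero i,
      log_aff_tilt hky hl] at this

theorem innerValue_nonneg (hk : 0 < k) (hy : 0 < y) (hh : 0 < h) (hu : u ∈ Icc (0 : ℝ) 1) :
    0 ≤ innerValue k y h α u := by
  have := singleVal_le_innerValue (b := -α / k) hk hy hh hu (mul_pos hk hy)
  rwa [singleVal_self (mul_pos hk hy), mul_zero, EReal.coe_zero,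
    show -(k * (-α / k)) = α by field_simp] at this

theorem innerValue_eq_zero (hk : 0 < k) (hy : 0 < y) (hh : 0 < h) (hu : u ∈ Icc (0 : ℝ) 1)
    (hα : α = 0 ∨ u = 1) : innerValue k y h α u = 0 := by
  refine le_antisymm ((iInf_le _ (fun _ => 0)).trans ?_) (innerValue_nonneg hk hy hh hu)
  have hky : 0 < k * y := mul_pos hk hy
  rw [innerObj_eq]
  simp only [mul_zero, logMGF_zero _ hky.le, zero_add]
  rcases hα with rfl | rfl
  · have : innerSup k y 0 u (fun _ => 0) ≤ 0 := by
      refine iSup_le fun x => ?_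
      simp [logMGF_zero _ (mul_nonneg hk.le x.coe_nonneg)]
    exact mul_nonpos_of_nonneg_of_nonpos
      (EReal.coe_nonneg.2 (mul_nonneg (by linarith [hu.2]) (Nat.cast_nonneg h))) this
  · simp

/-- As `l → ∞`, for `b ≥ 1` the linear part stays bounded below and `l ^ (1 - u) * m ^ u` diverges;
for `u = 0` the value on the right is simply `b (l - m)`. -/
theorem exists_singleVal_gt (hm : 0 < m) (hu : u ∈ Ico (0 : ℝ) 1)
    (h : 1 ≤ b ∨ (0 < b ∧ u = 0)) (C : ℝ) : ∃ l, 0 < l ∧ C < singleVal m l b u := by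
  rcases h with h | ⟨h, rfl⟩
  · have h1 : Tendsto (fun l : ℝ => -m + l ^ (1 - u) * m ^ u) atTop atTop :=
      tendsto_atTop_add_const_left _ _ ((tendsto_rpow_atTop (by linarith [hu.2])).atTop_mul_const
        (Real.rpow_pos_of_pos hm u))
    obtain ⟨l, hl, hlm⟩ := ((h1.eventually_gt_atTop C).and (eventually_ge_atTop m)).exists
    refine ⟨l, hm.trans_le hlm, hl.trans_le ?_⟩
    unfold singleVal
    rw [abs_of_nonneg (sub_nonneg.2 hlm)]
    have h1u : 0 ≤ 1 - u := by linarith [hu.2]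
    have : 0 ≤ (1 - u) * ((b - 1) * (l - m)) :=
      mul_nonneg h1u (mul_nonneg (by linarith) (by linarith))
    nlinarith
  · have h1 : Tendsto (fun l : ℝ => b * (l - m)) atTop atTop :=
      (tendsto_atTop_add_const_right _ (-m) tendsto_id).const_mul_atTop h
    obtain ⟨l, hl, hlm⟩ := ((h1.eventually_gt_atTop C).and (eventually_ge_atTop m)).exists
    refine ⟨l, hm.trans_le hlm, hl.trans_le ?_⟩
    unfold singleVal
    rw [abs_of_nonneg (sub_nonneg.2 hlm)]
    simp

theorem innerValue_eq_top (hk : 0 < k) (hy : 0 < y) (hh : 0 < h) (hu : u ∈ Ico (0 : ℝ) 1)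
    (hb : 1 ≤ b ∨ (0 < b ∧ u = 0)) : innerValue k y h (-(k * b)) u = ⊤ := by
  rw [EReal.eq_top_iff_forall_lt]
  intro C
  have hh' : (0 : ℝ) < h := by exact_mod_cast hh
  obtain ⟨l, hl, hC⟩ := exists_singleVal_gt (mul_pos hk hy) hu hb (C / h)
  refine lt_of_lt_of_le (EReal.coe_lt_coe_iff.2 ?_)
    (singleVal_le_innerValue (b := b) hk hy hh ⟨hu.1, hu.2.le⟩ hl)
  rwa [div_lt_iff₀' hh'] at hC

end

section
variable {J : Type*} [Fintype J] {y : J → ℝ} {h : J → ℕ} {k ε u b α : ℝ}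

theorem outerObj_nonneg (hk : 0 < k) (hy : ∀ j, 0 < y j) (hh : ∀ j, 0 < h j)
    (hu : u ∈ Icc (0 : ℝ) 1) (hα : α = 0 ∨ u = 1) : 0 ≤ outerObj y h k ε α u := by
  unfold outerObj
  have : ε * α * (1 - u) = 0 := by rcases hα with rfl | rfl <;> simp
  rw [this, EReal.coe_zero, zero_add]
  exact Finset.sum_nonneg fun j _ => innerValue_nonneg hk (hy j) (hh j) hu

theorem outerObj_eq_top [Nonempty J] (hk : 0 < k) (hy : ∀ j, 0 < y j) (hh : ∀ j, 0 < h j)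
    (hu : u ∈ Ico (0 : ℝ) 1) (hb : 1 ≤ b ∨ (0 < b ∧ u = 0)) :
    outerObj y h k ε (-(k * b)) u = ⊤ := by
  unfold outerObj
  obtain ⟨j⟩ := ‹Nonempty J›
  rw [ereal_sum_eq_top _ _ (fun i _ => (lt_of_lt_of_le EReal.bot_lt_zero
    (innerValue_nonneg hk (hy i) (hh i) ⟨hu.1, hu.2.le⟩)).ne') (Finset.mem_univ j)
    (innerValue_eq_top hk (hy j) (hh j) hu hb)]
  exact EReal.coe_add_top _

/-- A partial sum of the affinities gives a lower bound for the outer objective. -/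
theorem partial_le_outerObj (hk : 0 < k) (hy : ∀ j, 0 < y j) (hh : ∀ j, 0 < h j)
    (hu : u ∈ Ioo (0 : ℝ) 1) {w l₁ l₂ : J → ℝ} (hw : ∀ j, w j ∈ Ico (0 : ℝ) 1)
    (h1 : ∀ j, 0 ≤ l₁ j) (h2 : ∀ j, 0 < l₂ j) (n : ℕ) :
    ((ε * (-(k * b)) * (1 - u) + ∑ j, (h j : ℝ) * Real.log (∑ i ∈ Finset.range (n + 1),
      mix b (k * y j) (w j) (l₁ j) (l₂ j) i ^ (1 - u) * poi (k * y j) i ^ u) : ℝ) : EReal) ≤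
      outerObj y h k ε (-(k * b)) u := by
  unfold outerObj
  rw [EReal.coe_add, ereal_coe_finset_sum]
  refine add_le_add_right (Finset.sum_le_sum fun j _ => le_iInf fun κ => ?_) _
  refine le_trans (EReal.coe_le_coe_iff.2 (mul_le_mul_of_nonneg_left (Real.log_le_log ?_ ?_)
    (Nat.cast_nonneg _))) (log_aff_mix_le_innerObj (κ := κ) (b := b) hk (hy j) hu (hh j) (hw j)
      (h1 j) (h2 j)).1
  · have hky := mul_pos hk (hy j)
    exact Finset.sum_pos (fun i _ => mul_pos (Real.rpow_pos_of_pos (mix_pos (hw j) (h1 j) (h2 j) i) _)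
      (Real.rpow_pos_of_pos (poi_pos hky i) _)) ⟨0, by simp⟩
  · have hky := mul_pos hk (hy j)
    have hM := mix_pos (b := b) (m := k * y j) (hw j) (h1 j) (h2 j)
    exact (summable_aff hu (fun i => (poi_pos hky i).le) (fun i => (hM i).le) (summable_poi _)
      summable_mix).sum_le_tsum _ fun i _ =>
        aff_term_nonneg (fun i => (poi_pos hky i).le) (fun i => (hM i).le) i

/-- Near each point the objective lies above some continuous `Φ` whose value at the point exceeds
the given level. The choice of `Φ` depends on the region, and a dual trial point kept fixed while
`(b, u)` varies supplies it. -/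
theorem lowerSemicontinuousOn_outerObj [Nonempty J] (hk : 0 < k) (hy : ∀ j, 0 < y j)
    (hh : ∀ j, 0 < h j) : LowerSemicontinuousOn
      (fun x : ℝ × ℝ => outerObj y h k ε (-(k * x.1)) x.2) (Icc 0 1 ×ˢ Icc 0 1) := by
  have key : ∀ (x : ℝ × ℝ) (c : EReal) (Φ : ℝ × ℝ → ℝ), ContinuousAt Φ x → c < Φ x →
      (∀ᶠ z in 𝓝[Icc 0 1 ×ˢ Icc 0 1] x, (Φ z : EReal) ≤ outerObj y h k ε (-(k * z.1)) z.2) →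
      ∀ᶠ z in 𝓝[Icc 0 1 ×ˢ Icc 0 1] x, c < outerObj y h k ε (-(k * z.1)) z.2 := by
    intro x c Φ hΦ hc hle
    have h1 : ContinuousAt (fun z => (Φ z : EReal)) x :=
      continuous_coe_real_ereal.continuousAt.comp hΦ
    filter_upwards [nhdsWithin_le_nhds (h1.eventually (lt_mem_nhds hc)), hle] with z h2 h3
    exact h2.trans_le h3
  rintro ⟨b, u⟩ ⟨hb, hu⟩ c hc
  change b ∈ Icc 0 1 at hb
  change u ∈ Icc 0 1 at hu
  change c < outerObj y h k ε (-(k * b)) u at hc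
  -- On these edges the inner values vanish, and nonnegativity of the inner values nearby suffices.
  by_cases hzero : b = 0 ∨ u = 1
  · refine key (b, u) c (fun z => ε * (-(k * z.1)) * (1 - z.2)) (by fun_prop) ?_ ?_
    · refine hc.trans_eq ?_
      unfold outerObj
      rw [Finset.sum_eq_zero fun j _ => innerValue_eq_zero hk (hy j) (hh j) hu
        (hzero.imp (fun h => by simp [h]) id), add_zero]
    · filter_upwards [self_mem_nhdsWithin] with z hz
      unfold outerObj
      conv_lhs => rw [← add_zero ((_ : ℝ) : EReal)]
      exact add_le_add_right (Finset.sum_nonneg fun j _ =>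
        innerValue_nonneg hk (hy j) (hh j) hz.2) _
  push Not at hzero
  have hu1 : u < 1 := lt_of_le_of_ne hu.2 hzero.2
  have hb0 : 0 < b := lt_of_le_of_ne hb.1 (Ne.symm hzero.1)
  -- Where the value is `⊤`, a single far location in one class already exceeds any level, with
  -- continuous dependence on `(b, u)`.
  by_cases htop : 1 ≤ b ∨ (0 < b ∧ u = 0)
  · obtain ⟨j⟩ := ‹Nonempty J›
    have hh' : (0 : ℝ) < h j := by exact_mod_cast hh j
    have hky := mul_pos hk (hy j)
    obtain ⟨C, hC, -⟩ := EReal.lt_iff_exists_real_btwn.1 (hc.trans_le le_top)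
    obtain ⟨l, hl, hlC⟩ := exists_singleVal_gt hky ⟨hu.1, hu1⟩ htop
      ((C - ε * (-(k * b)) * (1 - u)) / h j)
    rw [div_lt_iff₀' hh'] at hlC
    refine key (b, u) c (fun z => ε * (-(k * z.1)) * (1 - z.2) +
      h j * singleVal (k * y j) l z.1 z.2) ?_ ?_ ?_
    · have h1 : Continuous fun z : ℝ × ℝ => l ^ (1 - z.2) :=
        Continuous.rpow (by fun_prop) (by fun_prop) fun _ => Or.inl hl.ne'
      have h2 : Continuous fun z : ℝ × ℝ => (k * y j) ^ z.2 :=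
        Continuous.rpow (by fun_prop) (by fun_prop) fun _ => Or.inl hky.ne'
      unfold singleVal
      exact Continuous.continuousAt (by fun_prop)
    · exact hC.trans (EReal.coe_lt_coe_iff.2 (by dsimp only; linarith))
    · filter_upwards [self_mem_nhdsWithin] with z hz
      unfold outerObj
      rw [EReal.coe_add]
      exact add_le_add_right ((singleVal_le_innerValue hk (hy j) (hh j) hz.2 hl).trans
        (Finset.single_le_sum (f := fun j => innerValue k (y j) (h j) (-(k * z.1)) z.2)
          (fun i _ => innerValue_nonneg hk (hy i) (hh i) hz.2) (Finset.mem_univ j))) _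
  · push Not at htop
    have hb' : b ∈ Ioo (0 : ℝ) 1 := ⟨hb0, htop.1⟩
    have hu' : u ∈ Ioo (0 : ℝ) 1 := ⟨lt_of_le_of_ne hu.1 (Ne.symm (htop.2 hb0)), hu1⟩
    choose w l₁ l₂ hS using fun j => exists_isSaddle hu' hb' (mul_pos hk (hy j))
    have hw := fun j => (hS j).w_mem'
    have h1 := fun j => (hS j).l₁_nonneg
    have h2 := fun j => (hS j).l₂_pos
    have hM := fun b' j => mix_pos (b := b') (m := k * y j) (hw j) (h1 j) (h2 j)
    have hp := fun j => poi_pos (mul_pos hk (hy j))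
    -- In the interior the saddle found at `(b, u)` is frozen. Finite partial sums of its affinities
    -- are continuous lower bounds, and they approach the value at `(b, u)`.
    set Φ : ℕ → ℝ × ℝ → ℝ := fun n z => ε * (-(k * z.1)) * (1 - z.2) + ∑ j, (h j : ℝ) *
      Real.log (∑ i ∈ Finset.range (n + 1), mix z.1 (k * y j) (w j) (l₁ j) (l₂ j) i ^ (1 - z.2) *
        poi (k * y j) i ^ z.2) with hΦ
    have hval : outerObj y h k ε (-(k * b)) u = ((ε * (-(k * b)) * (1 - u) + ∑ j, (h j : ℝ) *
        Real.log (aff u (poi (k * y j)) (mix b (k * y j) (w j) (l₁ j) (l₂ j))) : ℝ) : EReal) := by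
      unfold outerObj
      rw [EReal.coe_add, ereal_coe_finset_sum]
      simp only [innerValue_saddle hk (hy _) hu' (hh _) (hS _)]
    have hlim : Tendsto (fun n => Φ n (b, u)) atTop (𝓝 (ε * (-(k * b)) * (1 - u) + ∑ j, (h j : ℝ) *
        Real.log (aff u (poi (k * y j)) (mix b (k * y j) (w j) (l₁ j) (l₂ j))))) := by
      refine tendsto_const_nhds.add (tendsto_finsetSum _ fun j _ => Tendsto.const_mul _ ?_)
      refine Tendsto.log ?_ ((hS j).aff_pos hu' (mul_pos hk (hy j))).ne'
      exact ((summable_aff hu' (fun i => (hp j i).le) (fun i => (hM b j i).le) (summable_poi _)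
        summable_mix).hasSum.tendsto_sum_nat).comp (tendsto_add_atTop_nat 1)
    have hlim' := (continuous_coe_real_ereal.tendsto _).comp hlim
    rw [hval] at hc
    obtain ⟨n, hn⟩ := (hlim'.eventually (lt_mem_nhds hc)).exists
    refine key (b, u) c (Φ n) ?_ hn ?_
    · refine Continuous.continuousAt ?_
      refine Continuous.add (by fun_prop) (continuous_finsetSum _ fun j _ =>
        continuous_const.mul (Continuous.log (continuous_finsetSum _ fun i _ => ?_) fun z => ?_))
      · refine Continuous.mul (Continuous.rpow ?_ (by fun_prop) fun z => Or.inl (hM _ j i).ne')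
          (Continuous.rpow (by fun_prop) (by fun_prop) fun z => Or.inl (hp j i).ne')
        unfold mix tilt
        fun_prop
      · exact (Finset.sum_pos (fun i _ => mul_pos (Real.rpow_pos_of_pos (hM _ j i) _)
          (Real.rpow_pos_of_pos (hp j i) _)) ⟨0, by simp⟩).ne'
    · have hev : ∀ᶠ z : ℝ × ℝ in 𝓝 (b, u), z.2 ∈ Ioo (0 : ℝ) 1 :=
        continuous_snd.continuousAt.eventually (Ioo_mem_nhds hu'.1 hu'.2)
      filter_upwards [nhdsWithin_le_nhds hev] with z hz
      exact partial_le_outerObj hk hy hh hz hw h1 h2 n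

/-- Compactness of the unit square in `(b, u)` suffices: for `b > 1` the objective is `⊤` unless `u
= 1`, where it is nonnegative and hence no better than the value `0` at `(0, 1)`. -/
theorem exists_outerObj_eq_nestedValue [Nonempty J] (hk : 0 < k) (hy : ∀ j, 0 < y j)
    (hh : ∀ j, 0 < h j) : ∃ α u : ℝ, α ≤ 0 ∧ u ∈ Icc (0 : ℝ) 1 ∧
      outerObj y h k ε α u = nestedValue y h k ε := by
  obtain ⟨⟨b, u⟩, ⟨hb, hu⟩, hmin⟩ :=
    (lowerSemicontinuousOn_outerObj (ε := ε) hk hy hh).exists_isMinOn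
      ⟨(0, 1), by simp⟩ (isCompact_Icc.prod isCompact_Icc)
  have hα : -(k * b) ≤ 0 := neg_nonpos.2 (mul_nonneg hk.le hb.1)
  refine ⟨-(k * b), u, hα, hu, le_antisymm ?_ (nestedValue_le hα hu)⟩
  have hmin' : ∀ b' ∈ Icc (0 : ℝ) 1, ∀ u' ∈ Icc (0 : ℝ) 1,
      outerObj y h k ε (-(k * b)) u ≤ outerObj y h k ε (-(k * b')) u' :=
    fun b' hb' u' hu' => isMinOn_iff.1 hmin (b', u') ⟨hb', hu'⟩
  refine le_iInf fun α => le_iInf fun hα => le_iInf fun v => le_iInf fun hv => ?_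
  have e : α = -(k * (-α / k)) := by field_simp
  have hb0 : 0 ≤ -α / k := div_nonneg (by linarith) hk.le
  rcases le_or_gt (-α / k) 1 with h1 | h1
  · rw [e]; exact hmin' _ ⟨hb0, h1⟩ v hv
  · rcases eq_or_lt_of_le hv.2 with rfl | hv1
    · refine (hmin' 0 (by simp) 1 hv).trans ?_
      have : outerObj y h k ε (-(k * 0)) 1 = 0 := by
        unfold outerObj
        rw [Finset.sum_eq_zero fun j _ => innerValue_eq_zero hk (hy j) (hh j) hv (Or.inr rfl)]
        simp
      rw [this]
      exact outerObj_nonneg hk hy hh hv (Or.inr rfl)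
    · rw [e, outerObj_eq_top hk hy hh ⟨hv.1, hv1⟩ (Or.inl h1.le)]
      exact le_top

/-- Outer minimizers are interior. -/
theorem exists_eq_of_outerObj_eq [Nonempty J] (hk : 0 < k) (hy : ∀ j, 0 < y j)
    (hh : ∀ j, 0 < h j) (hε : 0 < ε) (hα : α ≤ 0) (hu : u ∈ Icc (0 : ℝ) 1)
    (he : outerObj y h k ε α u = nestedValue y h k ε) :
    u ∈ Ioo (0 : ℝ) 1 ∧ ∃ b ∈ Ioo (0 : ℝ) 1, α = -(k * b) := by
  have hneg : outerObj y h k ε α u < 0 := he ▸ nestedValue_neg hy hk hε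
  have e : α = -(k * (-α / k)) := by field_simp
  have hu1 : u < 1 := lt_of_le_of_ne hu.2 fun h1 =>
    not_lt.2 (outerObj_nonneg hk hy hh hu (Or.inr h1)) hneg
  have hα0 : α < 0 := lt_of_le_of_ne hα fun h1 =>
    not_lt.2 (outerObj_nonneg hk hy hh hu (Or.inl h1)) hneg
  have hb0 : 0 < -α / k := div_pos (by linarith) hk
  have hnt : ¬ (1 ≤ -α / k ∨ (0 < -α / k ∧ u = 0)) := fun h1 => by
    rw [e, outerObj_eq_top hk hy hh ⟨hu.1, hu1⟩ h1] at hneg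
    exact absurd hneg (by simp)
  push Not at hnt
  exact ⟨⟨lt_of_le_of_ne hu.1 (Ne.symm (hnt.2 hb0)), hu1⟩, _, ⟨hb0, hnt.1⟩, e⟩

end

/-! ### Stationarity of optimal points -/

theorem exp_mul_le_add {a b s x : ℝ} (has : a ≤ s) (hsb : s ≤ b) :
    Real.exp (s * x) ≤ Real.exp (a * x) + Real.exp (b * x) := by
  rcases le_total 0 x with hx | hx
  · have := Real.exp_le_exp.2 (mul_le_mul_of_nonneg_right hsb hx)
    linarith [Real.exp_pos (a * x)]
  · have := Real.exp_le_exp.2 (mul_le_mul_of_nonpos_right has hx)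
    linarith [Real.exp_pos (b * x)]

theorem abs_mul_exp_le {a b d s x : ℝ} (hd : 0 < d) (has : a + d ≤ s) (hsb : s + d ≤ b) :
    |x| * Real.exp (s * x) ≤ d⁻¹ * (Real.exp (a * x) + Real.exp (b * x)) := by
  have h1 : |x| ≤ d⁻¹ * Real.exp (d * |x|) := by
    rw [inv_mul_eq_div, le_div_iff₀ hd]
    linarith [Real.add_one_le_exp (d * |x|)]
  have h2 : Real.exp (d * |x|) * Real.exp (s * x) ≤ Real.exp (a * x) + Real.exp (b * x) := by
    rw [← Real.exp_add]
    rcases le_total 0 x with hx | hx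
    · rw [abs_of_nonneg hx, ← add_mul]
      exact exp_mul_le_add (by linarith) (by linarith)
    · rw [abs_of_nonpos hx, mul_neg, ← neg_mul, ← add_mul]
      exact exp_mul_le_add (by linarith) (by linarith)
  calc |x| * Real.exp (s * x) ≤ d⁻¹ * Real.exp (d * |x|) * Real.exp (s * x) :=
        mul_le_mul_of_nonneg_right h1 (Real.exp_pos _).le
    _ ≤ _ := by rw [mul_assoc]; exact mul_le_mul_of_nonneg_left h2 (by positivity)

/-- Differentiation of a moment generating series. -/
theorem hasDerivAt_tsum_exp_mul {p κ : ℕ → ℝ} {a b s : ℝ} (hp : ∀ i, 0 ≤ p i) (has : a < s)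
    (hsb : s < b) (ha : Summable fun i => Real.exp (a * κ i) * p i)
    (hb : Summable fun i => Real.exp (b * κ i) * p i) :
    HasDerivAt (fun t => ∑' i, Real.exp (t * κ i) * p i)
      (∑' i, κ i * (Real.exp (s * κ i) * p i)) s ∧
    Summable (fun i => κ i * (Real.exp (s * κ i) * p i)) := by
  set d : ℝ := min (s - a) (b - s) / 2 with hd
  have hm : 0 < min (s - a) (b - s) := lt_min (by linarith) (by linarith)
  have hd0 : 0 < d := by positivity
  have hd1 : 2 * d ≤ s - a := by rw [hd]; linarith [min_le_left (s - a) (b - s)]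
  have hd2 : 2 * d ≤ b - s := by rw [hd]; linarith [min_le_right (s - a) (b - s)]
  have hbd : ∀ i, ∀ t ∈ Ioo (s - d) (s + d), ‖κ i * (Real.exp (t * κ i) * p i)‖ ≤
      d⁻¹ * (Real.exp (a * κ i) * p i + Real.exp (b * κ i) * p i) := by
    intro i t ht
    rw [norm_mul, Real.norm_eq_abs, Real.norm_of_nonneg (mul_nonneg (Real.exp_pos _).le (hp i)),
      ← mul_assoc, ← add_mul, ← mul_assoc]
    exact mul_le_mul_of_nonneg_right (abs_mul_exp_le hd0 (by linarith [ht.1]) (by linarith [ht.2]))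
      (hp i)
  have hsum : Summable fun i => d⁻¹ * (Real.exp (a * κ i) * p i + Real.exp (b * κ i) * p i) :=
    (ha.add hb).mul_left _
  have hs : s ∈ Ioo (s - d) (s + d) := ⟨by linarith, by linarith⟩
  refine ⟨hasDerivAt_tsum_of_isPreconnected hsum isOpen_Ioo isPreconnected_Ioo
    (fun i t _ => ?_) hbd hs ?_ hs, Summable.of_norm_bounded hsum fun i => hbd i s hs⟩
  · refine ((((hasDerivAt_id t).mul_const (κ i)).exp).mul_const (p i)).congr_deriv ?_
    simp; ring
  · refine Summable.of_nonneg_of_le (fun i => mul_nonneg (Real.exp_pos _).le (hp i)) (fun i => ?_)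
      (ha.add hb)
    rw [← add_mul]
    exact mul_le_mul_of_nonneg_right (exp_mul_le_add has.le hsb.le) (hp i)

theorem exp_log_div_mul {M p s : ℝ} (hM : 0 < M) (hp : 0 < p) :
    Real.exp (s * Real.log (M / p)) * p = M ^ s * p ^ (1 - s) := by
  rw [mul_comm s, Real.exp_mul, Real.exp_log (div_pos hM hp), Real.div_rpow hM.le hp.le,
    Real.rpow_sub hp, Real.rpow_one]
  have := (Real.rpow_pos_of_pos hp s).ne'
  field_simp

theorem tsum_exp_eq_aff {p M : ℕ → ℝ} (hM : ∀ i, 0 < M i) (hp : ∀ i, 0 < p i) (s : ℝ) :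
    ∑' i, Real.exp (s * Real.log (M i / p i)) * p i = aff (1 - s) p M := by
  unfold aff
  simp only [exp_log_div_mul (hM _) (hp _), sub_sub_cancel]

theorem summable_exp_mul_log {p M : ℕ → ℝ} (hM : ∀ i, 0 < M i) (hp : ∀ i, 0 < p i)
    (sp : Summable p) (sM : Summable M) {s : ℝ} (hs : s ∈ Ioo (0 : ℝ) 1) :
    Summable fun i => Real.exp (s * Real.log (M i / p i)) * p i := by
  have := summable_aff (u := 1 - s) ⟨by linarith [hs.2], by linarith [hs.1]⟩
    (fun i => (hp i).le) (fun i => (hM i).le) sp sM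
  refine this.congr fun i => ?_
  rw [exp_log_div_mul (hM i) (hp i), sub_sub_cancel]

theorem hasDerivAt_tsum_exp_mul_log {p M : ℕ → ℝ} (hM : ∀ i, 0 < M i) (hp : ∀ i, 0 < p i)
    (sp : Summable p) (sM : Summable M) {s : ℝ} (hs : s ∈ Ioo (0 : ℝ) 1) :
    HasDerivAt (fun t => ∑' i, Real.exp (t * Real.log (M i / p i)) * p i)
      (∑' i, Real.log (M i / p i) * (Real.exp (s * Real.log (M i / p i)) * p i)) s ∧
    Summable (fun i => Real.log (M i / p i) * (Real.exp (s * Real.log (M i / p i)) * p i)) :=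
  hasDerivAt_tsum_exp_mul (a := s / 2) (b := (1 + s) / 2) (fun i => (hp i).le)
    (by linarith [hs.1]) (by linarith [hs.2])
    (summable_exp_mul_log hM hp sp sM ⟨by linarith [hs.1], by linarith [hs.2]⟩)
    (summable_exp_mul_log hM hp sp sM ⟨by linarith [hs.1], by linarith [hs.2]⟩)

/-- Changing the tilt of a two-point mixture. -/
theorem log_aff_mix_le {u b b' m w l₁ l₂ w' l₁' l₂' : ℝ} (hu : u ∈ Ioo (0 : ℝ) 1) (hm : 0 < m)
    (h : IsSaddle u b m w l₁ l₂) (h' : IsSaddle u b' m w' l₁' l₂') :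
    Real.log (aff u (poi m) (mix b' m w' l₁' l₂')) ≤ Real.log (aff u (poi m) (mix b m w l₁ l₂)) +
      (1 - u) * ((b' - b) * (w' * (|l₁' - m| * Real.exp ((b' - b) * |l₁' - m|)) +
        (1 - w') * (|l₂' - m| * Real.exp ((b' - b) * |l₂' - m|)))) := by
  set e₁ := Real.exp ((b' - b) * |l₁' - m|) with he₁
  set e₂ := Real.exp ((b' - b) * |l₂' - m|) with he₂
  have hw0 := h'.w_mem.1
  have hw1 : 0 < 1 - w' := by linarith [h'.w_mem.2]
  have hp₁ : 0 < e₁ := Real.exp_pos _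
  have hp₂ : 0 < e₂ := Real.exp_pos _
  set C := w' * e₁ + (1 - w') * e₂ with hC
  have hC0 : 0 < C := by positivity
  have ht : ∀ l i, tilt b' m l i = Real.exp ((b' - b) * |l - m|) * tilt b m l i := by
    intro l i
    unfold tilt
    rw [← mul_assoc, ← Real.exp_add]; congr 2; ring
  -- Replacing `b'` by `b` multiplies the two components by `e₁` and `e₂`; after division by their
  -- total `C` the result is again a two-point mixture, so maximality of the saddle at `b` applies.
  have hmix : ∀ i, mix b' m w' l₁' l₂' i = C * mix b m (w' * e₁ / C) l₁' l₂' i := by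
    intro i
    have h1 : 1 - w' * e₁ / C = (1 - w') * e₂ / C := by
      field_simp; rw [hC]; ring
    unfold mix
    rw [ht l₁', ht l₂', h1, ← he₁, ← he₂]
    field_simp
  have hw'' : w' * e₁ / C ∈ Ico (0 : ℝ) 1 := by
    refine ⟨by positivity, ?_⟩
    rw [div_lt_one hC0, hC]
    have : 0 < (1 - w') * e₂ := by positivity
    linarith
  have h2p := h'.l₂_pos
  have haff : aff u (poi m) (mix b' m w' l₁' l₂') =
      C ^ (1 - u) * aff u (poi m) (mix b m (w' * e₁ / C) l₁' l₂') := by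
    unfold aff
    rw [← tsum_mul_left]
    refine tsum_congr fun i => ?_
    rw [hmix, Real.mul_rpow hC0.le (mix_pos hw'' h'.l₁_nonneg h2p i).le]
    ring
  have hle := h.aff_le hu hm ⟨hw''.1, hw''.2.le⟩ h'.l₁_nonneg h2p.le
  have hpos := aff_mix_pos (b := b) hu hm hw'' h'.l₁_nonneg h2p
  rw [haff, Real.log_mul (by positivity) hpos.ne', Real.log_rpow hC0]
  have h1 := Real.log_le_log hpos hle
  have h1u : 0 < 1 - u := by linarith [hu.2]
  have h3 : Real.log C ≤ (b' - b) * (w' * (|l₁' - m| * e₁) + (1 - w') * (|l₂' - m| * e₂)) := by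
    refine (Real.log_le_sub_one_of_pos hC0).trans ?_
    have hexp : ∀ s : ℝ, Real.exp s - 1 ≤ s * Real.exp s := by
      intro s
      have h4 := Real.add_one_le_exp (-s)
      have h5 : Real.exp (-s) * Real.exp s = 1 := by rw [← Real.exp_add]; simp
      nlinarith [Real.exp_pos s]
    have q1 := mul_le_mul_of_nonneg_left (hexp ((b' - b) * |l₁' - m|)) hw0.le
    have q2 := mul_le_mul_of_nonneg_left (hexp ((b' - b) * |l₂' - m|)) hw1.le
    rw [← he₁] at q1
    rw [← he₂] at q2
    rw [hC]; linarith
  have := mul_le_mul_of_nonneg_left h3 h1u.le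
  linarith

section
variable {J : Type*} [Fintype J] {y : J → ℝ} {h : J → ℕ} {k ε u b : ℝ} {w l₁ l₂ : J → ℝ}

theorem outerObj_saddle (hk : 0 < k) (hy : ∀ j, 0 < y j) (hh : ∀ j, 0 < h j)
    (hu : u ∈ Ioo (0 : ℝ) 1) (hS : ∀ j, IsSaddle u b (k * y j) (w j) (l₁ j) (l₂ j)) :
    outerObj y h k ε (-(k * b)) u = ((ε * (-(k * b)) * (1 - u) + ∑ j, (h j : ℝ) *
      Real.log (aff u (poi (k * y j)) (mix b (k * y j) (w j) (l₁ j) (l₂ j))) : ℝ) : EReal) := by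
  unfold outerObj
  rw [EReal.coe_add, ereal_coe_finset_sum]
  simp only [innerValue_saddle hk (hy _) hu (hh _) (hS _)]

/-- Stationarity in the Lagrange multiplier: the mean distance of the two-point mixtures. -/
theorem sum_dist_eq (hk : 0 < k) (hy : ∀ j, 0 < y j) (hh : ∀ j, 0 < h j)
    (hu : u ∈ Ioo (0 : ℝ) 1) (hb : b ∈ Ioo (0 : ℝ) 1)
    (hS : ∀ j, IsSaddle u b (k * y j) (w j) (l₁ j) (l₂ j))
    (he : outerObj y h k ε (-(k * b)) u = nestedValue y h k ε) :
    ∑ j, (h j : ℝ) * (w j * |l₁ j - k * y j| + (1 - w j) * |l₂ j - k * y j|) = ε * k := by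
  have hm := fun j => mul_pos hk (hy j)
  have hex : ∀ j, ∀ b' : ℝ, ∃ x : ℝ × ℝ × ℝ, b' ∈ Ioo (0 : ℝ) 1 →
      IsSaddle u b' (k * y j) x.1 x.2.1 x.2.2 := by
    intro j b'
    by_cases hb' : b' ∈ Ioo (0 : ℝ) 1
    · obtain ⟨w', a', c', h'⟩ := exists_isSaddle hu hb' (hm j)
      exact ⟨(w', a', c'), fun _ => h'⟩
    · exact ⟨(0, 0, 0), fun h => absurd h hb'⟩
  choose X hX using hex
  set D : ℝ → ℝ := fun b' => ∑ j, (h j : ℝ) * ((X j b').1 * (|(X j b').2.1 - k * y j| *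
    Real.exp ((b' - b) * |(X j b').2.1 - k * y j|)) + (1 - (X j b').1) *
    (|(X j b').2.2 - k * y j| * Real.exp ((b' - b) * |(X j b').2.2 - k * y j|))) with hD
  have hDb : D b = ∑ j, (h j : ℝ) * (w j * |l₁ j - k * y j| + (1 - w j) * |l₂ j - k * y j|) := by
    refine Finset.sum_congr rfl fun j _ => ?_
    obtain ⟨e1, e2, e3⟩ := (hS j).unique hu (hm j) (hX j b hb)
    rw [e1, e2, e3]
    simp
  have hlim : Tendsto D (𝓝 b) (𝓝 (D b)) := by
    refine tendsto_finsetSum _ fun j _ => Tendsto.const_mul _ ?_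
    obtain ⟨t1, t2, t3⟩ := tendsto_isSaddle hu hb (hm j) (hX j)
    have t0 : Tendsto (fun b' => b' - b) (𝓝 b) (𝓝 (b - b)) := tendsto_id.sub_const b
    have d2 := (t2.sub_const (k * y j)).abs
    have d3 := (t3.sub_const (k * y j)).abs
    have x2 := (Real.continuous_exp.tendsto _).comp (t0.mul d2)
    have x3 := (Real.continuous_exp.tendsto _).comp (t0.mul d3)
    exact (t1.mul (d2.mul x2)).add ((t1.const_sub 1).mul (d3.mul x3))
  have h1u : 0 < 1 - u := by linarith [hu.2]
  -- Optimality of `b` is compared with a convexity-type upper bound for the value at `b'` that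
  -- involves the saddle at `b'`. Dividing by `b' - b` on either side and letting `b' → b`, with
  -- continuity of the saddle, replaces differentiation of the value.
  have hineq : ∀ b' ∈ Ioo (0 : ℝ) 1, (b' - b) * (ε * k) ≤ (b' - b) * D b' := by
    intro b' hb'
    have h1 : outerObj y h k ε (-(k * b)) u ≤ outerObj y h k ε (-(k * b')) u := by
      rw [he]
      exact nestedValue_le (neg_nonpos.2 (mul_pos hk hb'.1).le) ⟨hu.1.le, hu.2.le⟩
    rw [outerObj_saddle hk hy hh hu hS, outerObj_saddle hk hy hh hu (fun j => hX j b' hb'),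
      EReal.coe_le_coe_iff] at h1
    have h2 : ∑ j, (h j : ℝ) * Real.log (aff u (poi (k * y j))
        (mix b' (k * y j) (X j b').1 (X j b').2.1 (X j b').2.2)) ≤
        ∑ j, (h j : ℝ) * Real.log (aff u (poi (k * y j)) (mix b (k * y j) (w j) (l₁ j) (l₂ j))) +
          (1 - u) * ((b' - b) * D b') := by
      rw [hD, Finset.mul_sum, Finset.mul_sum, ← Finset.sum_add_distrib]
      refine Finset.sum_le_sum fun j _ => ?_
      have := mul_le_mul_of_nonneg_left (log_aff_mix_le hu (hm j) (hS j) (hX j b' hb'))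
        (Nat.cast_nonneg (α := ℝ) (h j))
      refine this.trans (le_of_eq ?_)
      ring
    have h3 : (1 - u) * ((b' - b) * (ε * k)) ≤ (1 - u) * ((b' - b) * D b') := by linarith
    exact le_of_mul_le_mul_left h3 h1u
  rw [← hDb]
  refine le_antisymm ?_ ?_
  · refine le_of_tendsto (hlim.mono_left (nhdsWithin_le_nhds (s := Iio b))) ?_
    filter_upwards [self_mem_nhdsWithin, nhdsWithin_le_nhds (Ioo_mem_nhds hb.1 hb.2)] with b' h1 h2
    have h3 : b' < b := h1
    exact (mul_le_mul_left_of_neg (by linarith)).1 (hineq b' h2)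
  · refine ge_of_tendsto (hlim.mono_left (nhdsWithin_le_nhds (s := Ioi b))) ?_
    filter_upwards [self_mem_nhdsWithin, nhdsWithin_le_nhds (Ioo_mem_nhds hb.1 hb.2)] with b' h1 h2
    have h3 : b < b' := h1
    exact le_of_mul_le_mul_left (hineq b' h2) (by linarith)

/-- Stationarity in `u`. -/
theorem sum_mean_log_eq (hk : 0 < k) (hy : ∀ j, 0 < y j)
    (hu : u ∈ Ioo (0 : ℝ) 1) (hb : b ∈ Ioo (0 : ℝ) 1) (hh : ∀ j, 0 < h j)
    (hS : ∀ j, IsSaddle u b (k * y j) (w j) (l₁ j) (l₂ j))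
    (he : outerObj y h k ε (-(k * b)) u = nestedValue y h k ε) :
    ∑ j, (h j : ℝ) * ((∑' i, Real.log (mix b (k * y j) (w j) (l₁ j) (l₂ j) i / poi (k * y j) i) *
      (Real.exp ((1 - u) * Real.log (mix b (k * y j) (w j) (l₁ j) (l₂ j) i / poi (k * y j) i)) *
        poi (k * y j) i)) / aff u (poi (k * y j)) (mix b (k * y j) (w j) (l₁ j) (l₂ j))) =
      ε * (k * b) := by
  have hm := fun j => mul_pos hk (hy j)
  have hp := fun j => poi_pos (hm j)
  have hM := fun j => (hS j).mix_pos
  set K : J → ℕ → ℝ := fun j i =>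
    Real.log (mix b (k * y j) (w j) (l₁ j) (l₂ j) i / poi (k * y j) i) with hK
  set F : J → ℝ := fun j => aff u (poi (k * y j)) (mix b (k * y j) (w j) (l₁ j) (l₂ j)) with hF
  have hF0 : ∀ j, 0 < F j := fun j => (hS j).aff_pos hu (hm j)
  set G : J → ℝ → ℝ := fun j s => ∑' i, Real.exp (s * K j i) * poi (k * y j) i with hG
  have hGF : ∀ j, G j (1 - u) = F j := fun j => by
    rw [hG]; dsimp only
    rw [tsum_exp_eq_aff (hM j) (hp j), sub_sub_cancel]
  have h1u : 1 - u ∈ Ioo (0 : ℝ) 1 := ⟨by linarith [hu.2], by linarith [hu.1]⟩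
  have hGd : ∀ j, HasDerivAt (G j) (∑' i, K j i * (Real.exp ((1 - u) * K j i) * poi (k * y j) i))
      (1 - u) := fun j =>
    (hasDerivAt_tsum_exp_mul_log (hM j) (hp j) (summable_poi _) summable_mix h1u).1
  set T : J → ℝ := fun j => ∑' i, K j i * (Real.exp ((1 - u) * K j i) * poi (k * y j) i) with hT
  -- `U v` bounds the objective at `v` through the trial table `κ = (u / v) K`. Since `v κ = u K`,
  -- the supremum term is unchanged, while `(1 - v) κ = (u / v - u) K`. The bound is exact at `v =
  -- u`, so `U` has a local minimum there.
  set U : ℝ → ℝ := fun v => ε * (-(k * b)) * (1 - v) + ∑ j, (h j : ℝ) *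
    (v * Real.log (G j (u / v - u)) + (1 - v) * Real.log (F j)) with hU
  have hUu : ((U u : ℝ) : EReal) = nestedValue y h k ε := by
    rw [← he, outerObj_saddle hk hy hh hu hS]
    congr 1
    rw [hU]; dsimp only
    rw [div_self hu.1.ne']
    simp only [hGF]
    congr 1
    exact Finset.sum_congr rfl fun j _ => by ring
  have hpoint : HasDerivAt (fun v : ℝ => u / v - u) (-(1 / u)) u := by
    refine (((hasDerivAt_inv hu.1.ne').const_mul u).sub_const u).congr_deriv ?_
    have := hu.1.ne'
    field_simp
  have hUd : HasDerivAt U (ε * (k * b) - ∑ j, (h j : ℝ) * (T j / F j)) u := by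
    have h1 : HasDerivAt (fun v : ℝ => ε * (-(k * b)) * (1 - v)) (ε * (k * b)) u := by
      refine (((hasDerivAt_id u).const_sub 1).const_mul (ε * (-(k * b)))).congr_deriv ?_
      ring
    have h2 : ∀ j, HasDerivAt (fun v : ℝ => (h j : ℝ) *
        (v * Real.log (G j (u / v - u)) + (1 - v) * Real.log (F j)))
        (-((h j : ℝ) * (T j / F j))) u := by
      intro j
      have e0 : u / u - u = 1 - u := by rw [div_self hu.1.ne']
      have h3 : HasDerivAt (fun v => G j (u / v - u)) (T j * -(1 / u)) u := by
        refine HasDerivAt.comp (h₂ := G j) u ?_ hpoint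
        rw [e0]; exact hGd j
      have h4 := h3.log (by rw [e0, hGF]; exact (hF0 j).ne')
      rw [e0, hGF] at h4
      refine ((((hasDerivAt_id u).fun_mul h4).fun_add
        (((hasDerivAt_id u).const_sub 1).mul_const (Real.log (F j)))).const_mul
          (h j : ℝ)).congr_deriv ?_
      have := hu.1.ne'
      have := (hF0 j).ne'
      simp only [id, e0, hGF]
      field_simp
      ring
    refine (h1.fun_add (HasDerivAt.fun_sum fun j _ => h2 j)).congr_deriv ?_
    rw [Finset.sum_neg_distrib]; ring
  have hmin : IsLocalMin U u := by
    have ev1 : ∀ᶠ v in 𝓝 u, v ∈ Ioo (0 : ℝ) 1 := Ioo_mem_nhds hu.1 hu.2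
    have ev2 : ∀ᶠ v in 𝓝 u, u / v - u ∈ Ioo (0 : ℝ) 1 := by
      refine hpoint.continuousAt.eventually (Ioo_mem_nhds ?_ ?_)
      · dsimp only; rw [div_self hu.1.ne']; exact h1u.1
      · dsimp only; rw [div_self hu.1.ne']; exact h1u.2
    filter_upwards [ev1, ev2] with v hv1 hv2
    rw [← EReal.coe_le_coe_iff, hUu]
    refine (nestedValue_le (neg_nonpos.2 (mul_pos hk hb.1).le) ⟨hv1.1.le, hv1.2.le⟩).trans ?_
    unfold outerObj
    rw [hU, EReal.coe_add, ereal_coe_finset_sum]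
    refine add_le_add_right (Finset.sum_le_sum fun j _ =>
      (iInf_le _ (fun i => u / v * K j i)).trans ?_) _
    have hv0 := hv1.1.ne'
    have e1 : ∀ i, Real.exp ((1 - v) * (u / v * K j i)) * poi (k * y j) i =
        Real.exp ((u / v - u) * K j i) * poi (k * y j) i := by
      intro i; congr 2; field_simp
    refine innerObj_le hk.le (hy j).le ⟨hv1.1.le, hv1.2.le⟩ (B := G j (u / v - u)) ?_
      (s := Real.log (F j)) fun x hx => ?_
    · simp only [e1]
      exact (summable_exp_mul_log (hM j) (hp j) (summable_poi _) summable_mix hv2).hasSum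
    · have e2 : ∀ i, Real.exp (-v * (u / v * K j i)) * poi (k * x) i =
          Real.exp (-u * K j i) * poi (k * x) i := by
        intro i; congr 2; field_simp
      simp only [e2]
      have := (hS j).sup_le (κ := K j) (c := 0) hk (hy j) hu (fun i => (add_zero _).symm) hx
      rwa [mul_zero, zero_add] at this
  have := hmin.hasDerivAt_eq_zero hUd
  linarith

end

/-! ### The explicit value and its partial derivatives -/

/-- The normalizing factor of a mixture of tilted Poisson weights. -/
noncomputable def mixMass (b m w l₁ l₂ : ℝ) : ℝ :=
  w * Real.exp (b * |l₁ - m|) + (1 - w) * Real.exp (b * |l₂ - m|)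

/-- The weight of the first Poisson distribution in a mixture of tilted Poisson weights. -/
noncomputable def mixFreq (b m w l₁ l₂ : ℝ) : ℝ :=
  w * Real.exp (b * |l₁ - m|) / mixMass b m w l₁ l₂

section
variable {k y b u v m w r l₁ l₂ : ℝ}

theorem mixMass_pos (hw : w ∈ Ioo (0 : ℝ) 1) : 0 < mixMass b m w l₁ l₂ := by
  have h0 := hw.1
  have h1 : 0 < 1 - w := by linarith [hw.2]
  unfold mixMass; positivity

theorem mixFreq_mem (hw : w ∈ Ioo (0 : ℝ) 1) : mixFreq b m w l₁ l₂ ∈ Ioo (0 : ℝ) 1 := by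
  have hN := mixMass_pos (b := b) (m := m) (l₁ := l₁) (l₂ := l₂) hw
  have h0 := hw.1
  have h1 : 0 < 1 - w := by linarith [hw.2]
  refine ⟨by unfold mixFreq; positivity, ?_⟩
  unfold mixFreq
  rw [div_lt_one hN]
  unfold mixMass
  have : 0 < (1 - w) * Real.exp (b * |l₂ - m|) := by positivity
  linarith

theorem one_sub_mixFreq (hw : w ∈ Ioo (0 : ℝ) 1) : 1 - mixFreq b m w l₁ l₂ =
    (1 - w) * Real.exp (b * |l₂ - m|) / mixMass b m w l₁ l₂ := by
  have hN := mixMass_pos (b := b) (m := m) (l₁ := l₁) (l₂ := l₂) hw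
  unfold mixFreq
  rw [eq_div_iff hN.ne', sub_mul, div_mul_cancel₀ _ hN.ne', one_mul]
  unfold mixMass; ring

/-- Passing from frequencies to tilted weights and back. -/
theorem mixFreq_neg_mixFreq (hw : w ∈ Ioo (0 : ℝ) 1) :
    mixMass (-b) m (mixFreq b m w l₁ l₂) l₁ l₂ = (mixMass b m w l₁ l₂)⁻¹ ∧
      mixFreq (-b) m (mixFreq b m w l₁ l₂) l₁ l₂ = w := by
  have hN := mixMass_pos (b := b) (m := m) (l₁ := l₁) (l₂ := l₂) hw
  have hE : ∀ x : ℝ, Real.exp (-b * x) = (Real.exp (b * x))⁻¹ := fun x => by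
    rw [neg_mul, Real.exp_neg]
  have h1 : mixMass (-b) m (mixFreq b m w l₁ l₂) l₁ l₂ = (mixMass b m w l₁ l₂)⁻¹ := by
    rw [mixMass, one_sub_mixFreq hw, mixFreq, hE, hE]
    have := (Real.exp_pos (b * |l₁ - m|)).ne'
    have := (Real.exp_pos (b * |l₂ - m|)).ne'
    field_simp; ring
  refine ⟨h1, ?_⟩
  rw [mixFreq, h1, mixFreq, hE]
  have := (Real.exp_pos (b * |l₁ - m|)).ne'
  field_simp

theorem mix_mixFreq (hr : r ∈ Ioo (0 : ℝ) 1) (i : ℕ) :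
    mix b m (mixFreq (-b) m r l₁ l₂) l₁ l₂ i =
      (r * poi l₁ i + (1 - r) * poi l₂ i) / mixMass (-b) m r l₁ l₂ := by
  have hN := mixMass_pos (b := -b) (m := m) (l₁ := l₁) (l₂ := l₂) hr
  have hE : ∀ x : ℝ, Real.exp (-b * x) = (Real.exp (b * x))⁻¹ := fun x => by
    rw [neg_mul, Real.exp_neg]
  rw [mix, one_sub_mixFreq hr, mixFreq, hE, hE, tilt, tilt]
  have := (Real.exp_pos (b * |l₁ - m|)).ne'
  have := (Real.exp_pos (b * |l₂ - m|)).ne'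
  field_simp

theorem exp_dist_eq (hk : 0 < k) (l : ℝ) :
    Real.exp (-(k * b) * |l / k - y|) = Real.exp (-b * |l - k * y|) := by
  have : l - k * y = k * (l / k - y) := by field_simp
  rw [this, abs_mul, abs_of_pos hk]; congr 1; ring

theorem explicit_mass_eq (hk : 0 < k) : r * Real.exp (-(k * b) * |l₁ / k - y|) +
    (1 - r) * Real.exp (-(k * b) * |l₂ / k - y|) = mixMass (-b) (k * y) r l₁ l₂ := by
  rw [exp_dist_eq hk, exp_dist_eq hk, mixMass]

theorem explicit_term_eq (hk : 0 < k) (hr : r ∈ Ioo (0 : ℝ) 1) (h1 : 0 ≤ l₁)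
    (h2 : 0 < l₂) :
    (∑' i, (r * poi (k * (l₁ / k)) i + (1 - r) * poi (k * (l₂ / k)) i) ^ (1 - v) *
      poi (k * y) i ^ v) / (r * Real.exp (-(k * b) * |l₁ / k - y|) +
        (1 - r) * Real.exp (-(k * b) * |l₂ / k - y|)) ^ (1 - v) =
      aff v (poi (k * y)) (mix b (k * y) (mixFreq (-b) (k * y) r l₁ l₂) l₁ l₂) := by
  have hN := mixMass_pos (b := -b) (m := k * y) (l₁ := l₁) (l₂ := l₂) hr
  rw [explicit_mass_eq hk, mul_div_cancel₀ _ hk.ne', mul_div_cancel₀ _ hk.ne', div_eq_inv_mul,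
    ← tsum_mul_left]
  unfold aff
  refine tsum_congr fun i => ?_
  have h1r : 0 < 1 - r := by linarith [hr.2]
  rw [mix_mixFreq hr, Real.div_rpow (add_nonneg (mul_nonneg hr.1.le (poi_nonneg h1 i))
    (mul_nonneg h1r.le (poi_nonneg h2.le i))) hN.le]
  ring

/-- The affinity of a saddle mixture is stationary in the weight. -/
theorem IsSaddle.hasDerivAt_aff (hu : u ∈ Ioo (0 : ℝ) 1) (hm : 0 < m)
    (hS : IsSaddle u b m w l₁ l₂) :
    HasDerivAt (fun w' => aff u (poi m) (mix b m w' l₁ l₂)) 0 w := by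
  have hw0 := hS.w_mem.1
  have hw1 : 0 < 1 - w := by linarith [hS.w_mem.2]
  have hM := hS.mix_pos
  have hp := poi_pos hm
  have ht1 := tilt_nonneg (b := b) (m := m) hS.l₁_nonneg
  have ht2 := tilt_nonneg (b := b) (m := m) hS.l₂_pos.le
  -- `c` bounds both weights from below, so the difference of the two components is at most `mix /
  -- c`. Together with `mix / 2 ≤ mix` for nearby weights, this dominates the termwise derivatives
  -- by the affinity series.
  set c := min w (1 - w) with hc
  have hc0 : 0 < c := lt_min hw0 hw1
  set I := Ioo (w / 2) ((1 + w) / 2) with hI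
  have hwI : w ∈ I := ⟨by linarith, by linarith⟩
  have hhalf : ∀ w' ∈ I, ∀ i, mix b m w l₁ l₂ i / 2 ≤ mix b m w' l₁ l₂ i := by
    intro w' hw' i
    unfold mix
    have e1 := mul_le_mul_of_nonneg_right hw'.1.le (ht1 i)
    have e2 : (1 - w) / 2 ≤ 1 - w' := by linarith [hw'.2]
    have e3 := mul_le_mul_of_nonneg_right e2 (ht2 i)
    linarith
  have sF := summable_aff hu (fun i => (hp i).le) (fun i => (hM i).le) (summable_poi _)
    (summable_mix (b := b) (m := m) (w := w) (l₁ := l₁) (l₂ := l₂))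
  have h1u : 0 < 1 - u := by linarith [hu.2]
  have hd : HasDerivAt (fun w' => ∑' i, mix b m w' l₁ l₂ i ^ (1 - u) * poi m i ^ u)
      (∑' i, (tilt b m l₁ i - tilt b m l₂ i) * (1 - u) * mix b m w l₁ l₂ i ^ (1 - u - 1) *
        poi m i ^ u) w := by
    refine hasDerivAt_tsum_of_isPreconnected (t := I) (g := fun i w' =>
      mix b m w' l₁ l₂ i ^ (1 - u) * poi m i ^ u) (g' := fun i w' =>
        (tilt b m l₁ i - tilt b m l₂ i) * (1 - u) * mix b m w' l₁ l₂ i ^ (1 - u - 1) * poi m i ^ u)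
      (sF.mul_left (c⁻¹ * (1 - u) * 2⁻¹ ^ (-u))) isOpen_Ioo isPreconnected_Ioo (fun i w' hw' => ?_)
      (fun i w' hw' => ?_) hwI sF hwI
    · have hpos : 0 < mix b m w' l₁ l₂ i := (half_pos (hM i)).trans_le (hhalf w' hw' i)
      have hdm : HasDerivAt (fun w' => mix b m w' l₁ l₂ i) (tilt b m l₁ i - tilt b m l₂ i) w' := by
        refine (((hasDerivAt_id w').mul_const _).add
          (((hasDerivAt_id w').const_sub 1).mul_const _)).congr_deriv ?_
        ring
      exact (hdm.rpow_const (Or.inl hpos.ne')).mul_const _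
    · have hpos : 0 < mix b m w' l₁ l₂ i := (half_pos (hM i)).trans_le (hhalf w' hw' i)
      have e1 : |tilt b m l₁ i - tilt b m l₂ i| ≤ c⁻¹ * mix b m w l₁ l₂ i := by
        rw [inv_mul_eq_div, le_div_iff₀ hc0]
        have q1 := mul_le_mul_of_nonneg_right (min_le_left w (1 - w)) (ht1 i)
        have q2 := mul_le_mul_of_nonneg_right (min_le_right w (1 - w)) (ht2 i)
        have q3 : |tilt b m l₁ i - tilt b m l₂ i| ≤ tilt b m l₁ i + tilt b m l₂ i :=
          abs_sub_le_iff.2 ⟨by linarith [ht1 i, ht2 i], by linarith [ht1 i, ht2 i]⟩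
        have q4 := mul_le_mul_of_nonneg_right q3 hc0.le
        unfold mix
        rw [← hc] at q1 q2
        linarith
      have e2 : mix b m w' l₁ l₂ i ^ (-u) ≤ 2⁻¹ ^ (-u) * mix b m w l₁ l₂ i ^ (-u) := by
        rw [← Real.mul_rpow (by norm_num) (hM i).le]
        refine Real.rpow_le_rpow_of_nonpos (mul_pos (by norm_num) (hM i)) ?_ (by linarith [hu.1])
        have := hhalf w' hw' i
        linarith
      have e3 : mix b m w l₁ l₂ i ^ (1 - u) = mix b m w l₁ l₂ i * mix b m w l₁ l₂ i ^ (-u) := by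
        rw [sub_eq_add_neg, Real.rpow_add (hM i), Real.rpow_one]
      have hpu : 0 ≤ poi m i ^ u := Real.rpow_nonneg (hp i).le _
      rw [norm_mul, norm_mul, norm_mul, Real.norm_eq_abs, Real.norm_of_nonneg h1u.le,
        Real.norm_of_nonneg hpu, show 1 - u - 1 = -u by ring,
        Real.norm_of_nonneg (Real.rpow_nonneg hpos.le _), e3]
      calc _ ≤ c⁻¹ * mix b m w l₁ l₂ i * (1 - u) * (2⁻¹ ^ (-u) * mix b m w l₁ l₂ i ^ (-u)) *
            poi m i ^ u := by
            have : 0 ≤ c⁻¹ * mix b m w l₁ l₂ i := by have := (hM i).le; positivity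
            gcongr
        _ = _ := by ring
  have hmax : IsLocalMax (fun w' => aff u (poi m) (mix b m w' l₁ l₂)) w := by
    filter_upwards [Ioo_mem_nhds hS.w_mem.1 hS.w_mem.2] with w' hw'
    exact hS.aff_le hu hm ⟨hw'.1.le, hw'.2.le⟩ hS.l₁_nonneg hS.l₂_pos.le
  have h0 := hmax.hasDerivAt_eq_zero hd
  rw [h0] at hd
  exact hd

theorem twoPointCoeff_eq (hk : 0 < k) (hy : 0 < y) (hS : IsSaddle u b (k * y) w l₁ l₂) (i : ℕ) :
    twoPointCoeff k y (mixFreq b (k * y) w l₁ l₂) (l₁ / k) (l₂ / k) i =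
      Real.log (mix b (k * y) w l₁ l₂ i / poi (k * y) i) +
        -Real.log (mixMass b (k * y) w l₁ l₂) := by
  obtain ⟨e1, e2⟩ := mixFreq_neg_mixFreq (b := b) (m := k * y) (l₁ := l₁) (l₂ := l₂) hS.w_mem
  have hN := mixMass_pos (b := b) (m := k * y) (l₁ := l₁) (l₂ := l₂) hS.w_mem
  have h1 := mix_mixFreq (b := b) (m := k * y) (l₁ := l₁) (l₂ := l₂)
    (mixFreq_mem (b := b) (m := k * y) (l₁ := l₁) (l₂ := l₂) hS.w_mem) i
  rw [e1, e2, div_inv_eq_mul, ← div_eq_iff hN.ne'] at h1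
  unfold twoPointCoeff
  rw [mul_div_cancel₀ _ hk.ne', mul_div_cancel₀ _ hk.ne', ← h1,
    Real.log_div (div_pos (hS.mix_pos i) hN).ne' (poi_pos (mul_pos hk hy) i).ne',
    Real.log_div (hS.mix_pos i).ne' hN.ne',
    Real.log_div (hS.mix_pos i).ne' (poi_pos (mul_pos hk hy) i).ne']
  ring

end

section
variable {J : Type*} [Fintype J] {y : J → ℝ} {h : J → ℕ} {k ε u b : ℝ} {w l₁ l₂ : J → ℝ}

theorem explicitValue_eq (hk : 0 < k) (hS : ∀ j, IsSaddle u b (k * y j) (w j) (l₁ j) (l₂ j))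
    (v : ℝ) : explicitValue y h k ε (-(k * b)) v (fun j => mixFreq b (k * y j) (w j) (l₁ j) (l₂ j))
      (fun j => l₁ j / k) (fun j => l₂ j / k) =
      ε * (-(k * b)) * (1 - v) + ∑ j, (h j : ℝ) *
        Real.log (aff v (poi (k * y j)) (mix b (k * y j) (w j) (l₁ j) (l₂ j))) := by
  unfold explicitValue
  congr 1
  refine Finset.sum_congr rfl fun j _ => ?_
  rw [explicit_term_eq hk (mixFreq_mem (hS j).w_mem) (hS j).l₁_nonneg (hS j).l₂_pos,
    (mixFreq_neg_mixFreq (hS j).w_mem).2]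

/-- Only the penalty and the logarithm of the normalizer depend on `α`. The normalized terms of that
logarithmic derivative have weights `w` and `1 - w`, so it is the mean distance, which `hdist`
balances against `ε`. -/
theorem hasDerivAt_explicitValue_alpha (hk : 0 < k) (hy : ∀ j, 0 < y j)
    (hu : u ∈ Ioo (0 : ℝ) 1) (hS : ∀ j, IsSaddle u b (k * y j) (w j) (l₁ j) (l₂ j))
    (hdist : ∑ j, (h j : ℝ) * (w j * |l₁ j - k * y j| + (1 - w j) * |l₂ j - k * y j|) = ε * k) :
    HasDerivAt (fun a => explicitValue y h k ε a u
      (fun j => mixFreq b (k * y j) (w j) (l₁ j) (l₂ j)) (fun j => l₁ j / k) (fun j => l₂ j / k)) 0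
      (-(k * b)) := by
  have hterm : ∀ j, HasDerivAt (fun a : ℝ => (h j : ℝ) * Real.log
      ((∑' i, (mixFreq b (k * y j) (w j) (l₁ j) (l₂ j) * poi (k * (l₁ j / k)) i +
        (1 - mixFreq b (k * y j) (w j) (l₁ j) (l₂ j)) * poi (k * (l₂ j / k)) i) ^ (1 - u) *
          (poi (k * y j) i) ^ u) /
      (mixFreq b (k * y j) (w j) (l₁ j) (l₂ j) * Real.exp (a * |l₁ j / k - y j|) +
        (1 - mixFreq b (k * y j) (w j) (l₁ j) (l₂ j)) * Real.exp (a * |l₂ j / k - y j|)) ^ (1 - u)))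
      (-(1 - u) / k * (h j * (w j * |l₁ j - k * y j| + (1 - w j) * |l₂ j - k * y j|)))
      (-(k * b)) := by
    intro j
    have hw := (hS j).w_mem
    have hq := mixFreq_mem (b := b) (m := k * y j) (l₁ := l₁ j) (l₂ := l₂ j) hw
    have hT := explicit_term_eq (b := b) (v := u) (y := y j) hk hq (hS j).l₁_nonneg (hS j).l₂_pos
    rw [(mixFreq_neg_mixFreq hw).2] at hT
    have hmass := explicit_mass_eq (b := b) (y := y j) (l₁ := l₁ j) (l₂ := l₂ j)
      (r := mixFreq b (k * y j) (w j) (l₁ j) (l₂ j)) hk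
    rw [(mixFreq_neg_mixFreq hw).1] at hmass
    have hN := mixMass_pos (b := b) (m := k * y j) (l₁ := l₁ j) (l₂ := l₂ j) hw
    have hF := (hS j).aff_pos hu (mul_pos hk (hy j))
    have h1q := one_sub_mixFreq (b := b) (m := k * y j) (l₁ := l₁ j) (l₂ := l₂ j) hw
    have hqd : mixFreq b (k * y j) (w j) (l₁ j) (l₂ j) = w j * Real.exp (b * |l₁ j - k * y j|) /
      mixMass b (k * y j) (w j) (l₁ j) (l₂ j) := rfl
    set q := mixFreq b (k * y j) (w j) (l₁ j) (l₂ j) with hqdef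
    have hq1 : 0 < 1 - q := by linarith [hq.2]
    set S := ∑' i, (q * poi (k * (l₁ j / k)) i + (1 - q) * poi (k * (l₂ j / k)) i) ^ (1 - u) *
          (poi (k * y j) i) ^ u with hSd
    have hNpos : ∀ a : ℝ, 0 < q * Real.exp (a * |l₁ j / k - y j|) +
        (1 - q) * Real.exp (a * |l₂ j / k - y j|) := fun a => by have := hq.1; positivity
    have hS0 : S ≠ 0 := by
      intro h0
      rw [h0, zero_div] at hT
      exact hF.ne hT
    have e : ∀ a : ℝ, (h j : ℝ) * Real.log (S / (q * Real.exp (a * |l₁ j / k - y j|) +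
        (1 - q) * Real.exp (a * |l₂ j / k - y j|)) ^ (1 - u)) = h j * (Real.log S - (1 - u) *
          Real.log (q * Real.exp (a * |l₁ j / k - y j|) +
            (1 - q) * Real.exp (a * |l₂ j / k - y j|))) := fun a => by
      rw [Real.log_div hS0 (Real.rpow_pos_of_pos (hNpos a) _).ne', Real.log_rpow (hNpos a)]
    simp only [e]
    have hexp : ∀ d : ℝ, HasDerivAt (fun a : ℝ => Real.exp (a * d))
        (Real.exp (-(k * b) * d) * d) (-(k * b)) := fun d => by
      simpa using ((hasDerivAt_id (-(k * b))).mul_const d).exp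
    have hd := ((((((hexp |l₁ j / k - y j|).const_mul q).fun_add
      ((hexp |l₂ j / k - y j|).const_mul (1 - q))).log (hNpos _).ne').const_mul
        (1 - u)).const_sub (Real.log S)).const_mul (h j : ℝ)
    refine hd.congr_deriv ?_
    have hl : ∀ l : ℝ, |l / k - y j| = |l - k * y j| / k := fun l => by
      have : l / k - y j = (l - k * y j) / k := by field_simp
      rw [this, abs_div, abs_of_pos hk]
    rw [hmass, exp_dist_eq hk, exp_dist_eq hk, h1q, hqd, neg_mul b, neg_mul b, Real.exp_neg,
      Real.exp_neg, hl, hl]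
    have := (Real.exp_pos (b * |l₁ j - k * y j|)).ne'
    have := (Real.exp_pos (b * |l₂ j - k * y j|)).ne'
    field_simp
  have h1 : HasDerivAt (fun a : ℝ => ε * a * (1 - u)) (ε * (1 - u)) (-(k * b)) := by
    simpa using ((hasDerivAt_id (-(k * b))).const_mul ε).mul_const (1 - u)
  unfold explicitValue
  refine (h1.fun_add (HasDerivAt.fun_sum fun j _ => hterm j)).congr_deriv ?_
  rw [← Finset.mul_sum, hdist]
  field_simp
  ring

/-- At fixed `α`, `q` and locations the mixture does not change with the exponent, so only the
logarithmic derivative of the affinity appears; `hmean` is its stationarity. -/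
theorem hasDerivAt_explicitValue_u (hk : 0 < k) (hy : ∀ j, 0 < y j)
    (hu : u ∈ Ioo (0 : ℝ) 1) (hS : ∀ j, IsSaddle u b (k * y j) (w j) (l₁ j) (l₂ j))
    (hmean : ∑ j, (h j : ℝ) *
      ((∑' i, Real.log (mix b (k * y j) (w j) (l₁ j) (l₂ j) i / poi (k * y j) i) *
      (Real.exp ((1 - u) * Real.log (mix b (k * y j) (w j) (l₁ j) (l₂ j) i / poi (k * y j) i)) *
        poi (k * y j) i)) / aff u (poi (k * y j)) (mix b (k * y j) (w j) (l₁ j) (l₂ j))) =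
      ε * (k * b)) :
    HasDerivAt (fun v => explicitValue y h k ε (-(k * b)) v
      (fun j => mixFreq b (k * y j) (w j) (l₁ j) (l₂ j)) (fun j => l₁ j / k) (fun j => l₂ j / k)) 0
      u := by
  simp only [explicitValue_eq hk hS]
  have h1u : 1 - u ∈ Ioo (0 : ℝ) 1 := ⟨by linarith [hu.2], by linarith [hu.1]⟩
  have h1 : HasDerivAt (fun v : ℝ => ε * (-(k * b)) * (1 - v)) (ε * (k * b)) u := by
    refine (((hasDerivAt_id u).const_sub 1).const_mul (ε * (-(k * b)))).congr_deriv ?_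
    ring
  have h2 : ∀ j, HasDerivAt (fun v => (h j : ℝ) * Real.log (aff v (poi (k * y j))
      (mix b (k * y j) (w j) (l₁ j) (l₂ j)))) (-((h j : ℝ) *
      ((∑' i, Real.log (mix b (k * y j) (w j) (l₁ j) (l₂ j) i / poi (k * y j) i) *
      (Real.exp ((1 - u) * Real.log (mix b (k * y j) (w j) (l₁ j) (l₂ j) i / poi (k * y j) i)) *
        poi (k * y j) i)) / aff u (poi (k * y j)) (mix b (k * y j) (w j) (l₁ j) (l₂ j))))) u := by
    intro j
    have hp := poi_pos (mul_pos hk (hy j))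
    have hG := (hasDerivAt_tsum_exp_mul_log (hS j).mix_pos hp (summable_poi _) summable_mix h1u).1
    have hc := HasDerivAt.comp u hG ((hasDerivAt_id u).const_sub 1)
    have e : (fun v => aff v (poi (k * y j)) (mix b (k * y j) (w j) (l₁ j) (l₂ j))) =
        (fun t => ∑' i, Real.exp (t * Real.log (mix b (k * y j) (w j) (l₁ j) (l₂ j) i /
          poi (k * y j) i)) * poi (k * y j) i) ∘ fun v => 1 - v := by
      funext v
      rw [Function.comp_apply, tsum_exp_eq_aff (hS j).mix_pos hp, sub_sub_cancel]
    have hc' := hc.congr_of_eventuallyEq (Eventually.of_forall fun v => congrFun e v)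
    refine ((hc'.log ((hS j).aff_pos hu (mul_pos hk (hy j))).ne').const_mul
      (h j : ℝ)).congr_deriv ?_
    ring
  refine (h1.fun_add (HasDerivAt.fun_sum fun j _ => h2 j)).congr_deriv ?_
  rw [Finset.sum_neg_distrib, hmean]; ring

/-- Varying `q` is varying the tilted weight `w` through `mixFreq`. The affinity is stationary in
`w`, so the chain rule gives `0` whatever the derivative of the reparametrization is. -/
theorem hasDerivAt_explicitValue_q [DecidableEq J] (hk : 0 < k) (hy : ∀ j, 0 < y j)
    (hu : u ∈ Ioo (0 : ℝ) 1) (hS : ∀ j, IsSaddle u b (k * y j) (w j) (l₁ j) (l₂ j)) (j : J) :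
    HasDerivAt (fun r => explicitValue y h k ε (-(k * b)) u
      (Function.update (fun j => mixFreq b (k * y j) (w j) (l₁ j) (l₂ j)) j r)
      (fun j => l₁ j / k) (fun j => l₂ j / k)) 0 (mixFreq b (k * y j) (w j) (l₁ j) (l₂ j)) := by
  have hw := (hS j).w_mem
  have hq := mixFreq_mem (b := b) (m := k * y j) (l₁ := l₁ j) (l₂ := l₂ j) hw
  have hmain : HasDerivAt (fun r => (h j : ℝ) * Real.log
      ((∑' i, (r * poi (k * (l₁ j / k)) i + (1 - r) * poi (k * (l₂ j / k)) i) ^ (1 - u) *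
          (poi (k * y j) i) ^ u) /
      (r * Real.exp (-(k * b) * |l₁ j / k - y j|) +
        (1 - r) * Real.exp (-(k * b) * |l₂ j / k - y j|)) ^ (1 - u))) 0
      (mixFreq b (k * y j) (w j) (l₁ j) (l₂ j)) := by
    have hd : HasDerivAt (fun r => mixFreq (-b) (k * y j) r (l₁ j) (l₂ j))
        (deriv (fun r => mixFreq (-b) (k * y j) r (l₁ j) (l₂ j))
          (mixFreq b (k * y j) (w j) (l₁ j) (l₂ j))) (mixFreq b (k * y j) (w j) (l₁ j) (l₂ j)) := by
      have hN := mixMass_pos (b := -b) (m := k * y j) (l₁ := l₁ j) (l₂ := l₂ j) hq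
      refine DifferentiableAt.hasDerivAt ?_
      unfold mixFreq at hN ⊢
      refine DifferentiableAt.div (by fun_prop) ?_ hN.ne'
      unfold mixMass
      fun_prop
    have hA := (hS j).hasDerivAt_aff hu (mul_pos hk (hy j))
    have e := (mixFreq_neg_mixFreq (b := b) (m := k * y j) (l₁ := l₁ j) (l₂ := l₂ j) hw).2
    rw [← e] at hA
    have hc := HasDerivAt.comp (h := fun r => mixFreq (-b) (k * y j) r (l₁ j) (l₂ j))
      (mixFreq b (k * y j) (w j) (l₁ j) (l₂ j)) hA hd
    have hl := (hc.log (by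
      rw [Function.comp_apply, e]
      exact ((hS j).aff_pos hu (mul_pos hk (hy j))).ne')).const_mul (h j : ℝ)
    refine (hl.congr_deriv (by simp)).congr_of_eventuallyEq ?_
    filter_upwards [Ioo_mem_nhds hq.1 hq.2] with r hr
    rw [explicit_term_eq hk hr (hS j).l₁_nonneg (hS j).l₂_pos]
    rfl
  unfold explicitValue
  refine HasDerivAt.const_add _ ?_
  rw [← Finset.sum_const_zero (s := (Finset.univ : Finset J))]
  refine HasDerivAt.fun_sum fun i _ => ?_
  by_cases hij : i = j
  · subst hij
    simpa only [Function.update_self] using hmain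
  · simp only [Function.update_of_ne hij]
    exact hasDerivAt_const _ _

end

/-! ### The value of the original program -/

section
variable {u b m w l₁ l₂ : ℝ}

/-- One half of the Gibbs variational principle, termwise. -/
theorem gibbs_term_le {X Y s : ℝ} (hX : 0 ≤ X) (h : X * Real.exp s = Y) : X * s ≤ Y - X := by
  have := mul_le_mul_of_nonneg_left (Real.add_one_le_exp s) hX
  linarith

/-- For a probability law `X`, `log ∑ e ^ v π` is at least the `X`-mean of `v` minus the relative
entropy of `X` to `π`. This is used for tilted laws `X₁`, `X₂` against `poi l₁`, `poi l₂` and for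
`X₀` against `poi m`. At a saddle `X₀` is the mixture of `X₁` and `X₂`, so the `v` terms cancel by
`hv` and only the entropies remain. -/
theorem IsSaddle.gibbs_le (hu : u ∈ Ioo (0 : ℝ) 1) (hm : 0 < m) (hS : IsSaddle u b m w l₁ l₂)
    {θ : ℝ} (hθ : θ ∈ Icc (0 : ℝ) 1) {v v' : ℕ → ℝ} (hv : ∀ i, (1 - θ) * v i + θ * v' i = 0)
    (s₁ : Summable fun i => Real.exp (v i) * poi l₁ i)
    (s₂ : Summable fun i => Real.exp (v i) * poi l₂ i)
    (s₀ : Summable fun i => Real.exp (v' i) * poi m i) :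
    (1 - θ) * (-(w * Real.log (∑' i, Real.exp (v i) * poi l₁ i) +
        (1 - w) * Real.log (∑' i, Real.exp (v i) * poi l₂ i)) +
        u * ((∑' i, Real.log (mix b m w l₁ l₂ i / poi m i) *
          (Real.exp ((1 - u) * Real.log (mix b m w l₁ l₂ i / poi m i)) * poi m i)) /
            aff u (poi m) (mix b m w l₁ l₂)) -
        b * (w * |l₁ - m| + (1 - w) * |l₂ - m|) + Real.log (aff u (poi m) (mix b m w l₁ l₂))) +
      θ * (-Real.log (∑' i, Real.exp (v' i) * poi m i) -
        (1 - u) * ((∑' i, Real.log (mix b m w l₁ l₂ i / poi m i) *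
          (Real.exp ((1 - u) * Real.log (mix b m w l₁ l₂ i / poi m i)) * poi m i)) /
            aff u (poi m) (mix b m w l₁ l₂)) +
        Real.log (aff u (poi m) (mix b m w l₁ l₂))) ≤ 0 := by
  have hp := poi_pos hm
  have hM := hS.mix_pos
  have hF := hS.aff_pos hu hm
  have h1u : 1 - u ∈ Ioo (0 : ℝ) 1 := ⟨by linarith [hu.2], by linarith [hu.1]⟩
  have sX₁ := hS.summable hu hm hS.l₁_nonneg
  have sX₂ := hS.summable hu hm hS.l₂_pos.le
  have hfe₁ : field u b m w l₁ l₂ l₁ = aff u (poi m) (mix b m w l₁ l₂) := hS.eq₁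
  have hfe₂ : field u b m w l₁ l₂ l₂ = aff u (poi m) (mix b m w l₁ l₂) := hS.eq₂
  have sK := (hasDerivAt_tsum_exp_mul_log hM hp (summable_poi _) summable_mix h1u).2
  have hA₁ := tsum_exp_mul_poi_pos hS.l₁_nonneg s₁
  have hA₂ := tsum_exp_mul_poi_pos hS.l₂_pos.le s₂
  have hA₀ := tsum_exp_mul_poi_pos hm.le s₀
  set F := aff u (poi m) (mix b m w l₁ l₂) with hFd
  set K : ℕ → ℝ := fun i => Real.log (mix b m w l₁ l₂ i / poi m i) with hK
  change Summable fun i => K i * (Real.exp ((1 - u) * K i) * poi m i) at sK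
  have hwt : ∀ i, wt u (poi m) (mix b m w l₁ l₂) i = Real.exp (-(u * K i)) := fun i => by
    unfold wt
    rw [Real.rpow_def_of_pos (div_pos (hM i) (hp i))]
    congr 1; simp only [hK]; ring
  set A₁ := ∑' i, Real.exp (v i) * poi l₁ i with hA₁d
  set A₂ := ∑' i, Real.exp (v i) * poi l₂ i with hA₂d
  set A₀ := ∑' i, Real.exp (v' i) * poi m i with hA₀d
  set T := (∑' i, K i * (Real.exp ((1 - u) * K i) * poi m i)) / F with hT
  set X₁ : ℕ → ℝ := fun i => wt u (poi m) (mix b m w l₁ l₂) i * tilt b m l₁ i / F with hX₁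
  set X₂ : ℕ → ℝ := fun i => wt u (poi m) (mix b m w l₁ l₂) i * tilt b m l₂ i / F with hX₂
  set X₀ : ℕ → ℝ := fun i => Real.exp ((1 - u) * K i) * poi m i / F with hX₀
  have hX : ∀ i, w * X₁ i + (1 - w) * X₂ i = X₀ i := by
    intro i
    have e1 : wt u (poi m) (mix b m w l₁ l₂) i * mix b m w l₁ l₂ i =
        Real.exp ((1 - u) * K i) * poi m i := by
      rw [wt_mul_self hp hM, hK, exp_log_div_mul (hM i) (hp i), sub_sub_cancel]
    simp only [hX₁, hX₂, hX₀]
    rw [← e1]; unfold mix; ring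
  have hsX₁ : HasSum X₁ 1 := hasSum_of_eq (sX₁.hasSum.div_const F) (fun _ => rfl)
    (by change 1 = field u b m w l₁ l₂ l₁ / F; rw [hfe₁, div_self hF.ne'])
  have hsX₂ : HasSum X₂ 1 := hasSum_of_eq (sX₂.hasSum.div_const F) (fun _ => rfl)
    (by change 1 = field u b m w l₁ l₂ l₂ / F; rw [hfe₂, div_self hF.ne'])
  have hsX₀ : HasSum X₀ 1 := hasSum_of_eq ((hsX₁.mul_left w).add (hsX₂.mul_left (1 - w)))
    (fun i => (hX i).symm) (by ring)
  have hsK : HasSum (fun i => K i * X₀ i) T := hasSum_of_eq (sK.hasSum.div_const F)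
    (fun i => by simp only [hX₀]; ring) rfl
  have hY₁ : HasSum (fun i => Real.exp (v i) * poi l₁ i / A₁) 1 :=
    hasSum_of_eq (s₁.hasSum.div_const A₁) (fun _ => rfl) (div_self hA₁.ne').symm
  have hY₂ : HasSum (fun i => Real.exp (v i) * poi l₂ i / A₂) 1 :=
    hasSum_of_eq (s₂.hasSum.div_const A₂) (fun _ => rfl) (div_self hA₂.ne').symm
  have hY₀ : HasSum (fun i => Real.exp (v' i) * poi m i / A₀) 1 :=
    hasSum_of_eq (s₀.hasSum.div_const A₀) (fun _ => rfl) (div_self hA₀.ne').symm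
  have hside : ∀ l A : ℝ, 0 ≤ l → 0 < A → ∀ i,
      wt u (poi m) (mix b m w l₁ l₂) i * tilt b m l i / F *
        (v i - Real.log A + u * K i - b * |l - m| + Real.log F) ≤
      Real.exp (v i) * poi l i / A - wt u (poi m) (mix b m w l₁ l₂) i * tilt b m l i / F := by
    intro l A hl hA i
    refine gibbs_term_le (div_nonneg (mul_nonneg (wt_pos hp hM i).le (tilt_nonneg hl i)) hF.le) ?_
    rw [Real.exp_add, Real.exp_sub, Real.exp_add, Real.exp_sub, Real.exp_log hA, Real.exp_log hF,
      hwt, Real.exp_neg, tilt]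
    have := (Real.exp_pos (u * K i)).ne'
    have := (Real.exp_pos (b * |l - m|)).ne'
    field_simp
  have hmid : ∀ i, X₀ i * (v' i - Real.log A₀ - (1 - u) * K i + Real.log F) ≤
      Real.exp (v' i) * poi m i / A₀ - X₀ i := by
    intro i
    refine gibbs_term_le (div_nonneg (mul_nonneg (Real.exp_pos _).le (hp i).le) hF.le) ?_
    rw [Real.exp_add, Real.exp_sub, Real.exp_sub, Real.exp_log hA₀, Real.exp_log hF]
    have := (Real.exp_pos ((1 - u) * K i)).ne'
    simp only [hX₀]
    field_simp
  have hL := ((((hsX₁.mul_left (w * (-Real.log A₁ - b * |l₁ - m| + Real.log F))).add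
    (hsX₂.mul_left ((1 - w) * (-Real.log A₂ - b * |l₂ - m| + Real.log F)))).add
      (hsK.mul_left u)).mul_left (1 - θ)).add
    (((hsX₀.mul_left (-Real.log A₀ + Real.log F)).sub (hsK.mul_left (1 - u))).mul_left θ)
  have hR := ((((hY₁.sub hsX₁).mul_left w).add ((hY₂.sub hsX₂).mul_left (1 - w))).mul_left
    (1 - θ)).add ((hY₀.sub hsX₀).mul_left θ)
  have hw0 := hS.w_mem.1
  have hw1 : 0 < 1 - w := by linarith [hS.w_mem.2]
  have hθ1 : 0 ≤ 1 - θ := by linarith [hθ.2]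
  have hle := hasSum_le (fun i => ?_) hL hR
  · linarith
  · have q1 := mul_le_mul_of_nonneg_left (hside l₁ A₁ hS.l₁_nonneg hA₁ i) hw0.le
    have q2 := mul_le_mul_of_nonneg_left (hside l₂ A₂ hS.l₂_pos.le hA₂ i) hw1.le
    have q3 := mul_le_mul_of_nonneg_left (add_le_add q1 q2) hθ1
    have q4 := mul_le_mul_of_nonneg_left (hmid i) hθ.1
    refine le_trans (le_of_eq ?_) (add_le_add q3 q4)
    change _ = (1 - θ) * (w * (X₁ i * _) + (1 - w) * (X₂ i * _)) + _
    have hXi := hX i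
    have hvi := hv i
    linear_combination ((1 - θ) * (-v i - u * K i)) * hXi - X₀ i * hvi

end

/-! ### Upper and lower bounds for the original program -/

section
variable {J : Type*} [Fintype J] {y : J → ℝ} {h : J → ℕ} {k ε u b : ℝ} {w l₁ l₂ : J → ℝ}

/-- The table of log densities is tested at the exponents `-u` and `1 - u`. Adding a constant to all
coefficients transfers error between the two sides, and the right constant makes both bounds equal
to the nested value. -/
theorem relaxedValue_le (hk : 0 < k) (hy : ∀ j, 0 < y j) (hH : 0 < ∑ j, (h j : ℝ))
    (hu : u ∈ Ioo (0 : ℝ) 1) (hb : 0 < b)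
    (hS : ∀ j, IsSaddle u b (k * y j) (w j) (l₁ j) (l₂ j)) :
    relaxedValue y h k ε ≤ ((ε * (-(k * b)) * (1 - u) + ∑ j, (h j : ℝ) *
      Real.log (aff u (poi (k * y j)) (mix b (k * y j) (w j) (l₁ j) (l₂ j))) : ℝ) : EReal) := by
  have hF := fun j => (hS j).aff_pos hu (mul_pos hk (hy j))
  set H := ∑ j, (h j : ℝ) with hHd
  -- The shift solves `-u s H - ε k b = (1 - u) s H`, equalizing the two bounds.
  set s : ℝ := -(ε * (k * b)) / H with hs
  have hsH : s * H = -(ε * (k * b)) := by rw [hs]; field_simp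
  set c : ℕ → J → ℝ := fun i j =>
    Real.log (mix b (k * y j) (w j) (l₁ j) (l₂ j) i / poi (k * y j) i) + s with hc
  refine (iInf_le _ c).trans (max_le (iSup_le fun Q => iSup_le fun hQ => ?_) ?_)
  · refine ((iInf_le _ (-u)).trans (iInf_le _ (by linarith [hu.1]))).trans ?_
    have hterm : ∀ j, (Q j).sum (fun x r => ((r : ℝ) : EReal) *
        logMGF (fun i => -u * c i j) (k * x)) ≤
        (((Q j).sum (fun _ r => (r : ℝ)) * (-u * s +
          Real.log (aff u (poi (k * y j)) (mix b (k * y j) (w j) (l₁ j) (l₂ j)))) -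
          k * b * (Q j).sum (fun x r => (r : ℝ) * |(x : ℝ) - y j|) : ℝ) : EReal) := by
      intro j
      unfold Finsupp.sum
      rw [Finset.sum_mul, Finset.mul_sum, ← Finset.sum_sub_distrib, ereal_coe_finset_sum]
      refine Finset.sum_le_sum fun x _ => ?_
      obtain ⟨e1, e2⟩ := (hS j).sup_le hk (hy j) hu (κ := fun i => c i j) (c := s)
        (fun i => rfl) x.coe_nonneg
      dsimp only
      rw [logMGF_of_summable (mul_nonneg hk.le x.coe_nonneg) e1, ← EReal.coe_mul,
        EReal.coe_le_coe_iff]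
      have := mul_le_mul_of_nonneg_left e2 (Q j x).coe_nonneg
      linarith
    refine (Finset.sum_le_sum fun j _ => hterm j).trans ?_
    rw [← ereal_coe_finset_sum, EReal.coe_le_coe_iff]
    have hmass : ∀ j, (Q j).sum (fun _ r => (r : ℝ)) = h j := by
      intro j
      have := congrArg (fun r : ℝ≥0 => (r : ℝ)) (hQ.1 j)
      simpa [Finsupp.sum] using this
    simp only [hmass]
    rw [Finset.sum_sub_distrib, ← Finset.mul_sum]
    have e3 : ∑ j, (h j : ℝ) * (-u * s +
        Real.log (aff u (poi (k * y j)) (mix b (k * y j) (w j) (l₁ j) (l₂ j)))) = -u * (s * H) +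
        ∑ j, (h j : ℝ) *
          Real.log (aff u (poi (k * y j)) (mix b (k * y j) (w j) (l₁ j) (l₂ j))) := by
      rw [hHd, Finset.mul_sum, Finset.mul_sum, ← Finset.sum_add_distrib]
      exact Finset.sum_congr rfl fun j _ => by ring
    have := mul_le_mul_of_nonneg_left hQ.2 (mul_pos hk hb).le
    rw [e3, hsH]
    linarith
  · refine ((iInf_le _ (1 - u)).trans (iInf_le _ (by linarith [hu.2]))).trans ?_
    have hterm : ∀ j, ((h j : ℝ) : EReal) * logMGF (fun i => (1 - u) * c i j) (k * y j) =
        ((h j * ((1 - u) * s + Real.log (aff u (poi (k * y j))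
          (mix b (k * y j) (w j) (l₁ j) (l₂ j)))) : ℝ) : EReal) := by
      intro j
      rw [logMGF_of_hasSum (mul_pos hk (hy j)).le
        ((hS j).hasSum_exp hk (hy j) hu (κ := fun i => c i j) (c := s) fun i => rfl),
        Real.log_mul (Real.exp_pos _).ne' (hF j).ne', Real.log_exp, ← EReal.coe_mul]
    simp only [hterm]
    rw [← ereal_coe_finset_sum, EReal.coe_le_coe_iff]
    have e3 : ∑ j, (h j : ℝ) * ((1 - u) * s +
        Real.log (aff u (poi (k * y j)) (mix b (k * y j) (w j) (l₁ j) (l₂ j)))) =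
        (1 - u) * (s * H) + ∑ j, (h j : ℝ) *
          Real.log (aff u (poi (k * y j)) (mix b (k * y j) (w j) (l₁ j) (l₂ j))) := by
      rw [hHd, Finset.mul_sum, Finset.mul_sum, ← Finset.sum_add_distrib]
      exact Finset.sum_congr rfl fun j _ => by ring
    rw [e3, hsH]
    linarith

theorem coe_mul_logMGF_ne_bot {a l : ℝ} {c : ℕ → ℝ} (ha : 0 < a) (hl : 0 ≤ l) :
    (a : EReal) * logMGF c l ≠ ⊥ := by
  intro hbot
  rw [EReal.mul_eq_bot] at hbot
  rcases hbot with h | h | h | h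
  · exact EReal.coe_ne_bot _ h.1
  · exact logMGF_ne_bot hl h.2
  · exact EReal.coe_ne_top _ h.1
  · exact absurd (EReal.coe_neg'.1 h.1) (by linarith)

theorem summable_of_coe_mul_logMGF_ne_top {a l : ℝ} {c : ℕ → ℝ} (ha : 0 < a) (hl : 0 ≤ l)
    (h : (a : EReal) * logMGF c l ≠ ⊤) : Summable fun i => Real.exp (c i) * poi l i := by
  refine summable_of_logMGF_ne_top hl fun ht => h ?_
  rw [ht, EReal.coe_mul_top_of_pos ha]

/-- Against every table the adversary plays the saddle histogram, which splits class `j` into masses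
`h w` and `h (1 - w)` at `l₁ / k` and `l₂ / k`; `hdist` makes its distance exactly `ε`. If both
Chernoff bounds were below `V`, a convex combination of them would contradict `gibbs_le`. -/
theorem le_relaxedValue (hk : 0 < k) (hy : ∀ j, 0 < y j) (hh : ∀ j, 0 < h j)
    (hu : u ∈ Ioo (0 : ℝ) 1)
    (hS : ∀ j, IsSaddle u b (k * y j) (w j) (l₁ j) (l₂ j))
    (hdist : ∑ j, (h j : ℝ) * (w j * |l₁ j - k * y j| + (1 - w j) * |l₂ j - k * y j|) = ε * k)
    (hmean : ∑ j, (h j : ℝ) *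
      ((∑' i, Real.log (mix b (k * y j) (w j) (l₁ j) (l₂ j) i / poi (k * y j) i) *
      (Real.exp ((1 - u) * Real.log (mix b (k * y j) (w j) (l₁ j) (l₂ j) i / poi (k * y j) i)) *
        poi (k * y j) i)) / aff u (poi (k * y j)) (mix b (k * y j) (w j) (l₁ j) (l₂ j))) =
      ε * (k * b))
    (hneg : ε * (-(k * b)) * (1 - u) + ∑ j, (h j : ℝ) *
      Real.log (aff u (poi (k * y j)) (mix b (k * y j) (w j) (l₁ j) (l₂ j))) < 0) :
    ((ε * (-(k * b)) * (1 - u) + ∑ j, (h j : ℝ) *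
      Real.log (aff u (poi (k * y j)) (mix b (k * y j) (w j) (l₁ j) (l₂ j))) : ℝ) : EReal) ≤
      relaxedValue y h k ε := by
  set V := ε * (-(k * b)) * (1 - u) + ∑ j, (h j : ℝ) *
      Real.log (aff u (poi (k * y j)) (mix b (k * y j) (w j) (l₁ j) (l₂ j))) with hV
  have hm := fun j => mul_pos hk (hy j)
  have hh' : ∀ j, (0 : ℝ) < h j := fun j => by exact_mod_cast hh j
  have hw0 := fun j => (hS j).w_mem.1
  have hw1 : ∀ j, 0 < 1 - w j := fun j => by linarith [(hS j).w_mem.2]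
  refine le_iInf fun c => le_of_not_gt fun hlt => ?_
  obtain ⟨hfar, hnull⟩ := max_lt_iff.1 hlt
  set x₁ : J → ℝ≥0 := fun j => ⟨l₁ j / k, div_nonneg (hS j).l₁_nonneg hk.le⟩ with hx₁
  set x₂ : J → ℝ≥0 := fun j => ⟨l₂ j / k, div_nonneg (hS j).l₂_pos.le hk.le⟩ with hx₂
  set a₁ : J → ℝ≥0 := fun j => ⟨h j * w j, (mul_pos (hh' j) (hw0 j)).le⟩ with ha₁
  set a₂ : J → ℝ≥0 := fun j => ⟨h j * (1 - w j), (mul_pos (hh' j) (hw1 j)).le⟩ with ha₂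
  set Q : J → ℝ≥0 →₀ ℝ≥0 := fun j => Finsupp.single (x₁ j) (a₁ j) + Finsupp.single (x₂ j) (a₂ j)
    with hQ
  have hQfar : IsFarHistogram y h ε Q := by
    constructor
    · intro j
      rw [hQ, Finsupp.sum_add_index' (fun _ => rfl) (fun _ _ _ => rfl),
        Finsupp.sum_single_index rfl, Finsupp.sum_single_index rfl]
      apply NNReal.coe_injective
      change (h j : ℝ) * w j + h j * (1 - w j) = ((h j : ℝ≥0) : ℝ)
      rw [NNReal.coe_natCast]; ring
    · have hterm : ∀ j, (Q j).sum (fun x r => (r : ℝ) * |(x : ℝ) - y j|) =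
          (h j * (w j * |l₁ j - k * y j| + (1 - w j) * |l₂ j - k * y j|)) / k := by
        intro j
        have hl : ∀ l : ℝ, |l / k - y j| = |l - k * y j| / k := fun l => by
          have : l / k - y j = (l - k * y j) / k := by field_simp
          rw [this, abs_div, abs_of_pos hk]
        rw [hQ, Finsupp.sum_add_index' (fun _ => by simp)
          (fun _ _ _ => by rw [NNReal.coe_add, add_mul]),
          Finsupp.sum_single_index (by simp), Finsupp.sum_single_index (by simp)]
        change (h j : ℝ) * w j * |l₁ j / k - y j| + h j * (1 - w j) * |l₂ j / k - y j| = _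
        rw [hl, hl]; ring
      simp only [hterm]
      rw [← Finset.sum_div, hdist, mul_div_cancel_right₀ _ hk.ne']
  have hfar' : logErrFar k c Q < (V : EReal) :=
    (le_iSup₂ (f := fun (Q : J → ℝ≥0 →₀ ℝ≥0) (_ : IsFarHistogram y h ε Q) => logErrFar k c Q)
      Q hQfar).trans_lt hfar
  simp only [logErrFar, logErrNull, iInf_lt_iff] at hfar' hnull
  obtain ⟨t, ht, hfar'⟩ := hfar'
  obtain ⟨t', ht', hnull⟩ := hnull
  have hQterm : ∀ j, (Q j).sum (fun x r => ((r : ℝ) : EReal) * logMGF (fun i => t * c i j) (k * x)) =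
      ((h j * w j : ℝ) : EReal) * logMGF (fun i => t * c i j) (l₁ j) +
        ((h j * (1 - w j) : ℝ) : EReal) * logMGF (fun i => t * c i j) (l₂ j) := by
    intro j
    rw [hQ, Finsupp.sum_add_index' (fun _ => by simp) (fun _ r₁ r₂ => by
        rw [NNReal.coe_add, EReal.coe_add, EReal.right_distrib_of_nonneg
          (EReal.coe_nonneg.2 r₁.coe_nonneg) (EReal.coe_nonneg.2 r₂.coe_nonneg)]),
      Finsupp.sum_single_index (by simp), Finsupp.sum_single_index (by simp)]
    change ((h j * w j : ℝ) : EReal) * logMGF (fun i => t * c i j) (k * (l₁ j / k)) +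
      ((h j * (1 - w j) : ℝ) : EReal) * logMGF (fun i => t * c i j) (k * (l₂ j / k)) = _
    rw [mul_div_cancel₀ _ hk.ne', mul_div_cancel₀ _ hk.ne']
  simp only [hQterm] at hfar'
  have nb₁ := fun j => coe_mul_logMGF_ne_bot (c := fun i => t * c i j) (mul_pos (hh' j) (hw0 j))
    (hS j).l₁_nonneg
  have nb₂ := fun j => coe_mul_logMGF_ne_bot (c := fun i => t * c i j) (mul_pos (hh' j) (hw1 j))
    (hS j).l₂_pos.le
  have nb₀ := fun j => coe_mul_logMGF_ne_bot (c := fun i => t' * c i j) (hh' j) (hm j).le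
  have s₁₂ : ∀ j, Summable (fun i => Real.exp (t * c i j) * poi (l₁ j) i) ∧
      Summable (fun i => Real.exp (t * c i j) * poi (l₂ j) i) := by
    intro j
    have hnt : ((h j * w j : ℝ) : EReal) * logMGF (fun i => t * c i j) (l₁ j) +
        ((h j * (1 - w j) : ℝ) : EReal) * logMGF (fun i => t * c i j) (l₂ j) ≠ ⊤ := fun htop =>
      absurd hfar' (by
        rw [ereal_sum_eq_top _ _ (fun i _ => by
          rw [Ne, EReal.add_eq_bot_iff, not_or]; exact ⟨nb₁ i, nb₂ i⟩) (Finset.mem_univ j) htop]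
        exact not_top_lt)
    constructor
    · refine summable_of_coe_mul_logMGF_ne_top (mul_pos (hh' j) (hw0 j)) (hS j).l₁_nonneg
        fun htop => hnt ?_
      rw [htop]; exact EReal.top_add_of_ne_bot (nb₂ j)
    · refine summable_of_coe_mul_logMGF_ne_top (mul_pos (hh' j) (hw1 j)) (hS j).l₂_pos.le
        fun htop => hnt ?_
      rw [htop]; exact EReal.add_top_of_ne_bot (nb₁ j)
  have s₀ : ∀ j, Summable fun i => Real.exp (t' * c i j) * poi (k * y j) i := fun j =>
    summable_of_coe_mul_logMGF_ne_top (hh' j) (hm j).le fun htop => absurd hnull (by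
      rw [ereal_sum_eq_top _ _ (fun i _ => nb₀ i) (Finset.mem_univ j) htop]
      exact not_top_lt)
  simp only [logMGF_of_summable (hS _).l₁_nonneg (s₁₂ _).1,
    logMGF_of_summable (hS _).l₂_pos.le (s₁₂ _).2, ← EReal.coe_mul, ← EReal.coe_add] at hfar'
  simp only [logMGF_of_summable (hm _).le (s₀ _), ← EReal.coe_mul] at hnull
  rw [← ereal_coe_finset_sum, EReal.coe_lt_coe_iff] at hfar' hnull
  -- At exponent `0` the bound is `0`, which is not below the negative number `V`.
  have ht0 : t < 0 := lt_of_le_of_ne ht fun h0 => by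
    subst h0
    simp [(hasSum_poi _).tsum_eq] at hfar'
    linarith
  have ht0' : 0 < t' := lt_of_le_of_ne ht' fun h0 => by
    subst h0
    simp [(hasSum_poi _).tsum_eq] at hnull
    linarith
  have htt : 0 < -t + t' := by linarith
  -- This weight satisfies `(1 - θ) t + θ t' = 0`, so the unknown table drops out of the combined
  -- Gibbs inequality.
  set θ : ℝ := -t / (-t + t') with hθ
  have hθ0 : 0 < θ := div_pos (by linarith) htt
  have hθ1 : 1 - θ = t' / (-t + t') := by rw [hθ]; field_simp; ring
  have hθ1' : 0 < 1 - θ := by rw [hθ1]; exact div_pos ht0' htt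
  have hg := fun j => mul_le_mul_of_nonneg_left ((hS j).gibbs_le hu (hm j) (θ := θ)
    ⟨hθ0.le, by linarith⟩ (v := fun i => t * c i j) (v' := fun i => t' * c i j)
    (fun i => by rw [hθ1, hθ]; field_simp; ring) (s₁₂ j).1 (s₁₂ j).2 (s₀ j)) (hh' j).le
  have hsum := Finset.sum_le_sum fun j (_ : j ∈ (Finset.univ : Finset J)) => hg j
  set T : J → ℝ := fun j =>
      ((∑' i, Real.log (mix b (k * y j) (w j) (l₁ j) (l₂ j) i / poi (k * y j) i) *
      (Real.exp ((1 - u) * Real.log (mix b (k * y j) (w j) (l₁ j) (l₂ j) i / poi (k * y j) i)) *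
        poi (k * y j) i)) / aff u (poi (k * y j)) (mix b (k * y j) (w j) (l₁ j) (l₂ j))) with hT
  set F : J → ℝ := fun j =>
    Real.log (aff u (poi (k * y j)) (mix b (k * y j) (w j) (l₁ j) (l₂ j))) with hF
  set D : J → ℝ := fun j => w j * |l₁ j - k * y j| + (1 - w j) * |l₂ j - k * y j| with hD
  set L : J → ℝ := fun j => h j * w j * Real.log (∑' i, Real.exp (t * c i j) * poi (l₁ j) i) +
    h j * (1 - w j) * Real.log (∑' i, Real.exp (t * c i j) * poi (l₂ j) i) with hL
  set L' : J → ℝ := fun j => h j * Real.log (∑' i, Real.exp (t' * c i j) * poi (k * y j) i) with hL'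
  have e : ∑ j, ((1 - θ) * (-L j + u * (h j * T j) - b * (h j * D j) + h j * F j) +
      θ * (-L' j - (1 - u) * (h j * T j) + h j * F j)) ≤ 0 := by
    refine le_trans (le_of_eq (Finset.sum_congr rfl fun j _ => ?_)) (hsum.trans (by simp))
    simp only [hL, hL', hT, hF, hD]
    ring
  simp only [Finset.sum_add_distrib, ← Finset.mul_sum, Finset.sum_sub_distrib,
    Finset.sum_neg_distrib] at e
  have hmean' : ∑ j, (h j : ℝ) * T j = ε * (k * b) := hmean
  have hdist' : ∑ j, (h j : ℝ) * D j = ε * k := hdist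
  have hVF : V = ε * (-(k * b)) * (1 - u) + ∑ j, (h j : ℝ) * F j := hV
  rw [hmean', hdist'] at e
  have q1 : 0 < (1 - θ) * (V - ∑ j, L j) := mul_pos hθ1' (by linarith)
  have q2 : 0 < θ * (V - ∑ j, L' j) := mul_pos hθ0 (by linarith)
  rw [hVF] at q1 q2
  linarith

end

end SemilinearTest

/-! ### Assembly of the main theorem -/

theorem mainTheorem2 {J : Type*} [Fintype J] [DecidableEq J]
    (y : J → ℝ) (h : J → ℕ) (k ε : ℝ)
    (hy_inj : Function.Injective y) (hy_pos : ∀ j, 0 < y j) (hh_pos : ∀ j, 0 < h j)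
    (h_total : ∑ j, (h j : ℝ) * y j = 1) (hk : 0 < k) (hε : 0 < ε) :
    (∃ (α u : ℝ) (κ : ℕ → J → ℝ), SemilinearTest.IsNestedOptimum y h k ε α u κ) ∧
    ∀ (α u : ℝ) (κ : ℕ → J → ℝ), SemilinearTest.IsNestedOptimum y h k ε α u κ →
      α < 0 ∧ u ∈ Set.Ioo (0 : ℝ) 1 ∧
      ∃ q x₁ x₂ : J → ℝ,
        (∀ j, q j ∈ Set.Ioo (0 : ℝ) 1 ∧ 0 ≤ x₁ j ∧ x₁ j < y j ∧ y j < x₂ j) ∧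
        SemilinearTest.IsNestedOptimum y h k ε α u
          (fun i j => SemilinearTest.twoPointCoeff k (y j) (q j) (x₁ j) (x₂ j) i) ∧
        (∀ j, ∃ s : ℝ, ∀ i,
          κ i j = SemilinearTest.twoPointCoeff k (y j) (q j) (x₁ j) (x₂ j) i + s) ∧
        SemilinearTest.nestedValue y h k ε =
          ((SemilinearTest.explicitValue y h k ε α u q x₁ x₂ : ℝ) : EReal) ∧
        SemilinearTest.relaxedValue y h k ε =
          ((SemilinearTest.explicitValue y h k ε α u q x₁ x₂ : ℝ) : EReal) ∧
        HasDerivAt (fun a => SemilinearTest.explicitValue y h k ε a u q x₁ x₂) 0 α ∧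
        HasDerivAt (fun v => SemilinearTest.explicitValue y h k ε α v q x₁ x₂) 0 u ∧
        ∀ j, HasDerivAt (fun r => SemilinearTest.explicitValue y h k ε α u
          (Function.update q j r) x₁ x₂) 0 (q j) := by
  -- The normalization of the probabilities rules out an empty index set; at least one class is
  -- needed for the objective to become `⊤` outside the unit square.
  have : Nonempty J := by
    by_contra hJ
    rw [not_nonempty_iff] at hJ
    simp at h_total
  have hH : 0 < ∑ j, (h j : ℝ) :=
    Finset.sum_pos (fun j _ => by exact_mod_cast hh_pos j) Finset.univ_nonempty
  constructor
  · obtain ⟨α, u, hα, hu, he⟩ := SemilinearTest.exists_outerObj_eq_nestedValue (ε := ε) hk hy_pos hh_pos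
    obtain ⟨hu', b, hb, rfl⟩ := SemilinearTest.exists_eq_of_outerObj_eq hk hy_pos hh_pos hε hα hu he
    choose w l₁ l₂ hS using fun j => SemilinearTest.exists_isSaddle hu' hb (mul_pos hk (hy_pos j))
    refine ⟨-(k * b), u, fun i j =>
      Real.log (SemilinearTest.mix b (k * y j) (w j) (l₁ j) (l₂ j) i / SemilinearTest.poi (k * y j) i), hα, hu, he, fun j =>
      le_antisymm ?_ (iInf_le _ _)⟩
    rw [SemilinearTest.innerValue_saddle hk (hy_pos j) hu' (hh_pos j) (hS j)]
    exact SemilinearTest.innerObj_saddle_le hk (hy_pos j) hu' (hS j) 0 fun i => (add_zero _).symm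
  · rintro α u κ ⟨hα, hu, he, hin⟩
    obtain ⟨hu', b, hb, rfl⟩ := SemilinearTest.exists_eq_of_outerObj_eq hk hy_pos hh_pos hε hα hu he
    choose w l₁ l₂ hS using fun j => SemilinearTest.exists_isSaddle hu' hb (mul_pos hk (hy_pos j))
    have hm := fun j => mul_pos hk (hy_pos j)
    have hdist := SemilinearTest.sum_dist_eq hk hy_pos hh_pos hu' hb hS he
    have hmean := SemilinearTest.sum_mean_log_eq hk hy_pos hu' hb hh_pos hS he
    have hval : SemilinearTest.nestedValue y h k ε = _ := he.symm.trans (SemilinearTest.outerObj_saddle hk hy_pos hh_pos hu' hS)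
    have hneg := SemilinearTest.nestedValue_neg (h := h) hy_pos hk hε
    rw [hval] at hneg
    have hE := SemilinearTest.explicitValue_eq (h := h) (ε := ε) hk hS u
    refine ⟨neg_lt_zero.2 (mul_pos hk hb.1), hu',
      fun j => SemilinearTest.mixFreq b (k * y j) (w j) (l₁ j) (l₂ j), fun j => l₁ j / k, fun j => l₂ j / k,
      fun j => ⟨SemilinearTest.mixFreq_mem (hS j).w_mem, div_nonneg (hS j).l₁_nonneg hk.le, ?_, ?_⟩,
      ⟨hα, hu, he, fun j => le_antisymm ?_ (iInf_le _ _)⟩, fun j => ?_, ?_, ?_,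
      SemilinearTest.hasDerivAt_explicitValue_alpha hk hy_pos hu' hS hdist,
      SemilinearTest.hasDerivAt_explicitValue_u hk hy_pos hu' hS hmean,
      SemilinearTest.hasDerivAt_explicitValue_q hk hy_pos hu' hS⟩
    · rw [div_lt_iff₀' hk]; exact (hS j).l₁_lt
    · rw [lt_div_iff₀' hk]; exact (hS j).lt_l₂
    · rw [SemilinearTest.innerValue_saddle hk (hy_pos j) hu' (hh_pos j) (hS j)]
      exact SemilinearTest.innerObj_saddle_le hk (hy_pos j) hu' (hS j) _
        fun i => SemilinearTest.twoPointCoeff_eq hk (hy_pos j) (hS j) i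
    -- Optimality of `κ` is equality in weak duality against the saddle mixture, which determines
    -- `κ` up to a constant; the normalizer `mixMass` accounts for the passage from `w` to `q`.
    · obtain ⟨c, hc⟩ := (SemilinearTest.log_aff_mix_le_innerObj (κ := fun i => κ i j) (b := b) hk (hy_pos j) hu'
        (hh_pos j) (hS j).w_mem' (hS j).l₁_nonneg (hS j).l₂_pos).2 (by
          rw [hin j, SemilinearTest.innerValue_saddle hk (hy_pos j) hu' (hh_pos j) (hS j)])
      refine ⟨c + Real.log (SemilinearTest.mixMass b (k * y j) (w j) (l₁ j) (l₂ j)), fun i => ?_⟩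
      rw [SemilinearTest.twoPointCoeff_eq hk (hy_pos j) (hS j) i, hc i]
      ring
    · rw [hE, hval]
    · rw [hE]
      exact le_antisymm (SemilinearTest.relaxedValue_le hk hy_pos hH hu' hb.1 hS)
        (SemilinearTest.le_relaxedValue hk hy_pos hh_pos hu' hS hdist hmean (EReal.coe_neg'.1 hneg))
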